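/- Let $M$ be a connected, orientable, closed (compact, boundaryless, Hausdorff, second countable) $C^\infty$ manifold of dimension $n\ge 2$ with a $C^\infty$ volume form $\omega$. For an open set $A\subset M$ and $s\in\mathbb Z^+\cup\{\infty\}$, let $\mathfrak X^s_\mu(A)$ be the set of $C^s$ vector fields on $A$ that are divergence-free with respect to $\omega$; that is, in every smooth chart in which $\omega=\rho\,dy_1\wedge\dots\wedge dy_n$, the components $X^i$ of the field satisfy $\sum_i\partial_i(\rho X^i)=0$. A finite regular atlas of $M$ is a finite family $(V_j,\phi_j)_{j\le m}$ of smooth charts whose domains $V_j$ cover $M$ and such that each $\phi_j$ is the restriction of a smooth chart defined on an open set containing $\overline{V_j}$. Relative to such an atlas, the Whitney $C^r$ norm on $A$ of a vector field $X$ with chart expressions $X_j:\phi_j(V_j\cap A)\to\mathbb R^n$ is $$\|X\|_{C^r;A}=\max_{j\le m,\ 0\le k\le r}\ \sup_{\phi_j(V_j\cap A)}\|D^kX_j\|,$$ with the Euclidean operator norm of $D^kX_j$; write $\|X\|_{C^r}$ if $A=M$, and call $X$ $C^r$-bounded on $A$ if $\|X\|_{C^r;A}<\infty$. **Theorem.**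 Let $K\subset M$ be compact and let $U\subsetneq M$ be an open neighbourhood of $K$ such that $U\setminus K$ is connected. Then there is an open set $V$ with $K\subset V\subset U$, depending only on $K$ and $U$ (for the given $M$ and $\omega$), such that for every finite regular atlas of $M$ and every integer $r\ge 1$ there is a constant $C>1$, depending only on $r$, $K$, $U$ (for the given $M$, $\omega$ and atlas), with the following property. For every $s\in\mathbb Z^+\cup\{\infty\}$ with $s\ge r$, every $X\in\mathfrak X^s_\mu(M)$ and every $C^r$-bounded $Y\in\mathfrak X^s_\mu(U)$, there is $Z\in\mathfrak X^s_\mu(M)$ such that 1. $Z=Y$ in $V$; 2. $Z=X$ in a neighbourhood of $U^c=M\setminus U$; 3. $\|Z-X\|_{C^r}\le C\,\|Y-X\|_{C^r;U}$; 4. $Z$ is $C^\infty$ at every point where it coincides neither with $X$ nor with $Y$. -/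

import Mathlib

open scoped Manifold ContDiff Topology NNReal

noncomputable section

namespace ConservativePasting

variable {n : ℕ} {M : Type*} [TopologicalSpace M] [ChartedSpace (EuclideanSpace ℝ (Fin n)) M]

/-- The expression of a vector field `X` in a chart `e`: the push-forward of `X` by `e`, a map
defined on the target of `e` (values off the target are irrelevant). -/
def chartField (e : OpenPartialHomeomorph M (EuclideanSpace ℝ (Fin n)))
    (X : ∀ x : M, TangentSpace (𝓡 n) x) (y : EuclideanSpace ℝ (Fin n)) :
    EuclideanSpace ℝ (Fin n) :=
  mfderiv (𝓡 n) (𝓡 n) e (e.symm y) (X (e.symm y))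

/-- The coefficient of an `n`-form in a chart `e`, that is, the function `ρ` for which the form
reads `ρ dy₁ ∧ ⋯ ∧ dyₙ` on the target of `e`. -/
def chartDensity (e : OpenPartialHomeomorph M (EuclideanSpace ℝ (Fin n)))
    (vol : ∀ x : M, TangentSpace (𝓡 n) x [⋀^Fin n]→ₗ[ℝ] ℝ) (y : EuclideanSpace ℝ (Fin n)) : ℝ :=
  vol (e.symm y) fun i =>
    mfderiv (𝓡 n) (𝓡 n) e.symm y (EuclideanSpace.single i (1 : ℝ) : EuclideanSpace ℝ (Fin n))

variable (n M) in
/-- A `C^∞` volume form: a smooth nowhere vanishing form of degree `n` on the `n`-manifold `M`. -/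
structure VolumeForm where
  form : ∀ x : M, TangentSpace (𝓡 n) x [⋀^Fin n]→ₗ[ℝ] ℝ
  smooth : ∀ e ∈ IsManifold.maximalAtlas (𝓡 n) ∞ M, ContDiffOn ℝ ∞ (chartDensity e form) e.target
  ne_zero : ∀ x, form x ≠ 0

/-- The divergence of `X` with respect to `vol` at a point of the source of the chart `e`, computed
in `e`: `ρ⁻¹ ∑ i, ∂ᵢ (ρ Xⁱ)`, where `vol = ρ dy₁ ∧ ⋯ ∧ dyₙ` in `e`. -/
def chartDivergence (vol : VolumeForm n M) (e : OpenPartialHomeomorph M (EuclideanSpace ℝ (Fin n)))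
    (X : ∀ x : M, TangentSpace (𝓡 n) x) (x : M) : ℝ :=
  (chartDensity e vol.form (e x))⁻¹ *
    ∑ i : Fin n, fderiv ℝ (fun y => chartDensity e vol.form y * chartField e X y i) (e x)
      (EuclideanSpace.single i 1)

/-- `X` is a vector field of class `C^s` on the open set `A`. Only the values of `X` on `A`
matter. -/
def IsFieldOn (s : ℕ∞) (A : Set M) [IsManifold (𝓡 n) 1 M]
    (X : ∀ x : M, TangentSpace (𝓡 n) x) : Prop :=
  ContMDiffOn (𝓡 n) (𝓡 n).tangent s (fun x => (⟨x, X x⟩ : TangentBundle (𝓡 n) M)) A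

/-- `X` is a vector field of class `C^s` on the open set `A` which is divergence-free with respect
to `vol`. Only the values of `X` on `A` matter. -/
def IsDivFreeFieldOn [IsManifold (𝓡 n) 1 M] (vol : VolumeForm n M) (s : ℕ∞) (A : Set M)
    (X : ∀ x : M, TangentSpace (𝓡 n) x) : Prop :=
  IsFieldOn s A X ∧
    ∀ e ∈ IsManifold.maximalAtlas (𝓡 n) ∞ M, ∀ x ∈ e.source ∩ A, chartDivergence vol e X x = 0

variable (n M) in
/-- A finite regular atlas of `M`: open sets `V i`, finite in number, that cover `M`, each with a
chart of the smooth structure of `M` whose domain contains the closure of `V i`. The local charts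
of the atlas are the restrictions of the maps `chart i` to `V i`. -/
structure RegularAtlas where
  card : ℕ
  chart : Fin card → OpenPartialHomeomorph M (EuclideanSpace ℝ (Fin n))
  V : Fin card → Set M
  chart_mem : ∀ i, chart i ∈ IsManifold.maximalAtlas (𝓡 n) ∞ M
  isOpen_V : ∀ i, IsOpen (V i)
  closure_subset : ∀ i, closure (V i) ⊆ (chart i).source
  cover : ⋃ i, V i = Set.univ

/-- The Whitney `C^r` norm of a vector field on the open set `A`, relative to a finite regular
atlas: the largest of the suprema, over the local charts, of the operator norms of the derivatives
of order at most `r` of the chart expressions of `X`. It is infinite if one of these is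
unbounded. -/
def whitneyNorm (𝒜 : RegularAtlas n M) (r : ℕ) (A : Set M)
    (X : ∀ x : M, TangentSpace (𝓡 n) x) : ENNReal :=
  ⨆ (j : Fin 𝒜.card) (k : ℕ) (_ : k ≤ r) (y ∈ 𝒜.chart j '' (𝒜.V j ∩ A)),
    ‖iteratedFDeriv ℝ k (chartField (𝒜.chart j) X) y‖ₑ

/-- A vector field is `C^r`-bounded on `A` if its Whitney `C^r` norm on `A` is finite. -/
def IsCrBoundedOn (𝒜 : RegularAtlas n M) (r : ℕ) (A : Set M)
    (X : ∀ x : M, TangentSpace (𝓡 n) x) : Prop :=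
  whitneyNorm 𝒜 r A X < ⊤

end ConservativePasting

end

/-! Put `W = Y - X` on `U`, and let `f` be a cut-off function equal to `1` near `K` and supported in
`U`. The interpolation `X + f W` coincides with `Y` near `K` and with `X` near the complement of
`U`, but its divergence is `div (f W) = df(W)`, which lives in a compact transition region `T ⊆ U \
K`. It has to be corrected by a field `v` with `div v = div (f W)`, with compact support in `U \ K`,
and with `C^r` size controlled by that of `W`. The field `X + f W - v` is then divergence-free, and
a final smoothing near `T` and the support of `v` yields the fourth property.

No derivative may be lost. Since `div W = 0`, the function `df(W)` contains no derivative of `W`, so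
a right inverse of the divergence that is bounded from `C^r` to `C^r` suffices. In a ball such an
inverse is elementary: the mass `g` is transported along segments to a multiple of a fixed bump `h`.
Each segment is cut at its midpoint. On the half near `g` the flux is written so that derivatives
fall on `g`, on the other half so that they fall on `h`; neither half has a singular kernel. The
midpoint densities cancel, whence `div F = g - (∫ g) h` (`ediv_ballSolution`,
`exists_ballSolution_bound`).

To globalize, `div (f W)` is split by a partition of unity into parts carried by chart balls. Each
part leaves a multiple of a bump in its ball, and connectedness of `U \ K` allows it to be replaced
by a multiple of one reference bump, up to the divergence of a fixed compactly supported field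
(`exists_local_primitive`). The total leftover multiple vanishes because the integral of a
divergence over `M` is zero (`eq_zero_of_divergence_eq`). This is `exists_divergence_solver`.

The smoothing (`exists_smoothing`) averages over `z` the pull-backs of the flux by the maps `x ↦ x +
τ ε(x) z`. Pull-backs respect vanishing divergence. Where `ε > 0` the average is an integral against
a smooth kernel, where `ε = 0` nothing changes, and small `τ` makes the change small in `C^r`.
Finitely many chart balls are treated one after the other. -/

noncomputable section

set_option linter.unusedSectionVars false

namespace ConservativePasting

open MeasureTheory Set Metric

/-! ### `C^r` bounds at a point for products and compositions. -/

section PointwiseBounds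

variable {D F F' : Type*} [NormedAddCommGroup D] [NormedSpace ℝ D]
  [NormedAddCommGroup F] [NormedSpace ℝ F] [NormedAddCommGroup F'] [NormedSpace ℝ F']

lemma sum_choose_mul_le {r k : ℕ} (hk : k ≤ r) {a b : ℝ} (ha : 0 ≤ a) (hb : 0 ≤ b)
    {α β : ℕ → ℝ} (hα0 : ∀ i, 0 ≤ α i) (hβ0 : ∀ i, 0 ≤ β i)
    (hα : ∀ i ≤ r, α i ≤ a) (hβ : ∀ i ≤ r, β i ≤ b) :
    ∑ i ∈ Finset.range (k + 1), (k.choose i : ℝ) * α i * β (k - i) ≤ 2 ^ r * a * b := by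
  calc ∑ i ∈ Finset.range (k + 1), (k.choose i : ℝ) * α i * β (k - i)
      ≤ ∑ i ∈ Finset.range (k + 1), (k.choose i : ℝ) * a * b := by
        refine Finset.sum_le_sum fun i hi => ?_
        have hik : i ≤ k := Nat.lt_succ_iff.1 (Finset.mem_range.1 hi)
        have h1 := hα i (hik.trans hk)
        have h2 := hβ (k - i) ((Nat.sub_le _ _).trans hk)
        have := hα0 i
        have := hβ0 (k - i)
        gcongr
    _ = 2 ^ k * a * b := by
        rw [← Finset.sum_mul, ← Finset.sum_mul]
        congr 2
        exact_mod_cast Nat.sum_range_choose k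
    _ ≤ 2 ^ r * a * b := by gcongr; norm_num

/-- A `C^r` bound at a point for the application of a family of linear maps to a vector-valued
map. -/
lemma norm_iteratedFDeriv_clm_apply_le_at {A : D → F →L[ℝ] F'} {u : D → F} {x : D} {r : ℕ}
    (hA : ContDiffAt ℝ r A x) (hu : ContDiffAt ℝ r u x) {a b : ℝ}
    (ha : ∀ i ≤ r, ‖iteratedFDeriv ℝ i A x‖ ≤ a) (hb : ∀ i ≤ r, ‖iteratedFDeriv ℝ i u x‖ ≤ b)
    {k : ℕ} (hk : k ≤ r) :
    ‖iteratedFDeriv ℝ k (fun y => A y (u y)) x‖ ≤ 2 ^ r * a * b := by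
  have h1 := (hA.eventually (by simp)).and (hu.eventually (by simp))
  obtain ⟨t, ht, hto, hxt⟩ := _root_.eventually_nhds_iff.1 h1
  have h := norm_iteratedFDerivWithin_clm_apply (n := k) (N := r)
    (fun y hy => (ht y hy).1.contDiffWithinAt) (fun y hy => (ht y hy).2.contDiffWithinAt)
    hto.uniqueDiffOn hxt (by exact_mod_cast hk)
  simp only [iteratedFDerivWithin_of_isOpen _ hto hxt] at h
  exact h.trans (sum_choose_mul_le hk ((norm_nonneg _).trans (ha 0 (Nat.zero_le _)))
    ((norm_nonneg _).trans (hb 0 (Nat.zero_le _)))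
    (fun _ => norm_nonneg _) (fun _ => norm_nonneg _) ha hb)

/-- A `C^r` bound at a point for a scalar multiple of a vector-valued map. -/
lemma norm_iteratedFDeriv_smul_le_at {f : D → ℝ} {u : D → F} {x : D} {r : ℕ}
    (hf : ContDiffAt ℝ r f x) (hu : ContDiffAt ℝ r u x) {a b : ℝ}
    (ha : ∀ i ≤ r, ‖iteratedFDeriv ℝ i f x‖ ≤ a) (hb : ∀ i ≤ r, ‖iteratedFDeriv ℝ i u x‖ ≤ b)
    {k : ℕ} (hk : k ≤ r) :
    ‖iteratedFDeriv ℝ k (fun y => f y • u y) x‖ ≤ 2 ^ r * a * b := by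
  have h1 := (hf.eventually (by simp)).and (hu.eventually (by simp))
  obtain ⟨t, ht, hto, hxt⟩ := _root_.eventually_nhds_iff.1 h1
  have h := norm_iteratedFDerivWithin_smul_le (n := k) (N := r)
    (fun y hy => (ht y hy).1.contDiffWithinAt) (fun y hy => (ht y hy).2.contDiffWithinAt)
    hto.uniqueDiffOn hxt (by exact_mod_cast hk)
  simp only [iteratedFDerivWithin_of_isOpen _ hto hxt] at h
  exact h.trans (sum_choose_mul_le hk ((norm_nonneg _).trans (ha 0 (Nat.zero_le _)))
    ((norm_nonneg _).trans (hb 0 (Nat.zero_le _)))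
    (fun _ => norm_nonneg _) (fun _ => norm_nonneg _) ha hb)

/-- A `C^r` bound at a point for a composition. -/
lemma norm_iteratedFDeriv_comp_le_at {u : F → F'} {ψ : D → F} {x : D} {r : ℕ}
    (hu : ContDiffAt ℝ r u (ψ x)) (hψ : ContDiffAt ℝ r ψ x) {a b : ℝ} (ha1 : 1 ≤ a)
    (ha : ∀ i, 1 ≤ i → i ≤ r → ‖iteratedFDeriv ℝ i ψ x‖ ≤ a)
    (hb : ∀ i ≤ r, ‖iteratedFDeriv ℝ i u (ψ x)‖ ≤ b) {k : ℕ} (hk : k ≤ r) :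
    ‖iteratedFDeriv ℝ k (fun y => u (ψ y)) x‖ ≤ r.factorial * b * a ^ r := by
  obtain ⟨t, ht, hto, hxt⟩ := _root_.eventually_nhds_iff.1 (hu.eventually (by simp))
  have h1 := (hψ.eventually (by simp)).and (hψ.continuousAt.eventually_mem (hto.mem_nhds hxt))
  obtain ⟨s, hs, hso, hxs⟩ := _root_.eventually_nhds_iff.1 h1
  have h := norm_iteratedFDerivWithin_comp_le (n := k) (N := r) (g := u) (f := ψ) (C := b) (D := a)
    (fun y hy => (ht y hy).contDiffWithinAt) (fun y hy => (hs y hy).1.contDiffWithinAt)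
    (by exact_mod_cast hk) hto.uniqueDiffOn hso.uniqueDiffOn (fun y hy => (hs y hy).2) hxs
    (fun i hi => by
      rw [iteratedFDerivWithin_of_isOpen _ hto hxt]; exact hb i (hi.trans hk))
    (fun i h1 hi => by
      rw [iteratedFDerivWithin_of_isOpen _ hso hxs]
      -- The composition estimate asks for the bound `a ^ i` on the derivative of order `i`; since
      -- `a ≥ 1` and `i ≥ 1`, the bound `a` is stronger.
      exact (ha i h1 (hi.trans hk)).trans (le_self_pow₀ ha1 (by omega)))
  rw [iteratedFDerivWithin_of_isOpen _ hso hxs] at h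
  have hb0 : 0 ≤ b := (norm_nonneg _).trans (hb 0 (Nat.zero_le _))
  refine h.trans ?_
  have := Nat.factorial_le hk
  gcongr

/-- The derivatives of a `C^r` map are uniformly bounded on a compact set. -/
lemma exists_iteratedFDeriv_bound {u : D → F} {Ω T : Set D} (hΩ : IsOpen Ω) (hT : IsCompact T)
    (hTΩ : T ⊆ Ω) (r : ℕ) (hu : ContDiffOn ℝ r u Ω) :
    ∃ C : ℝ, 1 ≤ C ∧ ∀ x ∈ T, ∀ i ≤ r, ‖iteratedFDeriv ℝ i u x‖ ≤ C := by
  have h : ∀ i ≤ r, ∃ C : ℝ, ∀ x ∈ T, ‖iteratedFDeriv ℝ i u x‖ ≤ C := by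
    intro i hi
    have hc : ContinuousOn (iteratedFDeriv ℝ i u) Ω :=
      (hu.continuousOn_iteratedFDerivWithin (by exact_mod_cast hi) hΩ.uniqueDiffOn).congr
        fun x hx => (iteratedFDerivWithin_of_isOpen _ hΩ hx).symm
    exact hT.exists_bound_of_continuousOn (hc.mono hTΩ)
  choose! C hC using h
  refine ⟨1 + ∑ i ∈ Finset.range (r + 1), |C i|, ?_, fun x hx i hi => ?_⟩
  · have : 0 ≤ ∑ i ∈ Finset.range (r + 1), |C i| := Finset.sum_nonneg fun _ _ => abs_nonneg _
    linarith
  · have h2 : |C i| ≤ ∑ i ∈ Finset.range (r + 1), |C i| :=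
      Finset.single_le_sum (f := fun i => |C i|) (fun _ _ => abs_nonneg _)
        (Finset.mem_range.2 (Nat.lt_succ_of_le hi))
    have := hC i hi x hx
    have := le_abs_self (C i)
    linarith

end PointwiseBounds

/-! ### Differentiation of integrals depending on a parameter. -/

section ParametricIntegral

variable {E P F : Type*} [NormedAddCommGroup E] [NormedSpace ℝ E] [ProperSpace E]
  [NormedAddCommGroup P] [NormedSpace ℝ P] [SecondCountableTopology P] [MeasurableSpace P]
  [BorelSpace P] [NormedAddCommGroup F] [NormedSpace ℝ F] [CompleteSpace F]

lemma iteratedFDeriv_partial {A : E × P → F} {s : WithTop ℕ∞} (hA : ContDiff ℝ s A) {k : ℕ}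
    (hk : (k : WithTop ℕ∞) ≤ s) (x : E) (p : P) :
    iteratedFDeriv ℝ k (fun x => A (x, p)) x =
      (iteratedFDeriv ℝ k A (x, p)).compContinuousLinearMap
        (fun _ => ContinuousLinearMap.inl ℝ E P) := by
  have h1 : (fun x => A (x, p)) =
      (fun z => A (z + (0, p))) ∘ (ContinuousLinearMap.inl ℝ E P) := by
    ext x; simp
  have h2 : ContDiff ℝ s (fun z : E × P => A (z + (0, p))) :=
    hA.comp (contDiff_id.add contDiff_const)
  rw [h1, ContinuousLinearMap.iteratedFDeriv_comp_right _ h2 _ hk, iteratedFDeriv_comp_add_right]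
  simp

lemma contDiff_iteratedFDeriv_partial {A : E × P → F} {s : WithTop ℕ∞} (hA : ContDiff ℝ s A)
    {k : ℕ} {m : WithTop ℕ∞} (hk : m + k ≤ s) :
    ContDiff ℝ m (fun z : E × P => iteratedFDeriv ℝ k (fun x => A (x, z.2)) z.1) := by
  have hk' : (k : WithTop ℕ∞) ≤ s := le_trans (by simp) hk
  simp only [iteratedFDeriv_partial hA hk']
  exact (ContinuousMultilinearMap.compContinuousLinearMapL (F := F)
    (fun _ : Fin k => ContinuousLinearMap.inl ℝ E P)).contDiff.comp
      (hA.iteratedFDeriv_right hk)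

/-- Differentiation under the integral sign: the derivative of the integrand is continuous, hence
bounded on the compact product of the closed unit ball about `x` and `S`, and this bound dominates.
-/
lemma hasFDerivAt_setIntegral_smul {μ : Measure P} [IsLocallyFiniteMeasure μ] {S : Set P}
    (hS : IsCompact S) {q : P → ℝ} (hq : Continuous q) {B : E × P → F} (hB : ContDiff ℝ 1 B)
    (x : E) :
    HasFDerivAt (fun x => ∫ p in S, q p • B (x, p) ∂μ)
      (∫ p in S, q p • fderiv ℝ (fun x => B (x, p)) x ∂μ) x := by
  have hB' : ∀ x p, HasFDerivAt (fun x => B (x, p))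
      ((fderiv ℝ B (x, p)).comp (ContinuousLinearMap.inl ℝ E P)) x := fun x p =>
    ((hB.differentiable one_ne_zero) (x, p)).hasFDerivAt.comp x (hasFDerivAt_prodMk_left x p)
  have hfd : Continuous fun z : E × P => q z.2 • fderiv ℝ (fun x => B (x, z.2)) z.1 := by
    simp only [fun x p => (hB' x p).fderiv]
    exact (hq.comp continuous_snd).smul
      ((hB.continuous_fderiv one_ne_zero).clm_comp continuous_const)
  obtain ⟨C, hC⟩ := ((isCompact_closedBall x 1).prod hS).exists_bound_of_continuousOn
    hfd.continuousOn
  have hBc : ∀ x, Continuous fun p => q p • B (x, p) := fun x =>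
    hq.smul (hB.continuous.comp (by fun_prop))
  refine hasFDerivAt_integral_of_dominated_of_fderiv_le (bound := fun _ => C)
    (F := fun x p => q p • B (x, p))
    (F' := fun x p => q p • fderiv ℝ (fun x => B (x, p)) x) (closedBall_mem_nhds x one_pos)
    (Filter.Eventually.of_forall fun y => (hBc y).aestronglyMeasurable)
    ((hBc x).continuousOn.integrableOn_compact hS)
    ((hfd.comp (by fun_prop : Continuous fun p : P => (x, p))).aestronglyMeasurable) ?_
    (integrableOn_const hS.measure_ne_top) ?_
  · exact ae_restrict_of_forall_mem hS.isClosed.measurableSet fun p hp y hy => hC (y, p) ⟨hy, hp⟩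
  · exact Filter.Eventually.of_forall fun p y _ =>
      ((hB' y p).differentiableAt.hasFDerivAt).const_smul (q p)

lemma iteratedFDeriv_setIntegral_smul {μ : Measure P} [IsLocallyFiniteMeasure μ] {S : Set P}
    (hS : IsCompact S) {q : P → ℝ} (hq : Continuous q) {A : E × P → F} {s : WithTop ℕ∞}
    (hA : ContDiff ℝ s A) {k : ℕ} (hk : (k : WithTop ℕ∞) ≤ s) :
    iteratedFDeriv ℝ k (fun x => ∫ p in S, q p • A (x, p) ∂μ) =
      fun x => ∫ p in S, q p • iteratedFDeriv ℝ k (fun x => A (x, p)) x ∂μ := by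
  induction k with
  | zero =>
    ext1 x
    simp only [iteratedFDeriv_zero_eq_comp, Function.comp_apply]
    rw [← LinearIsometryEquiv.coe_toContinuousLinearEquiv,
      ← ContinuousLinearEquiv.integral_comp_comm]
    simp
  | succ k ih =>
    have hk' : (k : WithTop ℕ∞) ≤ s := le_trans (by exact_mod_cast Nat.le_succ k) hk
    have hG : ContDiff ℝ 1 (fun z : E × P => iteratedFDeriv ℝ k (fun x => A (x, z.2)) z.1) :=
      contDiff_iteratedFDeriv_partial hA (by rw [add_comm]; exact_mod_cast hk)
    ext1 x
    simp only [iteratedFDeriv_succ_eq_comp_left, Function.comp_apply]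
    rw [ih hk', (hasFDerivAt_setIntegral_smul hS hq hG x).fderiv]
    refine (ContinuousLinearEquiv.integral_comp_comm (𝕜 := ℝ) (E := E →L[ℝ] (E [×k]→L[ℝ] F))
      (F := E [×(k + 1)]→L[ℝ] F) (μ := μ.restrict S)
      (continuousMultilinearCurryLeftEquiv ℝ
        (fun _ : Fin (k + 1) => E) F).symm.toContinuousLinearEquiv
      (fun p => q p • fderiv ℝ (iteratedFDeriv ℝ k fun x => A (x, p)) x)).symm.trans ?_
    simp only [map_smul]
    rfl

/-- Derivatives in `x` do not see the weight `q`, which only needs to be continuous. This is used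
with weight `h` for the half fluxes, and with the components of a merely continuous field as weights
for the smoothing. -/
lemma contDiff_setIntegral_smul {μ : Measure P} [IsLocallyFiniteMeasure μ] {S : Set P}
    (hS : IsCompact S) {q : P → ℝ} (hq : Continuous q) {A : E × P → F} {s : ℕ∞}
    (hA : ContDiff ℝ s A) : ContDiff ℝ s (fun x => ∫ p in S, q p • A (x, p) ∂μ) := by
  rw [contDiff_iff_continuous_differentiable]
  constructor
  · intro m hm
    rw [iteratedFDeriv_setIntegral_smul hS hq hA (by exact_mod_cast hm)]
    have hG : ContDiff ℝ 0 (fun z : E × P => iteratedFDeriv ℝ m (fun x => A (x, z.2)) z.1) :=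
      contDiff_iteratedFDeriv_partial hA (by rw [zero_add]; exact_mod_cast hm)
    exact continuous_parametric_integral_of_continuous
      (f := fun x p => q p • iteratedFDeriv ℝ m (fun x => A (x, p)) x)
      ((hq.comp continuous_snd).smul hG.continuous) hS
  · intro m hm x
    rw [iteratedFDeriv_setIntegral_smul hS hq hA (by exact_mod_cast hm.le)]
    have hG : ContDiff ℝ 1 (fun z : E × P => iteratedFDeriv ℝ m (fun x => A (x, z.2)) z.1) :=
      contDiff_iteratedFDeriv_partial hA (by
        have : (1 : ℕ∞) + m ≤ s := by rw [add_comm]; exact Order.add_one_le_of_lt hm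
        exact_mod_cast this)
    exact (hasFDerivAt_setIntegral_smul hS hq hG x).differentiableAt

lemma exists_partial_bound {A : E × P → F} (r : ℕ) (hA : ContDiff ℝ r A) {T : Set E} {S : Set P}
    (hT : IsCompact T) (hS : IsCompact S) :
    ∃ C : ℝ, 1 ≤ C ∧ ∀ x ∈ T, ∀ p ∈ S, ∀ i ≤ r,
      ‖iteratedFDeriv ℝ i (fun x => A (x, p)) x‖ ≤ C := by
  have h : ∀ i ≤ r, ∃ C : ℝ, ∀ z ∈ T ×ˢ S,
      ‖iteratedFDeriv ℝ i (fun x => A (x, z.2)) z.1‖ ≤ C := by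
    intro i hi
    have hG : ContDiff ℝ 0 (fun z : E × P => iteratedFDeriv ℝ i (fun x => A (x, z.2)) z.1) :=
      contDiff_iteratedFDeriv_partial hA (by rw [zero_add]; exact_mod_cast hi)
    exact (hT.prod hS).exists_bound_of_continuousOn hG.continuous.continuousOn
  choose! C hC using h
  refine ⟨1 + ∑ i ∈ Finset.range (r + 1), |C i|, ?_, fun x hx p hp i hi => ?_⟩
  · have : 0 ≤ ∑ i ∈ Finset.range (r + 1), |C i| := Finset.sum_nonneg fun _ _ => abs_nonneg _
    linarith
  · have h2 : |C i| ≤ ∑ i ∈ Finset.range (r + 1), |C i| :=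
      Finset.single_le_sum (f := fun i => |C i|) (fun _ _ => abs_nonneg _)
        (Finset.mem_range.2 (Nat.lt_succ_of_le hi))
    have := hC i hi (x, p) ⟨hx, hp⟩
    have := le_abs_self (C i)
    simp only at *
    linarith

end ParametricIntegral

/-- Euclidean space of dimension `n`. -/
abbrev Euc (n : ℕ) := EuclideanSpace ℝ (Fin n)

/-! ### Trace and divergence on Euclidean space. -/

section EuclideanDivergence

variable {n : ℕ}

/-- The trace of a continuous linear endomorphism of Euclidean space. -/
def traceL (n : ℕ) : (EuclideanSpace ℝ (Fin n) →L[ℝ] EuclideanSpace ℝ (Fin n)) →L[ℝ] ℝ :=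
  ∑ i : Fin n, (EuclideanSpace.proj i : EuclideanSpace ℝ (Fin n) →L[ℝ] ℝ).comp
    (ContinuousLinearMap.apply ℝ (EuclideanSpace ℝ (Fin n)) (EuclideanSpace.single i (1 : ℝ)))

lemma traceL_apply (L : Euc n →L[ℝ] Euc n) :
    traceL n L = ∑ i, L (EuclideanSpace.single i 1) i := by
  simp [traceL]

lemma traceL_eq_trace (L : Euc n →L[ℝ] Euc n) :
    traceL n L = LinearMap.trace ℝ (Euc n) (L : Euc n →ₗ[ℝ] Euc n) := by
  rw [traceL_apply, LinearMap.trace_eq_matrix_trace ℝ (EuclideanSpace.basisFun (Fin n) ℝ).toBasis,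
    Matrix.trace]
  simp [LinearMap.toMatrix_apply]

lemma traceL_id : traceL n (ContinuousLinearMap.id ℝ (Euc n)) = n := by
  simp [traceL_apply]

lemma traceL_smulRight (φ : Euc n →L[ℝ] ℝ) (v : Euc n) : traceL n (φ.smulRight v) = φ v := by
  rw [traceL_apply]
  conv_rhs => rw [← (EuclideanSpace.basisFun (Fin n) ℝ).sum_repr v]
  simp [mul_comm]

lemma traceL_comp_comm (A B : Euc n →L[ℝ] Euc n) : traceL n (A.comp B) = traceL n (B.comp A) := by
  simp only [traceL_eq_trace]
  exact LinearMap.trace_comp_comm' _ _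

/-- The divergence of a vector field on Euclidean space. -/
def ediv (u : Euc n → Euc n) (x : Euc n) : ℝ := traceL n (fderiv ℝ u x)

lemma ediv_eq_of_hasFDerivAt {u : Euc n → Euc n} {x : Euc n} {L : Euc n →L[ℝ] Euc n} (h : HasFDerivAt u L x) :
    ediv u x = traceL n L := by
  rw [ediv, h.fderiv]

lemma ediv_smul {f : Euc n → ℝ} {u : Euc n → Euc n} {x : Euc n} (hf : DifferentiableAt ℝ f x)
    (hu : DifferentiableAt ℝ u x) :
    ediv (fun y => f y • u y) x = f x * ediv u x + fderiv ℝ f x (u x) := by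
  rw [ediv, fderiv_fun_smul hf hu, map_add, map_smul, traceL_smulRight, ediv, smul_eq_mul]

lemma ediv_add {u v : Euc n → Euc n} {x : Euc n} (hu : DifferentiableAt ℝ u x)
    (hv : DifferentiableAt ℝ v x) : ediv (fun y => u y + v y) x = ediv u x + ediv v x := by
  rw [ediv, fderiv_fun_add hu hv, map_add, ediv, ediv]

lemma ediv_sub {u v : Euc n → Euc n} {x : Euc n} (hu : DifferentiableAt ℝ u x)
    (hv : DifferentiableAt ℝ v x) : ediv (fun y => u y - v y) x = ediv u x - ediv v x := by
  rw [ediv, fderiv_fun_sub hu hv, map_sub, ediv, ediv]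

/-- The divergence commutes with a parametric integral. -/
lemma ediv_setIntegral_smul {P : Type*} [NormedAddCommGroup P] [NormedSpace ℝ P]
    [SecondCountableTopology P] [MeasurableSpace P] [BorelSpace P] {μ : Measure P}
    [IsLocallyFiniteMeasure μ] {S : Set P} (hS : IsCompact S) {q : P → ℝ} (hq : Continuous q)
    {A : Euc n × P → Euc n} (hA : ContDiff ℝ 1 A) (x : Euc n) :
    ediv (fun x => ∫ p in S, q p • A (x, p) ∂μ) x =
      ∫ p in S, q p * ediv (fun x => A (x, p)) x ∂μ := by
  have hA' : ∀ x p, HasFDerivAt (fun x => A (x, p))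
      ((fderiv ℝ A (x, p)).comp (ContinuousLinearMap.inl ℝ (Euc n) P)) x := fun x p =>
    ((hA.differentiable one_ne_zero) (x, p)).hasFDerivAt.comp x (hasFDerivAt_prodMk_left x p)
  have hc : Continuous fun p : P => q p • fderiv ℝ (fun x => A (x, p)) x := by
    simp only [fun x p => (hA' x p).fderiv]
    exact hq.smul (((hA.continuous_fderiv one_ne_zero).comp
      (by fun_prop : Continuous fun p : P => (x, p))).clm_comp continuous_const)
  rw [ediv_eq_of_hasFDerivAt (hasFDerivAt_setIntegral_smul hS hq hA x),
    ← ContinuousLinearMap.integral_comp_comm _ (hc.continuousOn.integrableOn_compact hS)]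
  simp [ediv]

end EuclideanDivergence

/-! ### The divergence equation in a ball, without loss of derivatives. -/

section BallSolution

variable {n : ℕ}

/-- The flux of the mass distribution `g` along the segments which join its points to the points of
the mass distribution `h`, for the first half of the way. -/
def halfFlux (c : Euc n) (R : ℝ) (g h : Euc n → ℝ) (x : Euc n) : Euc n :=
  -- Here `z = (p, σ)`, and mass starts at `q = p + σ (x - p)`. Thus `x = p + (q - p) / σ` runs from
  -- `q` at `σ = 1` to the midpoint of `q` and `p` at `σ = 2`. The whole way to `p` would need `σ →
  -- ∞`; stopping at `2` keeps the integrand as regular as `g` on a compact domain.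
  ∫ z in closedBall c R ×ˢ Icc (1 : ℝ) 2,
    h z.1 • g (z.1 + z.2 • (x - z.1)) • (z.2 ^ (n - 1) • (z.1 - x))

variable {c : Euc n} {R : ℝ} {g h : Euc n → ℝ}

lemma isCompact_ball_prod (c : Euc n) (R : ℝ) : IsCompact (closedBall c R ×ˢ Icc (1 : ℝ) 2) :=
  (isCompact_closedBall c R).prod isCompact_Icc

lemma contDiff_halfFlux_integrand {s : WithTop ℕ∞} (hg : ContDiff ℝ s g) :
    ContDiff ℝ s (fun w : Euc n × (Euc n × ℝ) =>
      g (w.2.1 + w.2.2 • (w.1 - w.2.1)) • (w.2.2 ^ (n - 1) • (w.2.1 - w.1))) := by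
  have h1 : ContDiff ℝ s (fun w : Euc n × (Euc n × ℝ) => w.2.1 + w.2.2 • (w.1 - w.2.1)) := by fun_prop
  exact (hg.comp h1).smul (by fun_prop)

lemma contDiff_halfFlux {s : ℕ∞} (hg : ContDiff ℝ s g) (hh : Continuous h) :
    ContDiff ℝ s (halfFlux c R g h) :=
  contDiff_setIntegral_smul (isCompact_ball_prod c R) (hh.comp continuous_fst)
    (contDiff_halfFlux_integrand hg)

/-- By convexity: with `y = p + σ (x - p)` one has `x = (1 - σ⁻¹) p + σ⁻¹ y`, so `x` belongs to the
ball whenever `p` and `y` do. -/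
lemma halfFlux_eq_zero (hg : ∀ y ∉ closedBall c R, g y = 0) {x : Euc n} (hx : x ∉ closedBall c R) :
    halfFlux c R g h x = 0 := by
  refine setIntegral_eq_zero_of_forall_eq_zero ?_
  rintro ⟨p, σ⟩ ⟨hp, hσ⟩
  have hσ0 : 0 < σ := lt_of_lt_of_le one_pos hσ.1
  have : g (p + σ • (x - p)) = 0 := by
    refine hg _ fun hy => hx ?_
    have hc := (convex_closedBall c R) hp hy (a := 1 - σ⁻¹) (b := σ⁻¹)
      (sub_nonneg.2 (inv_le_one_of_one_le₀ hσ.1)) (inv_nonneg.2 hσ0.le) (by ring)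
    convert hc using 1
    rw [smul_add, smul_smul, inv_mul_cancel₀ hσ0.ne', sub_smul]
    simp only [one_smul]
    abel
  simp [this]

lemma ediv_halfFlux_integrand (hn : 1 ≤ n) (hg : ContDiff ℝ 1 g) (p : Euc n) (σ : ℝ) (x : Euc n) :
    ediv (fun x => g (p + σ • (x - p)) • (σ ^ (n - 1) • (p - x))) x =
      -(n * σ ^ (n - 1) * g (p + σ • (x - p)) +
        σ ^ n * fderiv ℝ g (p + σ • (x - p)) (x - p)) := by
  have h1 : HasFDerivAt (fun x : Euc n => p + σ • (x - p)) (σ • ContinuousLinearMap.id ℝ (Euc n)) x :=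
    (((hasFDerivAt_id x).sub_const p).const_smul σ).const_add p
  have h2 : HasFDerivAt (fun x : Euc n => g (p + σ • (x - p)))
      ((fderiv ℝ g (p + σ • (x - p))).comp (σ • ContinuousLinearMap.id ℝ (Euc n))) x :=
    ((hg.differentiable one_ne_zero) _).hasFDerivAt.comp x h1
  have h3 : HasFDerivAt (fun x : Euc n => σ ^ (n - 1) • (p - x))
      (σ ^ (n - 1) • -ContinuousLinearMap.id ℝ (Euc n)) x :=
    ((hasFDerivAt_id x).const_sub p).const_smul (σ ^ (n - 1))
  obtain ⟨m, rfl⟩ : ∃ m, n = m + 1 := ⟨n - 1, by omega⟩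
  rw [ediv_smul h2.differentiableAt h3.differentiableAt, ediv_eq_of_hasFDerivAt h3, h2.fderiv]
  simp only [map_smul, map_neg, traceL_id, ContinuousLinearMap.comp_apply, smul_eq_mul,
    smul_apply, ContinuousLinearMap.id_apply, Nat.add_sub_cancel]
  rw [← neg_sub x p, map_neg]
  push_cast
  ring

/-- This derivative is the opposite of the divergence found in `ediv_halfFlux_integrand`, so the
integral of that divergence over `σ` reduces to boundary terms. -/
lemma hasDerivAt_pow_mul_comp_ray (hg : ContDiff ℝ 1 g) (p x : Euc n) (σ : ℝ) :
    HasDerivAt (fun σ : ℝ => σ ^ n * g (p + σ • (x - p)))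
      (n * σ ^ (n - 1) * g (p + σ • (x - p)) + σ ^ n * fderiv ℝ g (p + σ • (x - p)) (x - p)) σ := by
  have h1 : HasDerivAt (fun σ : ℝ => p + σ • (x - p)) (x - p) σ := by
    simpa using ((hasDerivAt_id σ).smul_const (x - p)).const_add p
  exact (hasDerivAt_pow n σ).mul
    (((hg.differentiable one_ne_zero) _).hasFDerivAt.comp_hasDerivAt σ h1)

/-- The boundary term at `σ = 1` is the mass `g` that leaves. The one at `σ = 2` is the density of
the midpoints `(p + q) / 2` weighted by `h(p) g(q)`, with `q = 2x - p` and Jacobian `2 ^ n`. -/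
lemma ediv_halfFlux (hn : 1 ≤ n) (hg : ContDiff ℝ 1 g) (hh : Continuous h)
    (hh0 : ∀ y ∉ closedBall c R, h y = 0) (x : Euc n) :
    ediv (halfFlux c R g h) x = (∫ p, h p) * g x - 2 ^ n * ∫ p, h p * g ((2 : ℝ) • x - p) := by
  have hA := contDiff_halfFlux_integrand hg
  have hsupp : ∀ φ : Euc n → ℝ, ∫ p in closedBall c R, h p * φ p = ∫ p, h p * φ p := fun φ =>
    setIntegral_eq_integral_of_forall_compl_eq_zero fun p hp => by simp [hh0 p hp]
  refine (ediv_setIntegral_smul (isCompact_ball_prod c R) (hh.comp continuous_fst) hA x).trans ?_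
  simp only [ediv_halfFlux_integrand hn hg, Function.comp_apply]
  have hcont : Continuous fun z : Euc n × ℝ => h z.1 *
      -(n * z.2 ^ (n - 1) * g (z.1 + z.2 • (x - z.1)) +
        z.2 ^ n * fderiv ℝ g (z.1 + z.2 • (x - z.1)) (x - z.1)) := by
    have h1 : Continuous fun z : Euc n × ℝ => z.1 + z.2 • (x - z.1) := by fun_prop
    have h2 := hg.continuous.comp h1
    have h3 := ((hg.continuous_fderiv one_ne_zero).comp h1).clm_apply
      (by fun_prop : Continuous fun z : Euc n × ℝ => x - z.1)
    have h4 := hh.comp (continuous_fst : Continuous (Prod.fst : Euc n × ℝ → Euc n))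
    simp only [Function.comp_def] at h2 h3 h4
    fun_prop
  rw [Measure.volume_eq_prod, setIntegral_prod _ (by
    rw [← Measure.volume_eq_prod]
    exact hcont.continuousOn.integrableOn_compact (isCompact_ball_prod c R))]
  have hinner : ∀ p : Euc n, ∫ σ in Icc (1 : ℝ) 2, h p *
      -(n * σ ^ (n - 1) * g (p + σ • (x - p)) +
        σ ^ n * fderiv ℝ g (p + σ • (x - p)) (x - p)) =
      h p * (g x - 2 ^ n * g ((2 : ℝ) • x - p)) := by
    intro p
    rw [integral_const_mul, integral_neg, integral_Icc_eq_integral_Ioc,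
      ← intervalIntegral.integral_of_le one_le_two,
      intervalIntegral.integral_eq_sub_of_hasDerivAt
        (fun σ _ => hasDerivAt_pow_mul_comp_ray hg p x σ)]
    · congr 1
      have : p + (2 : ℝ) • (x - p) = (2 : ℝ) • x - p := by
        rw [smul_sub, two_smul ℝ p]; abel
      rw [this]
      simp
    · refine Continuous.intervalIntegrable ?_ _ _
      have h1 : Continuous fun σ : ℝ => p + σ • (x - p) := by fun_prop
      have h2 := hg.continuous.comp h1
      have h3 := ((hg.continuous_fderiv one_ne_zero).comp h1).clm_apply
        (continuous_const : Continuous fun _ : ℝ => x - p)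
      simp only [Function.comp_def] at h2 h3
      fun_prop
  simp only [hinner]
  rw [hsupp (fun p => g x - 2 ^ n * g ((2 : ℝ) • x - p))]
  have hi : ∀ φ : Euc n → ℝ, Continuous φ → Integrable fun p => h p * φ p := fun φ hφ =>
    (hh.mul hφ).integrable_of_hasCompactSupport
      (HasCompactSupport.intro (isCompact_closedBall c R) fun p hp => by simp [hh0 p hp])
  have hgx : Continuous fun p : Euc n => g ((2 : ℝ) • x - p) := hg.continuous.comp (by fun_prop)
  simp only [mul_sub]
  rw [integral_sub (hi _ continuous_const) (hi _ (hgx.const_mul _)), integral_mul_const]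
  congr 1
  rw [← integral_const_mul]
  congr 1
  ext p
  ring

/-- A solution of `div F = g - (∫ g) h` supported in a ball which contains the supports of `g` and
`h`, if `∫ h = 1`. -/
def ballSolution (c : Euc n) (R : ℝ) (h g : Euc n → ℝ) (x : Euc n) : Euc n :=
  halfFlux c R g h x - halfFlux c R h g x

lemma contDiff_ballSolution {s : ℕ∞} (hg : ContDiff ℝ s g) (hh : ContDiff ℝ ∞ h) :
    ContDiff ℝ s (ballSolution c R h g) :=
  (contDiff_halfFlux hg hh.continuous).sub
    (contDiff_halfFlux (hh.of_le (by exact_mod_cast le_top)) hg.continuous)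

lemma ballSolution_eq_zero (hg0 : ∀ y ∉ closedBall c R, g y = 0)
    (hh0 : ∀ y ∉ closedBall c R, h y = 0) {x : Euc n} (hx : x ∉ closedBall c R) :
    ballSolution c R h g x = 0 := by
  rw [ballSolution, halfFlux_eq_zero hg0 hx, halfFlux_eq_zero hh0 hx, sub_zero]

/-- The midpoint density is symmetric in `g` and `h`, by the substitution `p ↦ 2x - p`, so it
cancels in the difference of the two half fluxes. -/
lemma ediv_ballSolution (hn : 1 ≤ n) (hg : ContDiff ℝ 1 g) (hh : ContDiff ℝ ∞ h)
    (hg0 : ∀ y ∉ closedBall c R, g y = 0) (hh0 : ∀ y ∉ closedBall c R, h y = 0)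
    (hh1 : ∫ y, h y = 1) (x : Euc n) :
    ediv (ballSolution c R h g) x = g x - (∫ y, g y) * h x := by
  have hh' : ContDiff ℝ 1 h := hh.of_le (by exact_mod_cast le_top)
  have hd1 : DifferentiableAt ℝ (halfFlux c R g h) x :=
    ((contDiff_halfFlux (s := 1) (by exact_mod_cast hg) hh.continuous).differentiable
      (by simp)) x
  have hd2 : DifferentiableAt ℝ (halfFlux c R h g) x :=
    ((contDiff_halfFlux (s := 1) (by exact_mod_cast hh') hg.continuous).differentiable
      (by simp)) x
  rw [show ballSolution c R h g = fun x => halfFlux c R g h x - halfFlux c R h g x from rfl,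
    ediv_sub hd1 hd2, ediv_halfFlux hn hg hh.continuous hh0,
    ediv_halfFlux hn hh' hg.continuous hg0, hh1]
  have : ∫ p, h p * g ((2 : ℝ) • x - p) = ∫ p, g p * h ((2 : ℝ) • x - p) := by
    rw [← integral_sub_left_eq_self (fun p => h p * g ((2 : ℝ) • x - p)) volume ((2 : ℝ) • x)]
    congr 1
    ext p
    simp [mul_comm]
  rw [this]
  ring

/-- The derivatives in `x` fall on `g (p + σ (x - p))` and on a fixed polynomial factor, with `σ`
bounded by `2`. Hence order `r` of `g` controls order `r` of the flux, while only the supremum of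
`h` enters. -/
lemma exists_halfFlux_bound (c : Euc n) (R : ℝ) (r : ℕ) :
    ∃ C : ℝ, 0 ≤ C ∧ ∀ g h : Euc n → ℝ, ContDiff ℝ r g → Continuous h → ∀ B H : ℝ,
      (∀ y, ∀ i ≤ r, ‖iteratedFDeriv ℝ i g y‖ ≤ B) → (∀ y, |h y| ≤ H) →
      ∀ x ∈ closedBall c R, ∀ k ≤ r, ‖iteratedFDeriv ℝ k (halfFlux c R g h) x‖ ≤ C * B * H := by
  have hψ : ContDiff ℝ r (fun w : Euc n × (Euc n × ℝ) => w.2.1 + w.2.2 • (w.1 - w.2.1)) := by fun_prop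
  have hv : ContDiff ℝ r (fun w : Euc n × (Euc n × ℝ) => w.2.2 ^ (n - 1) • (w.2.1 - w.1)) := by fun_prop
  obtain ⟨a, ha1, ha⟩ := exists_partial_bound r hψ (isCompact_closedBall c R)
    (isCompact_ball_prod c R)
  obtain ⟨b, hb1, hb⟩ := exists_partial_bound r hv (isCompact_closedBall c R)
    (isCompact_ball_prod c R)
  set S := closedBall c R ×ˢ Icc (1 : ℝ) 2 with hS
  refine ⟨2 ^ r * (r.factorial * a ^ r) * b * volume.real S, by positivity,
    fun g h hg hh B H hB hH x hx k hk => ?_⟩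
  have hA := contDiff_halfFlux_integrand hg
  have hD := congrFun (iteratedFDeriv_setIntegral_smul (μ := volume) (isCompact_ball_prod c R)
    (hh.comp continuous_fst) hA (k := k) (by exact_mod_cast hk)) x
  refine (congrArg norm hD).le.trans ?_
  have hB0 : 0 ≤ B := (norm_nonneg _).trans (hB 0 0 (Nat.zero_le _))
  have hH0 : 0 ≤ H := (abs_nonneg _).trans (hH 0)
  have key : ∀ z ∈ S, ‖h z.1 • iteratedFDeriv ℝ k (fun x => g (z.1 + z.2 • (x - z.1)) •
      (z.2 ^ (n - 1) • (z.1 - x))) x‖ ≤ H * (2 ^ r * (r.factorial * B * a ^ r) * b) := by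
    intro z hz
    rw [norm_smul, Real.norm_eq_abs]
    refine mul_le_mul (hH _) ?_ (norm_nonneg _) hH0
    have hψz : ContDiff ℝ r (fun x : Euc n => z.1 + z.2 • (x - z.1)) := by fun_prop
    have hvz : ContDiff ℝ r (fun x : Euc n => z.2 ^ (n - 1) • (z.1 - x)) := by fun_prop
    refine norm_iteratedFDeriv_smul_le_at (hg.comp hψz).contDiffAt hvz.contDiffAt
      (fun i hi => ?_) (fun i hi => hb x hx z hz i hi) hk
    exact norm_iteratedFDeriv_comp_le_at hg.contDiffAt hψz.contDiffAt ha1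
      (fun i _ hi => ha x hx z hz i hi) (fun i hi => hB _ i hi) hi
  refine (norm_setIntegral_le_of_norm_le_const (isCompact_ball_prod c R).measure_lt_top
    key).trans (le_of_eq ?_)
  ring

/-- In one half flux the derivatives fall on `g`, in the other on `h`; since `h` is fixed, its `C^r`
size goes into the constant. -/
lemma exists_ballSolution_bound (c : Euc n) (R : ℝ) (r : ℕ) (hh : ContDiff ℝ ∞ h)
    (hh0 : ∀ y ∉ closedBall c R, h y = 0) :
    ∃ C : ℝ, 0 ≤ C ∧ ∀ g : Euc n → ℝ, ContDiff ℝ r g → ∀ B : ℝ,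
      (∀ y, ∀ i ≤ r, ‖iteratedFDeriv ℝ i g y‖ ≤ B) →
      ∀ x ∈ closedBall c R, ∀ k ≤ r, ‖iteratedFDeriv ℝ k (ballSolution c R h g) x‖ ≤ C * B := by
  obtain ⟨C, hC0, hC⟩ := exists_halfFlux_bound c R r
  have hhr : ContDiff ℝ r h := hh.of_le (by exact_mod_cast le_top)
  obtain ⟨H, hH1, hH⟩ := exists_iteratedFDeriv_bound (u := h) isOpen_univ
    (isCompact_closedBall c R) (subset_univ _) r hhr.contDiffOn
  have hH' : ∀ y, ∀ i ≤ r, ‖iteratedFDeriv ℝ i h y‖ ≤ H := by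
    intro y i hi
    by_cases hy : y ∈ closedBall c R
    · exact hH y hy i hi
    · have : h =ᶠ[𝓝 y] fun _ => 0 := by
        filter_upwards [isClosed_closedBall.isOpen_compl.mem_nhds hy] with z hz using hh0 z hz
      rw [(this.iteratedFDeriv ℝ i).eq_of_nhds]
      simp only [iteratedFDeriv_fun_zero, Pi.zero_apply, norm_zero]
      linarith
  refine ⟨2 * C * H, by positivity, fun g hg B hB x hx k hk => ?_⟩
  have h0 : ∀ {φ : Euc n → ℝ} {b : ℝ}, (∀ y, ∀ i ≤ r, ‖iteratedFDeriv ℝ i φ y‖ ≤ b) →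
      ∀ y, |φ y| ≤ b := fun hb y => by simpa using hb y 0 (Nat.zero_le _)
  have h1 := hC g h hg hh.continuous B H hB (h0 hH') x hx k hk
  have h2 := hC h g hhr hg.continuous H B hH' (h0 hB) x hx k hk
  have e1 : ContDiffAt ℝ k (halfFlux c R g h) x :=
    (contDiff_halfFlux (s := k) (hg.of_le (by exact_mod_cast hk)) hh.continuous).contDiffAt
  have e2 : ContDiffAt ℝ k (halfFlux c R h g) x :=
    (contDiff_halfFlux (s := k) (hhr.of_le (by exact_mod_cast hk)) hg.continuous).contDiffAt
  rw [show ballSolution c R h g = halfFlux c R g h - halfFlux c R h g from rfl,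
    iteratedFDeriv_sub_apply e1 e2]
  refine (norm_sub_le _ _).trans ?_
  linarith

end BallSolution

/-! ### Smoothing with variable step that preserves divergence-free fields. -/

section Regularization

variable {n : ℕ}

/-- The pull-back of the flux of `F` by the map `x ↦ x + τ ε(x) z`, at the point `w.1 = x`, where
`w.2 = τ`. -/
def shiftFlux (ε : Euc n → ℝ) (F : Euc n → Euc n) (w : Euc n × ℝ) (z : Euc n) : Euc n :=
  -- The pull-back of the flux of `F` by `φ` is `adj(Dφ) (F ∘ φ)`. For `φ(x) = x + τ ε(x) z` the
  -- derivative `1 + τ z ⊗ dε` is a rank one perturbation of the identity, with determinant `1 + τ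
  -- dε(z)` and adjugate `(1 + τ dε(z)) - τ z ⊗ dε`.
  (1 + w.2 * fderiv ℝ ε w.1 z) • F (w.1 + (w.2 * ε w.1) • z) -
    (w.2 * fderiv ℝ ε w.1 (F (w.1 + (w.2 * ε w.1) • z))) • z

/-- A regularization of the vector field `F`, with step `τ ε(x)` at the point `x`, which preserves
the divergence-free fields. -/
def regularize (η ε : Euc n → ℝ) (F : Euc n → Euc n) (w : Euc n × ℝ) : Euc n :=
  ∫ z in closedBall (0 : Euc n) 1, η z • shiftFlux ε F w z

variable {η ε : Euc n → ℝ} {F : Euc n → Euc n}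

lemma contDiff_fderiv_of_smooth (hε : ContDiff ℝ ∞ ε) : ContDiff ℝ ∞ (fderiv ℝ ε) :=
  hε.fderiv_right (by simp)

lemma contDiff_shiftFlux {s : ℕ∞} (hε : ContDiff ℝ ∞ ε) (hF : ContDiff ℝ s F) :
    ContDiff ℝ s (fun p : (Euc n × ℝ) × Euc n => shiftFlux ε F p.1 p.2) := by
  have hs : (s : WithTop ℕ∞) ≤ ∞ := by exact_mod_cast le_top
  have h1 : ContDiff ℝ s (fun p : (Euc n × ℝ) × Euc n => ε p.1.1) :=
    (hε.of_le hs).comp (contDiff_fst.comp contDiff_fst)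
  have h2 : ContDiff ℝ s (fun p : (Euc n × ℝ) × Euc n => fderiv ℝ ε p.1.1) :=
    ((contDiff_fderiv_of_smooth hε).of_le hs).comp (contDiff_fst.comp contDiff_fst)
  have h3 : ContDiff ℝ s (fun p : (Euc n × ℝ) × Euc n => p.1.2) :=
    contDiff_snd.comp contDiff_fst
  have h4 : ContDiff ℝ s (fun p : (Euc n × ℝ) × Euc n => F (p.1.1 + (p.1.2 * ε p.1.1) • p.2)) :=
    hF.comp ((contDiff_fst.comp contDiff_fst).add ((h3.mul h1).smul contDiff_snd))
  exact ((contDiff_const.add (h3.mul (h2.clm_apply contDiff_snd))).smul h4).sub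
    ((h3.mul (h2.clm_apply h4)).smul contDiff_snd)

lemma contDiff_regularize {s : ℕ∞} (hη : Continuous η) (hε : ContDiff ℝ ∞ ε)
    (hF : ContDiff ℝ s F) : ContDiff ℝ s (regularize η ε F) :=
  contDiff_setIntegral_smul (isCompact_closedBall 0 1) hη (contDiff_shiftFlux hε hF)

lemma setIntegral_bump (hη0 : ∀ z ∉ closedBall (0 : Euc n) 1, η z = 0) (hη1 : ∫ z, η z = 1) :
    ∫ z in closedBall (0 : Euc n) 1, η z = 1 := by
  rw [setIntegral_eq_integral_of_forall_compl_eq_zero hη0, hη1]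

lemma regularize_eq_self (hη0 : ∀ z ∉ closedBall (0 : Euc n) 1, η z = 0) (hη1 : ∫ z, η z = 1)
    {x : Euc n} {τ : ℝ} (h1 : τ * ε x = 0) (h2 : τ • fderiv ℝ ε x = 0) :
    regularize η ε F (x, τ) = F x := by
  have h2' : ∀ v, τ * fderiv ℝ ε x v = 0 := fun v => by
    simpa using congrArg (fun L : Euc n →L[ℝ] ℝ => L v) h2
  simp only [regularize, shiftFlux, h1, h2', add_zero, zero_smul, sub_zero, one_smul]
  rw [integral_smul_const, setIntegral_bump hη0 hη1, one_smul]

/-- A zero of the nonnegative function `ε` is a minimum, so `dε` vanishes there as well and no term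
of the shifted flux is altered. -/
lemma regularize_eq_self_of_eq_zero (hη0 : ∀ z ∉ closedBall (0 : Euc n) 1, η z = 0)
    (hη1 : ∫ z, η z = 1) (hε0 : ∀ y, 0 ≤ ε y) {x : Euc n} {τ : ℝ} (hx : ε x = 0) :
    regularize η ε F (x, τ) = F x := by
  refine regularize_eq_self hη0 hη1 (by simp [hx]) ?_
  have : IsLocalMin ε x := Filter.Eventually.of_forall fun y => by rw [hx]; exact hε0 y
  rw [this.fderiv_eq_zero, smul_zero]

/-- Exterior differentiation commutes with pull-back, so the divergence is composed with `x ↦ x + τ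
ε(x) z` and multiplied by the Jacobian of this map. In coordinates the terms with second derivatives
of `ε` cancel by symmetry. -/
lemma ediv_shiftFlux (hε : ContDiff ℝ ∞ ε) (hF : ContDiff ℝ 1 F) (τ : ℝ) (z x : Euc n) :
    ediv (fun x => shiftFlux ε F (x, τ) z) x =
      (1 + τ * fderiv ℝ ε x z) * ediv F (x + (τ * ε x) • z) := by
  have hεd : HasFDerivAt ε (fderiv ℝ ε x) x :=
    ((hε.differentiable (by simp)) x).hasFDerivAt
  have hDε : HasFDerivAt (fderiv ℝ ε) (fderiv ℝ (fderiv ℝ ε) x) x :=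
    (((contDiff_fderiv_of_smooth hε).differentiable (by simp)) x).hasFDerivAt
  have hsymm : ∀ v w, fderiv ℝ (fderiv ℝ ε) x v w = fderiv ℝ (fderiv ℝ ε) x w v := by
    intro v w
    exact (hε.contDiffAt.isSymmSndFDerivAt (by simpa using ENat.LEInfty.out)) v w
  set a := fderiv ℝ ε x with ha
  set Hs := fderiv ℝ (fderiv ℝ ε) x with hHs
  set y := x + (τ * ε x) • z with hy
  set L := fderiv ℝ F y with hL
  have hφ : HasFDerivAt (fun x => x + (τ * ε x) • z)
      (ContinuousLinearMap.id ℝ (Euc n) + (τ • a).smulRight z) x :=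
    (hasFDerivAt_id x).add ((hεd.const_mul τ).smul_const z)
  have hFφ : HasFDerivAt (fun x => F (x + (τ * ε x) • z))
      (L.comp (ContinuousLinearMap.id ℝ (Euc n) + (τ • a).smulRight z)) x :=
    ((hF.differentiable one_ne_zero) y).hasFDerivAt.comp x hφ
  have hc : HasFDerivAt (fun x => 1 + τ * fderiv ℝ ε x z) (τ • Hs.flip z) x := by
    have := ((hDε.clm_apply (hasFDerivAt_const z x)).const_mul τ).const_add 1
    refine this.congr_fderiv ?_
    ext v
    simp
  have hd : HasFDerivAt (fun x => τ * fderiv ℝ ε x (F (x + (τ * ε x) • z)))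
      (τ • (a.comp (L.comp (ContinuousLinearMap.id ℝ (Euc n) + (τ • a).smulRight z)) +
        Hs.flip (F y))) x :=
    (hDε.clm_apply hFφ).const_mul τ
  have htot := (hc.smul hFφ).sub (hd.smul_const z)
  refine (ediv_eq_of_hasFDerivAt htot).trans ?_
  have ht : ∀ v : Euc n, traceL n (L.comp ((τ • a).smulRight v)) = τ * a (L v) := by
    intro v
    have : L.comp ((τ • a).smulRight v) = (τ • a).smulRight (L v) := by
      ext1 w
      simp
    rw [this, traceL_smulRight]
    simp
  rw [map_sub, map_add, map_smul, traceL_smulRight, traceL_smulRight, ContinuousLinearMap.comp_add,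
    map_add, ht, ContinuousLinearMap.comp_id, ediv]
  simp only [smul_apply, add_apply, ContinuousLinearMap.flip_apply, ContinuousLinearMap.comp_apply,
    ContinuousLinearMap.smulRight_apply, smul_eq_mul, map_add,
    map_smul, hsymm z (F y)]
  ring

lemma ediv_regularize (hη : Continuous η) (hε : ContDiff ℝ ∞ ε) (hF : ContDiff ℝ 1 F)
    (τ : ℝ) (x : Euc n) :
    ediv (fun x => regularize η ε F (x, τ)) x =
      ∫ z in closedBall (0 : Euc n) 1,
        η z * ((1 + τ * fderiv ℝ ε x z) * ediv F (x + (τ * ε x) • z)) := by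
  have hA : ContDiff ℝ 1 (fun p : Euc n × Euc n => shiftFlux ε F (p.1, τ) p.2) := by
    have h1 : ContDiff ℝ (1 : ℕ∞) (fun p : (Euc n × ℝ) × Euc n => shiftFlux ε F p.1 p.2) :=
      contDiff_shiftFlux hε (by exact_mod_cast hF)
    have h2 : ContDiff ℝ (1 : ℕ∞) (fun p : Euc n × Euc n => ((p.1, τ), p.2)) := by fun_prop
    exact_mod_cast h1.comp h2
  refine (ediv_setIntegral_smul (isCompact_closedBall 0 1) hη hA x).trans ?_
  simp only [ediv_shiftFlux hε hF]

/-- The regularization converges to the field in the `C^r` topology, uniformly on compact sets. -/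
lemma eventually_regularize_sub_le {r : ℕ} (hη : Continuous η)
    (hη0 : ∀ z ∉ closedBall (0 : Euc n) 1, η z = 0) (hη1 : ∫ z, η z = 1)
    (hε : ContDiff ℝ ∞ ε) (hF : ContDiff ℝ r F) {T : Set (Euc n)} (hT : IsCompact T)
    {δ : ℝ} (hδ : 0 < δ) :
    ∀ᶠ τ in 𝓝 (0 : ℝ), ∀ x ∈ T, ∀ k ≤ r,
      ‖iteratedFDeriv ℝ k (fun x => regularize η ε F (x, τ) - F x) x‖ ≤ δ := by
  have hR : ContDiff ℝ r (regularize η ε F) := by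
    exact_mod_cast contDiff_regularize (s := r) hη hε (by exact_mod_cast hF)
  have hA : ContDiff ℝ r (fun w : Euc n × ℝ => regularize η ε F w - F w.1) :=
    hR.sub (hF.comp contDiff_fst)
  -- The difference is jointly `C^r` in `(x, τ)` and vanishes identically at `τ = 0`; continuity of
  -- its derivatives and compactness of `T` then give smallness for all `τ` near `0`, uniformly on
  -- `T`.
  have hz : (fun x => regularize η ε F (x, 0) - F x) = fun _ => 0 := by
    ext1 x
    rw [regularize_eq_self hη0 hη1 (by simp) (by simp), sub_self]
  have key : ∀ k ≤ r, ∀ᶠ τ in 𝓝 (0 : ℝ), ∀ x ∈ T,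
      ‖iteratedFDeriv ℝ k (fun x => regularize η ε F (x, τ) - F x) x‖ ≤ δ := by
    intro k hk
    have hG : ContDiff ℝ 0 (fun z : Euc n × ℝ =>
        iteratedFDeriv ℝ k (fun x => regularize η ε F (x, z.2) - F x) z.1) :=
      contDiff_iteratedFDeriv_partial hA (by rw [zero_add]; exact_mod_cast hk)
    refine hT.eventually_forall_of_forall_eventually fun x _ => ?_
    have hc : Continuous fun w : ℝ × Euc n =>
        ‖iteratedFDeriv ℝ k (fun x => regularize η ε F (x, w.1) - F x) w.2‖ :=
      (hG.continuous.comp (continuous_snd.prodMk continuous_fst)).norm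
    have h0 : ‖iteratedFDeriv ℝ k (fun x => regularize η ε F (x, 0) - F x) x‖ < δ := by
      rw [hz]
      simpa using hδ
    filter_upwards [hc.continuousAt.eventually_lt continuousAt_const h0] with w hw using hw.le
  have := (Finset.eventually_all (Finset.range (r + 1))
    (p := fun k τ => ∀ x ∈ T,
      ‖iteratedFDeriv ℝ k (fun x => regularize η ε F (x, τ) - F x) x‖ ≤ δ)).2
    fun k hk => key k (Nat.lt_succ_iff.1 (Finset.mem_range.1 hk))
  filter_upwards [this] with τ hτ x hx k hk
  exact hτ k (Finset.mem_range.2 (Nat.lt_succ_of_le hk)) x hx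

lemma exists_contDiffBump_tsupport_subset {x : Euc n} {s : Set (Euc n)} (hs : s ∈ 𝓝 x) :
    ∃ b : ContDiffBump x, tsupport b ⊆ s := by
  obtain ⟨R, hR, hRs⟩ := nhds_basis_closedBall.mem_iff.1 hs
  exact ⟨⟨R / 2, R, by positivity, by linarith⟩, by rw [ContDiffBump.tsupport_eq]; exact hRs⟩

/-- A function which is smooth near a point coincides near this point with a smooth function. -/
lemma exists_smooth_eventuallyEq {G : Type*} [NormedAddCommGroup G] [NormedSpace ℝ G]
    {u : Euc n → G} {s : Set (Euc n)} (hs : IsOpen s) (hu : ContDiffOn ℝ ∞ u s) {x : Euc n}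
    (hx : x ∈ s) : ∃ v : Euc n → G, ContDiff ℝ ∞ v ∧ v =ᶠ[𝓝 x] u := by
  obtain ⟨b, hb⟩ := exists_contDiffBump_tsupport_subset (hs.mem_nhds hx)
  refine ⟨fun y => b y • u y, contDiff_iff_contDiffAt.2 fun y => ?_, ?_⟩
  · by_cases hy : y ∈ s
    · exact b.contDiff.contDiffAt.smul (hu.contDiffAt (hs.mem_nhds hy))
    · have : (fun y => b y • u y) =ᶠ[𝓝 y] fun _ => 0 := by
        filter_upwards [(isClosed_tsupport b).isOpen_compl.mem_nhds fun h => hy (hb h)] with z hz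
        rw [image_eq_zero_of_notMem_tsupport hz, zero_smul]
      exact contDiffAt_const.congr_of_eventuallyEq this
  · filter_upwards [b.eventuallyEq_one] with y hy
    simp [hy]

/-- The regularization is smooth at a point where `F` is smooth and the step vanishes. -/
lemma contDiffAt_regularize_of_eq_zero (hη : Continuous η) (hε : ContDiff ℝ ∞ ε)
    {x : Euc n} {τ : ℝ} (hx : ε x = 0) {s : Set (Euc n)} (hs : IsOpen s) (hxs : x ∈ s)
    (hF : ContDiffOn ℝ ∞ F s) : ContDiffAt ℝ ∞ (fun x => regularize η ε F (x, τ)) x := by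
  obtain ⟨F', hF', hFF'⟩ := exists_smooth_eventuallyEq hs hF hxs
  -- As `ε x = 0`, the points `y + τ ε(y) z` tend to `x` as `y` does, uniformly in `z`: near `x` the
  -- average reads only values of `F` close to `x`, where `F` may be replaced by a globally smooth
  -- field.
  have h1 : ∀ᶠ y in 𝓝 x, ∀ z ∈ closedBall (0 : Euc n) 1,
      F' (y + (τ * ε y) • z) = F (y + (τ * ε y) • z) := by
    refine (isCompact_closedBall 0 1).eventually_forall_of_forall_eventually fun z _ => ?_
    have hc : Continuous fun w : Euc n × Euc n => w.1 + (τ * ε w.1) • w.2 := by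
      have := hε.continuous
      fun_prop
    have h2 : Filter.Tendsto (fun w : Euc n × Euc n => w.1 + (τ * ε w.1) • w.2) (𝓝 (x, z)) (𝓝 x) := by
      simpa [hx] using hc.tendsto (x, z)
    exact h2.eventually hFF'
  have h2 : (fun x => regularize η ε F (x, τ)) =ᶠ[𝓝 x] fun x => regularize η ε F' (x, τ) := by
    filter_upwards [h1] with y hy
    refine setIntegral_congr_fun measurableSet_closedBall fun z hz => ?_
    simp only [shiftFlux, hy z hz]
  have h3 : ContDiff ℝ ∞ (regularize η ε F') := contDiff_regularize (s := ⊤) hη hε hF'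
  exact (h3.comp (contDiff_id.prodMk contDiff_const)).contDiffAt.congr_of_eventuallyEq h2

/-- The regularizing kernel, applied to a vector `v`. -/
def regKernel (η ε : Euc n → ℝ) (v : Euc n) (p : Euc n × Euc n) : Euc n :=
  η ((ε p.1)⁻¹ • (p.2 - p.1)) •
    ((1 + fderiv ℝ ε p.1 ((ε p.1)⁻¹ • (p.2 - p.1))) • v -
      (fderiv ℝ ε p.1 v) • ((ε p.1)⁻¹ • (p.2 - p.1)))

lemma contDiff_regKernel (hη : ContDiff ℝ ∞ η) (hε : ContDiff ℝ ∞ ε) (hpos : ∀ x, 0 < ε x)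
    (v : Euc n) : ContDiff ℝ ∞ (regKernel η ε v) := by
  have h1 : ContDiff ℝ ∞ (fun p : Euc n × Euc n => (ε p.1)⁻¹ • (p.2 - p.1)) :=
    ((hε.comp contDiff_fst).inv fun p => (hpos p.1).ne').smul (contDiff_snd.sub contDiff_fst)
  have h2 : ContDiff ℝ ∞ (fun p : Euc n × Euc n => fderiv ℝ ε p.1) :=
    (contDiff_fderiv_of_smooth hε).comp contDiff_fst
  exact (hη.comp h1).smul (((contDiff_const.add (h2.clm_apply h1)).smul contDiff_const).sub
    ((h2.clm_apply contDiff_const).smul h1))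

/-- Linearity in `v` turns the vector-valued weight `F` into scalar weights, the form required by
`contDiff_setIntegral_smul`. -/
lemma regKernel_sum (p : Euc n × Euc n) (v : Euc n) :
    regKernel η ε v p = ∑ i, v i • regKernel η ε (EuclideanSpace.single i 1) p := by
  have hv : v = ∑ i, v i • EuclideanSpace.single i (1 : ℝ) := by
    conv_lhs => rw [← (EuclideanSpace.basisFun (Fin n) ℝ).sum_repr v]
    simp
  let Λ : Euc n →ₗ[ℝ] Euc n :=
    { toFun := fun v => regKernel η ε v p
      map_add' := fun v w => by
        simp only [regKernel, map_add, smul_add, add_smul, smul_sub]; abel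
      map_smul' := fun c v => by
        simp only [regKernel, map_smul, RingHom.id_apply, smul_eq_mul]
        module }
  calc regKernel η ε v p = Λ v := rfl
    _ = Λ (∑ i, v i • EuclideanSpace.single i (1 : ℝ)) := by rw [← hv]
    _ = ∑ i, v i • Λ (EuclideanSpace.single i 1) := by simp only [map_sum, map_smul]

/-- The substitution `w = x + ε(x) z` moves the dependence on `x` from the argument of `F` into the
kernel, which is smooth where `ε > 0`. -/
lemma regularize_eq_integral_regKernel (hη0 : ∀ z ∉ closedBall (0 : Euc n) 1, η z = 0)
    {x : Euc n} (hpos : 0 < ε x) :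
    regularize η ε F (x, 1) = |(ε x ^ n)⁻¹| • ∫ w, regKernel η ε (F w) (x, w) := by
  have h1 : regularize η ε F (x, 1) = ∫ z, η z • shiftFlux ε F (x, 1) z :=
    setIntegral_eq_integral_of_forall_compl_eq_zero fun z hz => by simp [hη0 z hz]
  have h2 : ∀ z, η z • shiftFlux ε F (x, 1) z =
      regKernel η ε (F (x + ε x • z)) (x, x + ε x • z) := by
    intro z
    simp [shiftFlux, regKernel, smul_smul, inv_mul_cancel₀ hpos.ne']
  rw [h1]
  simp only [h2]
  rw [Measure.integral_comp_smul volume (fun y => regKernel η ε (F (x + y)) (x, x + y)) (ε x),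
    integral_add_left_eq_self (fun y => regKernel η ε (F y) (x, y)) x]
  simp

lemma contDiffAt_regularize_one_of_pos (hη : ContDiff ℝ ∞ η)
    (hη0 : ∀ z ∉ closedBall (0 : Euc n) 1, η z = 0) (hε : ContDiff ℝ ∞ ε) (hpos : ∀ x, 0 < ε x)
    (hF : Continuous F) (x : Euc n) :
    ContDiffAt ℝ ∞ (fun x => regularize η ε F (x, 1)) x := by
  -- One compact domain serves all `y` near `x`: if `|y - x| < 1` and `ε y < ε x + 1`, the kernel at
  -- `y` lives within `ε y` of `y`, hence in this ball.
  set S := closedBall x (ε x + 2) with hS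
  have hSc : IsCompact S := isCompact_closedBall _ _
  have hFi : ∀ i, Continuous fun w => F w i := fun i =>
    (EuclideanSpace.proj i : Euc n →L[ℝ] ℝ).continuous.comp hF
  have h1 : ∀ᶠ y in 𝓝 x, regularize η ε F (y, 1) =
      |(ε y ^ n)⁻¹| • ∑ i, ∫ w in S, F w i • regKernel η ε (EuclideanSpace.single i 1) (y, w) := by
    have hlt : ε x < ε x + 1 := by linarith
    filter_upwards [ball_mem_nhds x one_pos,
      hε.continuous.continuousAt.eventually_lt continuousAt_const hlt] with y hy hεy
    rw [regularize_eq_integral_regKernel hη0 (hpos y)]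
    congr 1
    rw [← integral_finsetSum]
    · simp only [← regKernel_sum]
      refine (setIntegral_eq_integral_of_forall_compl_eq_zero fun w hw => ?_).symm
      have : η ((ε y)⁻¹ • (w - y)) = 0 := by
        refine hη0 _ fun hmem => hw ?_
        rw [mem_closedBall_zero_iff, norm_smul, norm_inv, Real.norm_of_nonneg (hpos y).le,
          inv_mul_le_iff₀ (hpos y), mul_one] at hmem
        rw [hS, mem_closedBall]
        have h3 := dist_triangle w y x
        rw [dist_eq_norm w y] at h3
        have h4 := mem_ball.1 hy
        linarith
      simp [regKernel, this]
    · intro i _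
      refine ContinuousOn.integrableOn_compact hSc ?_
      exact ((hFi i).smul ((contDiff_regKernel hη hε hpos _).continuous.comp
        (by fun_prop : Continuous fun w : Euc n => (y, w)))).continuousOn
  refine ContDiffAt.congr_of_eventuallyEq ?_ h1
  have h2 : ContDiff ℝ ∞ fun y => |(ε y ^ n)⁻¹| := by
    have : (fun y => |(ε y ^ n)⁻¹|) = fun y => (ε y ^ n)⁻¹ := by
      ext y
      exact abs_of_nonneg (by have := hpos y; positivity)
    rw [this]
    exact (hε.pow n).inv fun y => (pow_pos (hpos y) n).ne'
  refine (h2.smul (ContDiff.sum fun i _ => ?_)).contDiffAt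
  exact contDiff_setIntegral_smul (s := ⊤) hSc (hFi i) (contDiff_regKernel hη hε hpos _)

/-- The regularization is smooth at the points where the step does not vanish. -/
lemma contDiffAt_regularize_of_pos (hη : ContDiff ℝ ∞ η)
    (hη0 : ∀ z ∉ closedBall (0 : Euc n) 1, η z = 0) (hε : ContDiff ℝ ∞ ε)
    (hF : Continuous F) {x : Euc n} {τ : ℝ} (hτ : 0 < τ) (hx : 0 < ε x) :
    ContDiffAt ℝ ∞ (fun x => regularize η ε F (x, τ)) x := by
  obtain ⟨b, hb⟩ := exists_contDiffBump_tsupport_subset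
    ((isOpen_lt continuous_const hε.continuous).mem_nhds hx)
  -- Only the step and its derivative near `x` matter, so `τ ε` is replaced by a function that is
  -- positive everywhere and agrees with `τ ε` near `x`; the parameter becomes `1`.
  set ε' : Euc n → ℝ := fun y => τ * (b y * ε y) + (1 - b y) with hε'
  have hε's : ContDiff ℝ ∞ ε' :=
    (contDiff_const.mul (b.contDiff.mul hε)).add (contDiff_const.sub b.contDiff)
  have hpos : ∀ y, 0 < ε' y := by
    intro y
    by_cases hy : 0 < ε y
    · rcases b.nonneg.eq_or_lt (a := 0) (b := b y) with h | h
      · simp [hε', ← h]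
      · have h1 := b.le_one (x := y)
        have : 0 < τ * (b y * ε y) := by positivity
        simp only [hε']
        linarith
    · have : b y = 0 := image_eq_zero_of_notMem_tsupport fun h => hy (hb h)
      simp [hε', this]
  have heq : ∀ᶠ y in 𝓝 x, ε' y = τ * ε y := by
    filter_upwards [b.eventuallyEq_one] with y hy
    simp [hε', hy]
  refine (contDiffAt_regularize_one_of_pos hη hη0 hε's hpos hF x).congr_of_eventuallyEq ?_
  filter_upwards [heq.eventually_nhds] with y hy
  have h1 : ε' y = τ * ε y := hy.self_of_nhds
  have h2 : fderiv ℝ ε' y = τ • fderiv ℝ ε y := by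
    rw [Filter.EventuallyEq.fderiv_eq hy]
    exact fderiv_const_mul ((hε.differentiable (by simp)) y) τ
  simp [regularize, shiftFlux, h1, h2]

end Regularization

/-! ### Jacobi's formula and the Piola transform. -/

section Piola

variable {n : ℕ}

lemma differentiable_det : Differentiable ℝ fun A : Euc n →L[ℝ] Euc n => A.det := by
  have h : (fun A : Euc n →L[ℝ] Euc n => A.det) = fun A =>
      ∑ σ : Equiv.Perm (Fin n), ((Equiv.Perm.sign σ : ℤ) : ℝ) *
        ∏ i, A (EuclideanSpace.single i 1) (σ i) := by
    ext1 A
    change LinearMap.det (A : Euc n →ₗ[ℝ] Euc n) = _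
    rw [← LinearMap.det_toMatrix (EuclideanSpace.basisFun (Fin n) ℝ).toBasis, Matrix.det_apply']
    simp [LinearMap.toMatrix_apply]
  rw [h]
  have hd : ∀ i j : Fin n, Differentiable ℝ fun A : Euc n →L[ℝ] Euc n =>
      A (EuclideanSpace.single i 1) j := fun i j =>
    ((EuclideanSpace.proj j : Euc n →L[ℝ] ℝ).comp
      (ContinuousLinearMap.apply ℝ (Euc n) (EuclideanSpace.single i (1 : ℝ)))).differentiable
  fun_prop

/-- Jacobi's formula for the derivative of the determinant. -/
lemma fderiv_det_apply {A B : Euc n →L[ℝ] Euc n} (hAB : A.comp B = ContinuousLinearMap.id ℝ _)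
    (H : Euc n →L[ℝ] Euc n) :
    fderiv ℝ (fun A : Euc n →L[ℝ] Euc n => A.det) A H = A.det * traceL n (B.comp H) := by
  have h1 : HasDerivAt (fun t : ℝ => (A + t • H).det)
      (fderiv ℝ (fun A : Euc n →L[ℝ] Euc n => A.det) A H) 0 := by
    have h2 : HasDerivAt (fun t : ℝ => A + t • H) H 0 := by
      simpa using ((hasDerivAt_id (0 : ℝ)).smul_const H).const_add A
    have h3 : HasFDerivAt (fun A : Euc n →L[ℝ] Euc n => A.det)
        (fderiv ℝ (fun A : Euc n →L[ℝ] Euc n => A.det) A) (A + (0 : ℝ) • H) := by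
      have h0 : A + (0 : ℝ) • H = A := by ext1 v; simp
      rw [h0]
      exact (differentiable_det A).hasFDerivAt
    exact h3.comp_hasDerivAt (0 : ℝ) h2
  set b := (EuclideanSpace.basisFun (Fin n) ℝ).toBasis
  set Q := LinearMap.toMatrix b b (B.comp H : Euc n →ₗ[ℝ] Euc n) with hQ
  have h4 : ∀ t : ℝ, (A + t • H).det = A.det * (1 + t • Q).det := by
    intro t
    have h5 : A + t • H = A.comp (ContinuousLinearMap.id ℝ _ + t • B.comp H) := by
      rw [ContinuousLinearMap.comp_add, ContinuousLinearMap.comp_id, ContinuousLinearMap.comp_smul,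
        ← ContinuousLinearMap.comp_assoc, hAB, ContinuousLinearMap.id_comp]
    rw [h5]
    change LinearMap.det ((A : Euc n →ₗ[ℝ] Euc n) ∘ₗ
      ((ContinuousLinearMap.id ℝ _ + t • B.comp H : Euc n →L[ℝ] Euc n) : Euc n →ₗ[ℝ] Euc n)) = _
    rw [LinearMap.det_comp]
    congr 1
    rw [← LinearMap.det_toMatrix b]
    congr 1
    simp [hQ]
  have h6 : HasDerivAt (fun t : ℝ => A.det * (1 + t • Q).det) (A.det * Q.trace) 0 := by
    refine HasDerivAt.const_mul _ ?_
    -- `det (1 + t Q) = 1 + t tr Q + t² (…)`, with a polynomial remainder, so the derivative at `0`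
    -- is the trace.
    have h9 := fun t : ℝ => Matrix.det_one_add_smul t Q
    rw [funext h9]
    have h7 := (((hasDerivAt_id (0 : ℝ)).const_mul Q.trace).const_add 1).add
      (((Matrix.det (1 + (Polynomial.X : Polynomial ℝ) •
        Q.map Polynomial.C)).divX.divX.hasDerivAt 0).mul (hasDerivAt_pow 2 (0 : ℝ)))
    convert! h7 using 1
    simp
  have h8 : Q.trace = traceL n (B.comp H) := by
    rw [traceL_eq_trace, LinearMap.trace_eq_matrix_trace ℝ b]
  rw [← h8]
  simp only [h4] at h1
  exact h1.unique h6

/-- The divergence is multiplied by the Jacobian under the Piola transform. -/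
lemma ediv_eq_det_mul_ediv {ψ F G : Euc n → Euc n} {y : Euc n} (hψ : ContDiffAt ℝ 2 ψ y)
    (hF : DifferentiableAt ℝ F y) (hG : DifferentiableAt ℝ G (ψ y)) {B : Euc n →L[ℝ] Euc n}
    (hAB : (fderiv ℝ ψ y).comp B = ContinuousLinearMap.id ℝ _)
    (hBA : B.comp (fderiv ℝ ψ y) = ContinuousLinearMap.id ℝ _)
    (h : ∀ᶠ y' in 𝓝 y, fderiv ℝ ψ y' (F y') = (fderiv ℝ ψ y').det • G (ψ y')) :
    ediv F y = (fderiv ℝ ψ y).det * ediv G (ψ y) := by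
  set A := fderiv ℝ ψ y with hA
  have hψ1 : HasFDerivAt ψ A y := (hψ.differentiableAt (by simp)).hasFDerivAt
  have hψ2 : HasFDerivAt (fderiv ℝ ψ) (fderiv ℝ (fderiv ℝ ψ) y) y :=
    ((hψ.fderiv_right (m := 1) (by norm_num)).differentiableAt (by simp)).hasFDerivAt
  set D := fderiv ℝ (fderiv ℝ ψ) y with hD
  have hsymm : ∀ v w, D v w = D w v := fun v w =>
    (hψ.isSymmSndFDerivAt (by simp)) v w
  have hL := hψ2.clm_apply hF.hasFDerivAt
  have hJ : HasFDerivAt (fun y => (fderiv ℝ ψ y).det)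
      ((fderiv ℝ (fun A : Euc n →L[ℝ] Euc n => A.det) A).comp D) y :=
    (differentiable_det A).hasFDerivAt.comp y hψ2
  have hR := hJ.smul (hG.hasFDerivAt.comp y hψ1)
  have hLR := (hL.congr_of_eventuallyEq (Filter.EventuallyEq.symm h)).unique hR
  have hy : A (F y) = A.det • G (ψ y) := h.self_of_nhds
  have hBF : A.det • B (G (ψ y)) = F y := by
    rw [← map_smul, ← hy]
    exact congrArg (fun L : Euc n →L[ℝ] Euc n => L (F y)) hBA
  -- The identity `Dψ(F) = det(Dψ) G ∘ ψ` has been differentiated; it is now composed with `B =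
  -- (Dψ)⁻¹` and traced. The second derivatives of `ψ` contribute `tr (B D(F))` to both sides, on
  -- the left by symmetry (`e3`) and on the right by Jacobi's formula (`e4`), and cancel.
  have htr := congrArg (fun L => traceL n (B.comp L)) hLR
  simp only [ContinuousLinearMap.comp_add, map_add, ContinuousLinearMap.comp_smul, map_smul,
    Function.comp_apply] at htr
  have e1 : traceL n (B.comp (A.comp (fderiv ℝ F y))) = ediv F y := by
    rw [← ContinuousLinearMap.comp_assoc, hBA, ContinuousLinearMap.id_comp, ediv]
  have e2 : traceL n (B.comp ((fderiv ℝ G (ψ y)).comp A)) = ediv G (ψ y) := by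
    rw [traceL_comp_comm, ContinuousLinearMap.comp_assoc, hAB, ContinuousLinearMap.comp_id, ediv]
  have e3 : B.comp (D.flip (F y)) = B.comp (D (F y)) := by
    congr 1
    ext1 v
    exact hsymm v (F y)
  have e4 : traceL n (B.comp (((fderiv ℝ (fun A : Euc n →L[ℝ] Euc n => A.det) A).comp D).smulRight
      (G (ψ y)))) = traceL n (B.comp (D (F y))) := by
    have : B.comp (((fderiv ℝ (fun A : Euc n →L[ℝ] Euc n => A.det) A).comp D).smulRight
        (G (ψ y))) = ((fderiv ℝ (fun A : Euc n →L[ℝ] Euc n => A.det) A).comp D).smulRight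
        (B (G (ψ y))) := by
      ext1 v
      simp
    rw [this, traceL_smulRight, ContinuousLinearMap.comp_apply, fderiv_det_apply hAB, ← hBF]
    simp only [map_smul, ContinuousLinearMap.comp_smul, smul_eq_mul]
  rw [e1, e2, e3, e4, smul_eq_mul] at htr
  linarith

end Piola

/-! ### Chart changes for vector fields and volume densities. -/

section Charts

variable {n : ℕ} {M : Type*} [TopologicalSpace M] [ChartedSpace (EuclideanSpace ℝ (Fin n)) M]
  [IsManifold (𝓡 n) ∞ M] {e e' : OpenPartialHomeomorph M (EuclideanSpace ℝ (Fin n))}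

lemma mdifferentiable_of_mem (he : e ∈ IsManifold.maximalAtlas (𝓡 n) ∞ M) :
    e.MDifferentiable (𝓡 n) (𝓡 n) :=
  ⟨(contMDiffOn_of_mem_maximalAtlas he).mdifferentiableOn (by simp),
    (contMDiffOn_symm_of_mem_maximalAtlas he).mdifferentiableOn (by simp)⟩

lemma mfderiv_symm_apply_mfderiv (he : e ∈ IsManifold.maximalAtlas (𝓡 n) ∞ M) {y : Euc n}
    (hy : y ∈ e.target) (v : TangentSpace (𝓡 n) (e.symm y)) :
    mfderiv (𝓡 n) (𝓡 n) e.symm y (mfderiv (𝓡 n) (𝓡 n) e (e.symm y) v) = v := by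
  have h := (mdifferentiable_of_mem he).symm_comp_deriv (e.map_target hy)
  rw [e.right_inv hy] at h
  exact congrArg (fun L => L v) h

lemma mfderiv_apply_mfderiv_symm (he : e ∈ IsManifold.maximalAtlas (𝓡 n) ∞ M) {y : Euc n}
    (hy : y ∈ e.target) (v : Euc n) :
    mfderiv (𝓡 n) (𝓡 n) e (e.symm y) (mfderiv (𝓡 n) (𝓡 n) e.symm y v) = v :=
  congrArg (fun L => L v) ((mdifferentiable_of_mem he).comp_symm_deriv hy)

lemma mfderiv_symm_chartField (he : e ∈ IsManifold.maximalAtlas (𝓡 n) ∞ M)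
    (X : ∀ x : M, TangentSpace (𝓡 n) x) {y : Euc n} (hy : y ∈ e.target) :
    mfderiv (𝓡 n) (𝓡 n) e.symm y (chartField e X y) = X (e.symm y) :=
  mfderiv_symm_apply_mfderiv he hy _

lemma contDiffAt_transition (he : e ∈ IsManifold.maximalAtlas (𝓡 n) ∞ M)
    (he' : e' ∈ IsManifold.maximalAtlas (𝓡 n) ∞ M) {y : Euc n} (hy : y ∈ e.target)
    (hy' : e.symm y ∈ e'.source) : ContDiffAt ℝ ∞ (fun y => e' (e.symm y)) y := by
  have h1 := contMDiffAt_symm_of_mem_maximalAtlas he hy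
  have h2 := contMDiffAt_of_mem_maximalAtlas he' hy'
  exact contMDiffAt_iff_contDiffAt.1 (h2.comp y h1)

lemma fderiv_transition_apply (he : e ∈ IsManifold.maximalAtlas (𝓡 n) ∞ M)
    (he' : e' ∈ IsManifold.maximalAtlas (𝓡 n) ∞ M) {y : Euc n} (hy : y ∈ e.target)
    (hy' : e.symm y ∈ e'.source) (v : Euc n) :
    fderiv ℝ (fun y => e' (e.symm y)) y v =
      mfderiv (𝓡 n) (𝓡 n) e' (e.symm y) (mfderiv (𝓡 n) (𝓡 n) e.symm y v) := by
  have h := mfderiv_comp y ((mdifferentiable_of_mem he').mdifferentiableAt hy')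
    ((mdifferentiable_of_mem he).mdifferentiableAt_symm hy)
  rw [← mfderiv_eq_fderiv]
  exact congrArg (fun L => L v) h

lemma chartField_transition (he : e ∈ IsManifold.maximalAtlas (𝓡 n) ∞ M)
    (he' : e' ∈ IsManifold.maximalAtlas (𝓡 n) ∞ M) (X : ∀ x : M, TangentSpace (𝓡 n) x) {y : Euc n}
    (hy : y ∈ e.target) (hy' : e.symm y ∈ e'.source) :
    chartField e' X (e' (e.symm y)) =
      fderiv ℝ (fun y => e' (e.symm y)) y (chartField e X y) := by
  rw [fderiv_transition_apply he he' hy hy', mfderiv_symm_chartField he X hy, chartField,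
    e'.left_inv hy']

lemma mfderiv_symm_transition (he : e ∈ IsManifold.maximalAtlas (𝓡 n) ∞ M)
    (he' : e' ∈ IsManifold.maximalAtlas (𝓡 n) ∞ M) {y : Euc n} (hy : y ∈ e.target)
    (hy' : e.symm y ∈ e'.source) (v : Euc n) :
    (mfderiv (𝓡 n) (𝓡 n) e'.symm (e' (e.symm y))
      (fderiv ℝ (fun y => e' (e.symm y)) y v) : Euc n) = mfderiv (𝓡 n) (𝓡 n) e.symm y v := by
  rw [fderiv_transition_apply he he' hy hy']
  exact congrArg (fun L => L (mfderiv (𝓡 n) (𝓡 n) e.symm y v))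
    ((mdifferentiable_of_mem he').symm_comp_deriv hy')

lemma alternatingMap_apply_single (υ : Euc n [⋀^Fin n]→ₗ[ℝ] ℝ) (L : Euc n →L[ℝ] Euc n) :
    υ (fun i => L (EuclideanSpace.single i 1)) =
      L.det * υ (fun i => EuclideanSpace.single i 1) := by
  set b := (EuclideanSpace.basisFun (Fin n) ℝ).toBasis with hb
  have hbi : (b : Fin n → Euc n) = fun i => EuclideanSpace.single i 1 := by
    ext1 i; simp [hb]
  have h := υ.eq_smul_basis_det b
  have h1 : b.det (fun i => L (EuclideanSpace.single i 1)) = L.det := by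
    have := b.det_comp (L : Euc n →ₗ[ℝ] Euc n) b
    rw [b.det_self, mul_one, hbi] at this
    exact this
  rw [h]
  simp only [AlternatingMap.smul_apply, smul_eq_mul, h1, ← hbi, b.det_self]
  ring

lemma chartDensity_transition (he : e ∈ IsManifold.maximalAtlas (𝓡 n) ∞ M)
    (he' : e' ∈ IsManifold.maximalAtlas (𝓡 n) ∞ M)
    (υ : ∀ x : M, TangentSpace (𝓡 n) x [⋀^Fin n]→ₗ[ℝ] ℝ) {y : Euc n} (hy : y ∈ e.target)
    (hy' : e.symm y ∈ e'.source) :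
    chartDensity e υ y = (fderiv ℝ (fun y => e' (e.symm y)) y).det *
      chartDensity e' υ (e' (e.symm y)) := by
  let N₀ : Euc n →L[ℝ] Euc n := mfderiv (𝓡 n) (𝓡 n) e'.symm (e' (e.symm y))
  let N : Euc n →ₗ[ℝ] Euc n := N₀
  let υ' : Euc n [⋀^Fin n]→ₗ[ℝ] ℝ := υ (e.symm y)
  have h1 := alternatingMap_apply_single (υ'.compLinearMap N) (fderiv ℝ (fun y => e' (e.symm y)) y)
  have h2 : chartDensity e υ y = υ'.compLinearMap N
      (fun i => fderiv ℝ (fun y => e' (e.symm y)) y (EuclideanSpace.single i 1)) := by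
    change υ' _ = υ' _
    congr 1
    ext1 i
    exact (mfderiv_symm_transition he he' hy hy' _).symm
  rw [h2, h1]
  congr 1
  rw [chartDensity, e'.left_inv hy']
  rfl

lemma chartDensity_ne_zero (vol : VolumeForm n M) (he : e ∈ IsManifold.maximalAtlas (𝓡 n) ∞ M)
    {y : Euc n} (hy : y ∈ e.target) : chartDensity e vol.form y ≠ 0 := by
  let N : Euc n →L[ℝ] Euc n := mfderiv (𝓡 n) (𝓡 n) e.symm y
  let N' : Euc n →L[ℝ] Euc n := mfderiv (𝓡 n) (𝓡 n) e (e.symm y)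
  have h1 : ∀ v, N (N' v) = v := fun v => mfderiv_symm_apply_mfderiv he hy v
  have h2 : ∀ v, N' (N v) = v := fun v => mfderiv_apply_mfderiv_symm he hy v
  let Ne : Euc n ≃ₗ[ℝ] Euc n :=
    { (N : Euc n →ₗ[ℝ] Euc n) with
      invFun := N'
      left_inv := h2
      right_inv := h1 }
  let υ' : Euc n [⋀^Fin n]→ₗ[ℝ] ℝ := vol.form (e.symm y)
  have h3 := (AlternatingMap.map_basis_ne_zero_iff
    ((EuclideanSpace.basisFun (Fin n) ℝ).toBasis.map Ne) υ').2 (vol.ne_zero _)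
  have h4 : ⇑((EuclideanSpace.basisFun (Fin n) ℝ).toBasis.map Ne) =
      fun i => N (EuclideanSpace.single i 1) := by
    ext1 i
    simp [Ne]
  rw [h4] at h3
  exact h3

end Charts

/-! ### Regularity of vector fields, read in charts. -/

section Fields

variable {n : ℕ} {M : Type*} [TopologicalSpace M] [ChartedSpace (EuclideanSpace ℝ (Fin n)) M]
  [IsManifold (𝓡 n) ∞ M] {e e' : OpenPartialHomeomorph M (EuclideanSpace ℝ (Fin n))}
  {X Y : ∀ x : M, TangentSpace (𝓡 n) x} {x : M} {s : ℕ∞}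

/-- `X` is a vector field of class `C^s` near the point `x`. -/
def IsFieldAt (s : ℕ∞) (X : ∀ x : M, TangentSpace (𝓡 n) x) (x : M) : Prop :=
  ContMDiffAt (𝓡 n) (𝓡 n).tangent s (fun x => (⟨x, X x⟩ : TangentBundle (𝓡 n) M)) x

lemma IsFieldOn.isFieldAt {A : Set M} (h : IsFieldOn s A X) (hA : IsOpen A) (hx : x ∈ A) :
    IsFieldAt s X x :=
  ContMDiffOn.contMDiffAt h (hA.mem_nhds hx)

lemma isFieldOn_of_isFieldAt {A : Set M} (h : ∀ x ∈ A, IsFieldAt s X x) : IsFieldOn s A X :=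
  fun x hx => (h x hx).contMDiffWithinAt

lemma IsFieldAt.of_le {t : ℕ∞} (h : IsFieldAt s X x) (hts : t ≤ s) : IsFieldAt t X x :=
  ContMDiffAt.of_le h (by exact_mod_cast hts)

lemma contMDiffAt_tangentMap {M₁ M₂ : Type*} [TopologicalSpace M₁] [TopologicalSpace M₂]
    [ChartedSpace (EuclideanSpace ℝ (Fin n)) M₁] [ChartedSpace (EuclideanSpace ℝ (Fin n)) M₂]
    [IsManifold (𝓡 n) ∞ M₁] [IsManifold (𝓡 n) ∞ M₂] {f : M₁ → M₂} {t : Set M₁} (ht : IsOpen t)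
    (hf : ContMDiffOn (𝓡 n) (𝓡 n) ∞ f t) (p : TangentBundle (𝓡 n) M₁) (hp : p.1 ∈ t) :
    ContMDiffAt (𝓡 n).tangent (𝓡 n).tangent s (tangentMap (𝓡 n) (𝓡 n) f) p := by
  have h1 := hf.contMDiffOn_tangentMapWithin (m := s)
    (by exact_mod_cast (le_top : s + 1 ≤ (⊤ : ℕ∞))) ht.uniqueMDiffOn
  have h2 : IsOpen (Bundle.TotalSpace.proj ⁻¹' t : Set (TangentBundle (𝓡 n) M₁)) :=
    ht.preimage (FiberBundle.continuous_proj _ _)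
  refine (h1.contMDiffAt (h2.mem_nhds hp)).congr_of_eventuallyEq ?_
  filter_upwards [h2.mem_nhds hp] with q hq
  simp only [tangentMap, tangentMapWithin]
  rw [mfderivWithin_of_isOpen ht hq]

/-- A vector field is of class `C^s` at a point if and only if so is its expression in a chart. -/
lemma isFieldAt_iff (he : e ∈ IsManifold.maximalAtlas (𝓡 n) ∞ M) (hx : x ∈ e.source) :
    IsFieldAt s X x ↔ ContDiffAt ℝ s (chartField e X) (e x) := by
  have hs : (s : WithTop ℕ∞) ≤ ∞ := by exact_mod_cast le_top
  have hex := e.map_source hx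
  constructor
  · intro h
    have h1 : ContMDiffAt (𝓡 n) (𝓡 n) s e.symm (e x) :=
      (contMDiffAt_symm_of_mem_maximalAtlas he hex).of_le hs
    have h2 : ContMDiffAt (𝓡 n) (𝓡 n).tangent s
        (fun y => (⟨e.symm y, X (e.symm y)⟩ : TangentBundle (𝓡 n) M)) (e x) :=
      ContMDiffAt.comp_of_eq (x := e x) h h1 (e.left_inv hx)
    have h3 := (contMDiffAt_tangentMap (s := s) e.open_source (contMDiffOn_of_mem_maximalAtlas he)
      ⟨e.symm (e x), X (e.symm (e x))⟩ (e.map_target hex)).comp (e x) h2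
    have h4 : ContMDiffAt (𝓡 n) (𝓡 n).tangent s
        (fun y => (⟨y, chartField e X y⟩ : TangentBundle (𝓡 n) (EuclideanSpace ℝ (Fin n)))) (e x) := by
      refine h3.congr_of_eventuallyEq ?_
      filter_upwards [e.open_target.mem_nhds hex] with y hy
      simp only [Function.comp_apply, tangentMap, chartField]
      rw [e.right_inv hy]
    exact contMDiffAt_vectorSpace_iff_contDiffAt.1 h4
  · intro h
    have h1 : ContMDiffAt (𝓡 n) (𝓡 n) s e x :=
      (contMDiffAt_of_mem_maximalAtlas he hx).of_le hs
    have h2 : ContMDiffAt (𝓡 n) (𝓡 n).tangent s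
        (fun y => (⟨y, chartField e X y⟩ : TangentBundle (𝓡 n) (EuclideanSpace ℝ (Fin n)))) (e x) :=
      contMDiffAt_vectorSpace_iff_contDiffAt.2 h
    have h3 := (contMDiffAt_tangentMap (s := s) e.open_target
      (contMDiffOn_symm_of_mem_maximalAtlas he) ⟨e x, chartField e X (e x)⟩ hex).comp x
        (h2.comp x h1)
    refine ContMDiffAt.congr_of_eventuallyEq h3 ?_
    filter_upwards [e.open_source.mem_nhds hx] with z hz
    simp only [Function.comp_apply, tangentMap]
    rw [mfderiv_symm_chartField he X (e.map_source hz), e.left_inv hz]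

lemma chartField_congr (hx : x ∈ e.source) (h : ∀ᶠ z in 𝓝 x, X z = Y z) :
    chartField e X =ᶠ[𝓝 (e x)] chartField e Y := by
  have h1 : Filter.Tendsto e.symm (𝓝 (e x)) (𝓝 x) := e.tendsto_symm hx
  filter_upwards [h1.eventually h] with y hy
  exact congrArg (mfderiv (𝓡 n) (𝓡 n) e (e.symm y)) hy

lemma IsFieldAt.congr (h : IsFieldAt s X x) (hXY : ∀ᶠ z in 𝓝 x, Y z = X z) : IsFieldAt s Y x := by
  refine ContMDiffAt.congr_of_eventuallyEq h ?_
  filter_upwards [hXY] with z hz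
  rw [hz]

lemma chartField_add (e : OpenPartialHomeomorph M (EuclideanSpace ℝ (Fin n))) :
    chartField e (fun x => X x + Y x) = fun y => chartField e X y + chartField e Y y := by
  ext1 y
  exact map_add (mfderiv (𝓡 n) (𝓡 n) e (e.symm y)) _ _

lemma chartField_sub (e : OpenPartialHomeomorph M (EuclideanSpace ℝ (Fin n))) :
    chartField e (fun x => X x - Y x) = fun y => chartField e X y - chartField e Y y := by
  ext1 y
  exact map_sub (mfderiv (𝓡 n) (𝓡 n) e (e.symm y)) _ _

lemma chartField_smul (e : OpenPartialHomeomorph M (EuclideanSpace ℝ (Fin n))) (f : M → ℝ) :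
    chartField e (fun x => f x • X x) = fun y => f (e.symm y) • chartField e X y := by
  ext1 y
  exact map_smul (mfderiv (𝓡 n) (𝓡 n) e (e.symm y)) _ _

lemma chartField_zero (e : OpenPartialHomeomorph M (EuclideanSpace ℝ (Fin n))) :
    chartField e (fun x => (0 : TangentSpace (𝓡 n) x)) = fun _ => (0 : Euc n) := by
  ext1 y
  exact map_zero (mfderiv (𝓡 n) (𝓡 n) e (e.symm y))

lemma contDiffAt_comp_symm {f : M → ℝ} (hf : ContMDiff (𝓡 n) 𝓘(ℝ, ℝ) ∞ f)
    (he : e ∈ IsManifold.maximalAtlas (𝓡 n) ∞ M) {y : Euc n} (hy : y ∈ e.target) :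
    ContDiffAt ℝ ∞ (fun y => f (e.symm y)) y :=
  contMDiffAt_iff_contDiffAt.1
    ((hf.contMDiffAt).comp y (contMDiffAt_symm_of_mem_maximalAtlas he hy))

lemma chart_mem (x : M) :
    chartAt (EuclideanSpace ℝ (Fin n)) x ∈ IsManifold.maximalAtlas (𝓡 n) ∞ M :=
  IsManifold.chart_mem_maximalAtlas x

lemma IsFieldAt.add (hX : IsFieldAt s X x) (hY : IsFieldAt s Y x) :
    IsFieldAt s (fun x => X x + Y x) x := by
  rw [isFieldAt_iff (chart_mem x) (mem_chart_source _ x)] at *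
  rw [chartField_add]
  exact hX.add hY

lemma IsFieldAt.sub (hX : IsFieldAt s X x) (hY : IsFieldAt s Y x) :
    IsFieldAt s (fun x => X x - Y x) x := by
  rw [isFieldAt_iff (chart_mem x) (mem_chart_source _ x)] at *
  rw [chartField_sub]
  exact hX.sub hY

lemma IsFieldAt.smul {f : M → ℝ} (hf : ContMDiff (𝓡 n) 𝓘(ℝ, ℝ) ∞ f) (hX : IsFieldAt s X x) :
    IsFieldAt s (fun x => f x • X x) x := by
  rw [isFieldAt_iff (chart_mem x) (mem_chart_source _ x)] at *
  rw [chartField_smul]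
  exact ((contDiffAt_comp_symm hf (chart_mem x) (mem_chart_target _ x)).of_le
    (by exact_mod_cast le_top)).smul hX

lemma isFieldAt_zero : IsFieldAt s (fun x : M => (0 : TangentSpace (𝓡 n) x)) x := by
  rw [isFieldAt_iff (chart_mem x) (mem_chart_source _ x), chartField_zero]
  exact contDiffAt_const

lemma isFieldAt_sum {ι : Type*} (t : Finset ι) {W : ι → ∀ x : M, TangentSpace (𝓡 n) x}
    (h : ∀ i ∈ t, IsFieldAt s (W i) x) : IsFieldAt s (fun x => ∑ i ∈ t, W i x) x := by
  classical
  induction t using Finset.induction_on with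
  | empty => simpa using isFieldAt_zero
  | insert a t ha ih =>
    simp only [Finset.sum_insert ha]
    exact (h a (Finset.mem_insert_self _ _)).add
      (ih fun i hi => h i (Finset.mem_insert_of_mem hi))

end Fields

/-! ### The divergence of a vector field and its independence of the chart. -/

section Divergence

variable {n : ℕ} {M : Type*} [TopologicalSpace M] [ChartedSpace (EuclideanSpace ℝ (Fin n)) M]
  [IsManifold (𝓡 n) ∞ M] {e e' : OpenPartialHomeomorph M (EuclideanSpace ℝ (Fin n))}
  {X Y : ∀ x : M, TangentSpace (𝓡 n) x} {x : M} {s : ℕ∞} (vol : VolumeForm n M)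

lemma contDiffAt_chartDensity (he : e ∈ IsManifold.maximalAtlas (𝓡 n) ∞ M) {y : Euc n}
    (hy : y ∈ e.target) : ContDiffAt ℝ ∞ (chartDensity e vol.form) y :=
  (vol.smooth e he).contDiffAt (e.open_target.mem_nhds hy)

lemma IsFieldAt.differentiableAt (hX : IsFieldAt 1 X x)
    (he : e ∈ IsManifold.maximalAtlas (𝓡 n) ∞ M) (hx : x ∈ e.source) :
    DifferentiableAt ℝ (chartField e X) (e x) :=
  ((isFieldAt_iff he hx).1 hX).differentiableAt (by simp)

lemma differentiableAt_chartDensity_smul (hX : IsFieldAt 1 X x)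
    (he : e ∈ IsManifold.maximalAtlas (𝓡 n) ∞ M) (hx : x ∈ e.source) :
    DifferentiableAt ℝ (fun y => chartDensity e vol.form y • chartField e X y) (e x) :=
  ((contDiffAt_chartDensity vol he (e.map_source hx)).differentiableAt (by simp)).smul
    (hX.differentiableAt he hx)

lemma chartDivergence_eq (hX : IsFieldAt 1 X x) (he : e ∈ IsManifold.maximalAtlas (𝓡 n) ∞ M)
    (hx : x ∈ e.source) :
    chartDivergence vol e X x = (chartDensity e vol.form (e x))⁻¹ *
      ediv (fun y => chartDensity e vol.form y • chartField e X y) (e x) := by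
  rw [chartDivergence, ediv, traceL_apply]
  congr 1
  refine Finset.sum_congr rfl fun i _ => ?_
  have h := ((EuclideanSpace.proj i : Euc n →L[ℝ] ℝ).hasFDerivAt.comp (e x)
    (differentiableAt_chartDensity_smul vol hX he hx).hasFDerivAt).fderiv
  have h' := congrArg (fun L => L (EuclideanSpace.single i 1)) h
  simpa [Function.comp_def] using h'

/-- The divergence of a `C^1` vector field does not depend on the chart. -/
lemma chartDivergence_eq_chartDivergence (hX : IsFieldAt 1 X x)
    (he : e ∈ IsManifold.maximalAtlas (𝓡 n) ∞ M) (he' : e' ∈ IsManifold.maximalAtlas (𝓡 n) ∞ M)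
    (hx : x ∈ e.source) (hx' : x ∈ e'.source) :
    chartDivergence vol e X x = chartDivergence vol e' X x := by
  have hy := e.map_source hx
  have hy' : e.symm (e x) ∈ e'.source := by rwa [e.left_inv hx]
  have hψx : e' (e.symm (e x)) = e' x := by rw [e.left_inv hx]
  set ψ : Euc n → Euc n := fun y => e' (e.symm y) with hψ
  have hψs : ContDiffAt ℝ ∞ ψ (e x) := contDiffAt_transition he he' hy hy'
  have hz : e' x ∈ e'.target := e'.map_source hx'
  have hz' : e'.symm (e' x) ∈ e.source := by rwa [e'.left_inv hx']
  set φ : Euc n → Euc n := fun y => e (e'.symm y) with hφ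
  have hφs : ContDiffAt ℝ ∞ φ (e' x) := contDiffAt_transition he' he hz hz'
  have hφx : φ (e' x) = e x := by simp only [hφ, e'.left_inv hx']
  have hev : ∀ᶠ y in 𝓝 (e x), y ∈ e.target ∧ e.symm y ∈ e'.source := by
    refine (e.open_target.eventually_mem hy).and ?_
    exact (e.tendsto_symm hx).eventually (e'.open_source.eventually_mem hx')
  have hev' : ∀ᶠ y in 𝓝 (e' x), y ∈ e'.target ∧ e'.symm y ∈ e.source := by
    refine (e'.open_target.eventually_mem hz).and ?_
    exact (e'.tendsto_symm hx').eventually (e.open_source.eventually_mem hx)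
  have hdψ : HasFDerivAt ψ (fderiv ℝ ψ (e x)) (e x) :=
    (hψs.differentiableAt (by simp)).hasFDerivAt
  have hdφ : HasFDerivAt φ (fderiv ℝ φ (e' x)) (e' x) :=
    (hφs.differentiableAt (by simp)).hasFDerivAt
  have hBA : (fderiv ℝ φ (e' x)).comp (fderiv ℝ ψ (e x)) = ContinuousLinearMap.id ℝ _ := by
    have h1 : HasFDerivAt (φ ∘ ψ) ((fderiv ℝ φ (e' x)).comp (fderiv ℝ ψ (e x))) (e x) := by
      rw [← hψx] at hdφ ⊢
      exact hdφ.comp (e x) hdψ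
    refine (h1.congr_of_eventuallyEq ?_).unique (hasFDerivAt_id (e x))
    filter_upwards [hev] with y hy
    simp only [Function.comp_apply, hφ, hψ, e'.left_inv hy.2, e.right_inv hy.1, id]
  have hAB : (fderiv ℝ ψ (e x)).comp (fderiv ℝ φ (e' x)) = ContinuousLinearMap.id ℝ _ := by
    have h1 : HasFDerivAt (ψ ∘ φ) ((fderiv ℝ ψ (e x)).comp (fderiv ℝ φ (e' x))) (e' x) := by
      rw [← hφx] at hdψ ⊢
      exact hdψ.comp (e' x) hdφ
    refine (h1.congr_of_eventuallyEq ?_).unique (hasFDerivAt_id (e' x))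
    filter_upwards [hev'] with y hy
    simp only [Function.comp_apply, hφ, hψ, e.left_inv hy.2, e'.right_inv hy.1, id]
  have hG := differentiableAt_chartDensity_smul vol hX he' hx'
  rw [← hψx] at hG
  -- The fluxes `ρ X` in the two charts are Piola transforms of each other, because the field is
  -- multiplied by `Dψ` and the densities satisfy `ρ = det(Dψ) ρ' ∘ ψ`.
  have key := ediv_eq_det_mul_ediv (hψs.of_le (by simpa using ENat.LEInfty.out))
    (differentiableAt_chartDensity_smul vol hX he hx) hG hAB hBA (by
      filter_upwards [hev] with y hy
      rw [map_smul, ← chartField_transition he he' X hy.1 hy.2,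
        chartDensity_transition he he' vol.form hy.1 hy.2, smul_smul])
  rw [chartDivergence_eq vol hX he hx, chartDivergence_eq vol hX he' hx', key,
    chartDensity_transition he he' vol.form hy hy']
  have hρ' := chartDensity_ne_zero vol he' hz
  have hρ := chartDensity_ne_zero vol he hy
  rw [chartDensity_transition he he' vol.form hy hy'] at hρ
  have hJ : (fderiv ℝ ψ (e x)).det ≠ 0 := left_ne_zero_of_mul hρ
  simp only [hψ, hψx] at *
  field_simp

/-- The divergence of a vector field. -/
def divergence (X : ∀ x : M, TangentSpace (𝓡 n) x) (x : M) : ℝ :=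
  chartDivergence vol (chartAt (EuclideanSpace ℝ (Fin n)) x) X x

lemma divergence_eq_chartDivergence (hX : IsFieldAt 1 X x)
    (he : e ∈ IsManifold.maximalAtlas (𝓡 n) ∞ M) (hx : x ∈ e.source) :
    divergence vol X x = chartDivergence vol e X x :=
  chartDivergence_eq_chartDivergence vol hX (chart_mem x) he (mem_chart_source _ x) hx

lemma divergence_eq (hX : IsFieldAt 1 X x) (he : e ∈ IsManifold.maximalAtlas (𝓡 n) ∞ M)
    (hx : x ∈ e.source) :
    divergence vol X x = (chartDensity e vol.form (e x))⁻¹ *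
      ediv (fun y => chartDensity e vol.form y • chartField e X y) (e x) := by
  rw [divergence_eq_chartDivergence vol hX he hx, chartDivergence_eq vol hX he hx]

lemma isDivFreeFieldOn_of {A : Set M} (hs : 1 ≤ s) (h : ∀ x ∈ A, IsFieldAt s X x)
    (h0 : ∀ x ∈ A, divergence vol X x = 0) : IsDivFreeFieldOn vol s A X :=
  ⟨isFieldOn_of_isFieldAt h, fun e he x hx => by
    rw [← divergence_eq_chartDivergence vol ((h x hx.2).of_le hs) he hx.1, h0 x hx.2]⟩

lemma IsDivFreeFieldOn.isFieldAt {A : Set M} (h : IsDivFreeFieldOn vol s A X) (hA : IsOpen A)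
    (hx : x ∈ A) : IsFieldAt s X x :=
  IsFieldOn.isFieldAt h.1 hA hx

lemma IsDivFreeFieldOn.divergence_eq_zero {A : Set M} (h : IsDivFreeFieldOn vol s A X)
    (hx : x ∈ A) : divergence vol X x = 0 :=
  h.2 _ (chart_mem x) x ⟨mem_chart_source _ x, hx⟩

lemma divergence_congr (h : ∀ᶠ z in 𝓝 x, X z = Y z) :
    divergence vol X x = divergence vol Y x := by
  have h1 := chartField_congr (mem_chart_source (EuclideanSpace ℝ (Fin n)) x) h
  unfold divergence chartDivergence
  congr 1
  refine Finset.sum_congr rfl fun i _ => ?_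
  have h2 : (fun y => chartDensity (chartAt (EuclideanSpace ℝ (Fin n)) x) vol.form y *
      chartField (chartAt (EuclideanSpace ℝ (Fin n)) x) X y i) =ᶠ[𝓝 (chartAt _ x x)]
      (fun y => chartDensity (chartAt (EuclideanSpace ℝ (Fin n)) x) vol.form y *
        chartField (chartAt (EuclideanSpace ℝ (Fin n)) x) Y y i) := by
    filter_upwards [h1] with y hy
    rw [hy]
  rw [h2.fderiv_eq]

lemma divergence_add (hX : IsFieldAt 1 X x) (hY : IsFieldAt 1 Y x) :
    divergence vol (fun x => X x + Y x) x = divergence vol X x + divergence vol Y x := by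
  have hm := mem_chart_source (EuclideanSpace ℝ (Fin n)) x
  rw [divergence_eq vol hX (chart_mem x) hm, divergence_eq vol hY (chart_mem x) hm,
    divergence_eq vol (hX.add hY) (chart_mem x) hm, chartField_add, ← mul_add,
    ← ediv_add (differentiableAt_chartDensity_smul vol hX (chart_mem x) hm)
      (differentiableAt_chartDensity_smul vol hY (chart_mem x) hm)]
  simp only [smul_add]

/-- The last term is `df(X)`. For a divergence-free `X` it is all that remains, and it contains no
derivative of `X`: this is why the divergence equation is solved without loss. -/
lemma divergence_smul {f : M → ℝ} (hf : ContMDiff (𝓡 n) 𝓘(ℝ, ℝ) ∞ f) (hX : IsFieldAt 1 X x)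
    (he : e ∈ IsManifold.maximalAtlas (𝓡 n) ∞ M) (hx : x ∈ e.source) :
    divergence vol (fun x => f x • X x) x = f x * divergence vol X x +
      fderiv ℝ (fun y => f (e.symm y)) (e x) (chartField e X (e x)) := by
  have hρ := chartDensity_ne_zero vol he (e.map_source hx)
  rw [divergence_eq vol hX he hx, divergence_eq vol (hX.smul hf) he hx, chartField_smul]
  have h1 : (fun y => chartDensity e vol.form y • f (e.symm y) • chartField e X y) =
      fun y => f (e.symm y) • chartDensity e vol.form y • chartField e X y := by
    ext1 y
    exact smul_comm _ _ _
  rw [h1, ediv_smul ((contDiffAt_comp_symm hf he (e.map_source hx)).differentiableAt (by simp))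
    (differentiableAt_chartDensity_smul vol hX he hx), map_smul, e.left_inv hx, smul_eq_mul]
  field_simp

lemma divergence_const_smul (c : ℝ) (hX : IsFieldAt 1 X x) :
    divergence vol (fun x => c • X x) x = c * divergence vol X x := by
  have h := divergence_smul vol (f := fun _ : M => c) contMDiff_const hX (chart_mem x)
    (mem_chart_source _ x)
  simpa using h

lemma divergence_sub (hX : IsFieldAt 1 X x) (hY : IsFieldAt 1 Y x) :
    divergence vol (fun x => X x - Y x) x = divergence vol X x - divergence vol Y x := by
  have hm := mem_chart_source (EuclideanSpace ℝ (Fin n)) x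
  rw [divergence_eq vol hX (chart_mem x) hm, divergence_eq vol hY (chart_mem x) hm,
    divergence_eq vol (hX.sub hY) (chart_mem x) hm, chartField_sub, ← mul_sub,
    ← ediv_sub (differentiableAt_chartDensity_smul vol hX (chart_mem x) hm)
      (differentiableAt_chartDensity_smul vol hY (chart_mem x) hm)]
  simp only [smul_sub]

lemma divergence_zero : divergence vol (fun x : M => (0 : TangentSpace (𝓡 n) x)) x = 0 := by
  have h := divergence_const_smul vol 0 (isFieldAt_zero (n := n) (s := 1) (x := x))
  simpa using h

lemma divergence_sum {ι : Type*} (t : Finset ι) {W : ι → ∀ x : M, TangentSpace (𝓡 n) x}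
    (h : ∀ i ∈ t, IsFieldAt 1 (W i) x) :
    divergence vol (fun x => ∑ i ∈ t, W i x) x = ∑ i ∈ t, divergence vol (W i) x := by
  classical
  induction t using Finset.induction_on with
  | empty => simpa using divergence_zero vol
  | insert a t ha ih =>
    simp only [Finset.sum_insert ha]
    rw [divergence_add vol (h a (Finset.mem_insert_self _ _))
      (isFieldAt_sum t fun i hi => h i (Finset.mem_insert_of_mem hi)),
      ih fun i hi => h i (Finset.mem_insert_of_mem hi)]

end Divergence

/-! ### Extension by zero of fields and functions given in a chart. -/

section Extension

variable {n : ℕ} {M : Type*} [TopologicalSpace M] [ChartedSpace (EuclideanSpace ℝ (Fin n)) M]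
  [IsManifold (𝓡 n) ∞ M] {e e' : OpenPartialHomeomorph M (EuclideanSpace ℝ (Fin n))}
  {X Y : ∀ x : M, TangentSpace (𝓡 n) x} {x : M} {s : ℕ∞} (vol : VolumeForm n M)

/-- The derivative of the inverse of a chart, as a linear endomorphism of Euclidean space. -/
def symmDeriv (e : OpenPartialHomeomorph M (EuclideanSpace ℝ (Fin n))) (y : Euc n) :
    Euc n →L[ℝ] Euc n :=
  mfderiv (𝓡 n) (𝓡 n) e.symm y

open Classical in
/-- The vector field on `M` whose flux reads `F` in the chart `e`, extended by zero outside of the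
domain of `e`. -/
def extField (e : OpenPartialHomeomorph M (EuclideanSpace ℝ (Fin n))) (F : Euc n → Euc n) (x : M) :
    TangentSpace (𝓡 n) x :=
  (if x ∈ e.source then symmDeriv e (e x) ((chartDensity e vol.form (e x))⁻¹ • F (e x)) else 0 :
    Euc n)

open Classical in
/-- The function on `M` which reads `G / ρ` in the chart `e`, extended by zero outside of the
domain of `e`. -/
def extFun (e : OpenPartialHomeomorph M (EuclideanSpace ℝ (Fin n))) (G : Euc n → ℝ) (x : M) : ℝ :=
  if x ∈ e.source then (chartDensity e vol.form (e x))⁻¹ * G (e x) else 0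

variable {F : Euc n → Euc n} {G : Euc n → ℝ} {T : Set (Euc n)}

lemma chartField_extField (he : e ∈ IsManifold.maximalAtlas (𝓡 n) ∞ M) {y : Euc n}
    (hy : y ∈ e.target) :
    chartField e (extField vol e F) y = (chartDensity e vol.form y)⁻¹ • F y := by
  have h1 : (extField vol e F (e.symm y) : Euc n) =
      symmDeriv e y ((chartDensity e vol.form y)⁻¹ • F y) := by
    refine (if_pos (e.map_target hy)).trans ?_
    rw [e.right_inv hy]
  rw [chartField, h1]
  exact mfderiv_apply_mfderiv_symm he hy _

lemma extField_eq_zero (hF : ∀ y ∉ T, F y = 0) {x : M} (hx : x ∉ e.symm '' T) :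
    extField vol e F x = 0 := by
  by_cases h : x ∈ e.source
  · refine (if_pos h).trans ?_
    have : F (e x) = 0 := hF _ fun hm => hx ⟨e x, hm, e.left_inv h⟩
    rw [this, smul_zero, map_zero]
    rfl
  · exact if_neg h

lemma extFun_eq_zero (hG : ∀ y ∉ T, G y = 0) {x : M}
    (hx : x ∉ e.symm '' T) : extFun vol e G x = 0 := by
  unfold extFun
  split_ifs with h
  · have : G (e x) = 0 := hG _ fun hm => hx ⟨e x, hm, e.left_inv h⟩
    rw [this, mul_zero]
  · rfl

lemma isFieldAt_extField_of_mem (he : e ∈ IsManifold.maximalAtlas (𝓡 n) ∞ M) (hx : x ∈ e.source)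
    (hF : ContDiffAt ℝ s F (e x)) : IsFieldAt s (extField vol e F) x := by
  rw [isFieldAt_iff he hx]
  have hy := e.map_source hx
  have h1 : ContDiffAt ℝ s (fun y => (chartDensity e vol.form y)⁻¹ • F y) (e x) :=
    (((contDiffAt_chartDensity vol he hy).of_le (by exact_mod_cast le_top)).inv
      (chartDensity_ne_zero vol he hy)).smul hF
  refine h1.congr_of_eventuallyEq ?_
  filter_upwards [e.open_target.mem_nhds hy] with y hy using chartField_extField vol he hy

variable [T2Space M]

lemma isCompact_symm_image (hT : IsCompact T) (hTe : T ⊆ e.target) :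
    IsCompact (e.symm '' T) :=
  hT.image_of_continuousOn (e.continuousOn_symm.mono hTe)

lemma extField_eventually_eq_zero (hF0 : ∀ y ∉ T, F y = 0) (hT : IsCompact T)
    (hTe : T ⊆ e.target) (hx : x ∉ e.symm '' T) :
    ∀ᶠ z in 𝓝 x, extField vol e F z = 0 := by
  filter_upwards [(isCompact_symm_image hT hTe).isClosed.isOpen_compl.mem_nhds hx] with z hz
  exact extField_eq_zero vol hF0 hz

lemma symm_image_subset_source (hTe : T ⊆ e.target) : e.symm '' T ⊆ e.source := by
  rintro _ ⟨y, hy, rfl⟩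
  exact e.map_target (hTe hy)

lemma isFieldAt_extField (he : e ∈ IsManifold.maximalAtlas (𝓡 n) ∞ M) (hF : ContDiff ℝ s F)
    (hF0 : ∀ y ∉ T, F y = 0) (hT : IsCompact T) (hTe : T ⊆ e.target) (x : M) :
    IsFieldAt s (extField vol e F) x := by
  by_cases hx : x ∈ e.symm '' T
  · exact isFieldAt_extField_of_mem vol he (symm_image_subset_source hTe hx) hF.contDiffAt
  · exact isFieldAt_zero.congr (extField_eventually_eq_zero vol hF0 hT hTe hx)

/-- The factor `ρ⁻¹` in `extField` makes `ρ` times the field read `F` in the chart, so the weighted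
divergence becomes the Euclidean divergence of `F`, up to `ρ⁻¹`. -/
lemma divergence_extField (he : e ∈ IsManifold.maximalAtlas (𝓡 n) ∞ M) (hF : ContDiff ℝ 1 F)
    (hF0 : ∀ y ∉ T, F y = 0) (hT : IsCompact T) (hTe : T ⊆ e.target) (x : M) :
    divergence vol (extField vol e F) x = extFun vol e (ediv F) x := by
  have hX : IsFieldAt 1 (extField vol e F) x :=
    isFieldAt_extField vol he (by exact_mod_cast hF) hF0 hT hTe x
  by_cases hx : x ∈ e.source
  · rw [divergence_eq vol hX he hx, extFun, if_pos hx]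
    congr 1
    have h : (fun y => chartDensity e vol.form y • chartField e (extField vol e F) y)
        =ᶠ[𝓝 (e x)] F := by
      filter_upwards [e.open_target.mem_nhds (e.map_source hx)] with y hy
      rw [chartField_extField vol he hy, smul_smul,
        mul_inv_cancel₀ (chartDensity_ne_zero vol he hy), one_smul]
    rw [ediv, h.fderiv_eq, ediv]
  · rw [extFun, if_neg hx, divergence_congr vol (extField_eventually_eq_zero vol hF0 hT hTe
      fun h => hx (symm_image_subset_source hTe h)), divergence_zero]

end Extension

/-! ### Comparison of `C^r` sizes in charts and in a regular atlas. -/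

section Norms

variable {n : ℕ} {M : Type*} [TopologicalSpace M] [ChartedSpace (EuclideanSpace ℝ (Fin n)) M]
  [IsManifold (𝓡 n) ∞ M] {e e' : OpenPartialHomeomorph M (EuclideanSpace ℝ (Fin n))}

/-- On a compact set the `C^r` sizes of a vector field in two charts are comparable. -/
lemma exists_bound_chart_change (he : e ∈ IsManifold.maximalAtlas (𝓡 n) ∞ M)
    (he' : e' ∈ IsManifold.maximalAtlas (𝓡 n) ∞ M) {T : Set M} (hT : IsCompact T)
    (hTe : T ⊆ e.source) (hTe' : T ⊆ e'.source) (r : ℕ) :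
    ∃ C : ℝ, 0 ≤ C ∧ ∀ (X : ∀ x : M, TangentSpace (𝓡 n) x) (x : M), x ∈ T → IsFieldAt r X x →
      ∀ B : ℝ, (∀ k ≤ r, ‖iteratedFDeriv ℝ k (chartField e X) (e x)‖ ≤ B) →
      ∀ k ≤ r, ‖iteratedFDeriv ℝ k (chartField e' X) (e' x)‖ ≤ C * B := by
  set φ : Euc n → Euc n := fun y => e (e'.symm y) with hφ
  set L : Euc n → (Euc n →L[ℝ] Euc n) := fun y => fderiv ℝ (fun y => e' (e.symm y)) (φ y) with hL
  have hr : (r : WithTop ℕ∞) ≤ ∞ := by exact_mod_cast le_top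
  have hopen : IsOpen (e'.target ∩ e'.symm ⁻¹' e.source) :=
    e'.isOpen_inter_preimage_symm e.open_source
  have hTi : IsCompact (e' '' T) := hT.image_of_continuousOn (e'.continuousOn.mono hTe')
  have hTsub : e' '' T ⊆ e'.target ∩ e'.symm ⁻¹' e.source := by
    rintro _ ⟨x, hx, rfl⟩
    exact ⟨e'.map_source (hTe' hx), by
      simpa only [mem_preimage, e'.left_inv (hTe' hx)] using hTe hx⟩
  have hφs : ∀ y ∈ e'.target ∩ e'.symm ⁻¹' e.source, ContDiffAt ℝ ∞ φ y := fun y hy =>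
    contDiffAt_transition he' he hy.1 hy.2
  have hLs : ∀ y ∈ e'.target ∩ e'.symm ⁻¹' e.source, ContDiffAt ℝ ∞ L y := by
    intro y hy
    have h1 : ContDiffAt ℝ ∞ (fun y => e' (e.symm y)) (φ y) :=
      contDiffAt_transition he he' (e.map_source hy.2) (by
        simp only [hφ, e.left_inv hy.2]; exact e'.map_target hy.1)
    exact (h1.fderiv_right (by simp)).comp y (hφs y hy)
  obtain ⟨a, ha1, ha⟩ := exists_iteratedFDeriv_bound hopen hTi hTsub r
    (fun y hy => ((hφs y hy).of_le hr).contDiffWithinAt)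
  obtain ⟨b, hb1, hb⟩ := exists_iteratedFDeriv_bound hopen hTi hTsub r
    (fun y hy => ((hLs y hy).of_le hr).contDiffWithinAt)
  refine ⟨2 ^ r * b * (r.factorial * a ^ r), by positivity, fun X x hx hX B hB k hk => ?_⟩
  have hy : e' x ∈ e' '' T := mem_image_of_mem _ hx
  have hmem := hTsub hy
  have hφx : φ (e' x) = e x := by simp only [hφ, e'.left_inv (hTe' hx)]
  have hXe : ContDiffAt ℝ r (chartField e X) (φ (e' x)) := by
    rw [hφx]
    exact_mod_cast (isFieldAt_iff he (hTe hx)).1 hX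
  have heq : chartField e' X =ᶠ[𝓝 (e' x)] fun y => L y (chartField e X (φ y)) := by
    filter_upwards [hopen.mem_nhds hmem] with y hy
    have h2 : e.symm (φ y) = e'.symm y := by simp only [hφ, e.left_inv hy.2]
    have h1 := chartField_transition he he' X (y := φ y) (e.map_source hy.2) (by
      rw [h2]; exact e'.map_target hy.1)
    rw [h2, e'.right_inv hy.1] at h1
    exact h1
  rw [(heq.iteratedFDeriv ℝ k).eq_of_nhds]
  refine (norm_iteratedFDeriv_clm_apply_le_at ((hLs _ hmem).of_le hr)
    (hXe.comp _ ((hφs _ hmem).of_le hr)) (fun i hi => hb _ hy i hi) (fun i hi => ?_) hk).trans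
    (le_of_eq (b := 2 ^ r * b * (r.factorial * B * a ^ r)) rfl) |>.trans (le_of_eq (by ring))
  exact norm_iteratedFDeriv_comp_le_at hXe ((hφs _ hmem).of_le hr) ha1
    (fun j _ hj => ha _ hy j hj) (fun j hj => by rw [hφx]; exact hB j hj) hi

/-- A `C^r` bound of a vector field in all local charts of a regular atlas, at the points of `A`. -/
def AtlasBound (𝒜 : RegularAtlas n M) (r : ℕ) (A : Set M) (X : ∀ x : M, TangentSpace (𝓡 n) x)
    (B : ℝ) : Prop :=
  ∀ j, ∀ x ∈ 𝒜.V j ∩ A, ∀ k ≤ r,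
    ‖iteratedFDeriv ℝ k (chartField (𝒜.chart j) X) (𝒜.chart j x)‖ ≤ B

variable {𝒜 : RegularAtlas n M} {r : ℕ} {A : Set M} {X Y : ∀ x : M, TangentSpace (𝓡 n) x} {B B' : ℝ}

lemma whitneyNorm_le_of_atlasBound (h : AtlasBound 𝒜 r A X B) :
    whitneyNorm 𝒜 r A X ≤ ENNReal.ofReal B := by
  refine iSup_le fun j => iSup_le fun k => iSup_le fun hk => iSup_le fun y => iSup_le ?_
  rintro ⟨x, hx, rfl⟩
  rw [← ofReal_norm]
  exact ENNReal.ofReal_le_ofReal (h j x hx k hk)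

lemma atlasBound_of_whitneyNorm_ne_top (h : whitneyNorm 𝒜 r A X ≠ ⊤) :
    AtlasBound 𝒜 r A X (whitneyNorm 𝒜 r A X).toReal := by
  intro j x hx k hk
  have h1 : ‖iteratedFDeriv ℝ k (chartField (𝒜.chart j) X) (𝒜.chart j x)‖ₑ ≤
      whitneyNorm 𝒜 r A X :=
    le_iSup_of_le j <| le_iSup_of_le k <| le_iSup_of_le hk <|
      le_iSup_of_le (𝒜.chart j x) <| le_iSup_of_le (mem_image_of_mem _ hx) le_rfl
  have h2 := ENNReal.toReal_mono h h1
  simpa using h2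

lemma RegularAtlas.exists_mem (𝒜 : RegularAtlas n M) (x : M) : ∃ j, x ∈ 𝒜.V j := by
  have : x ∈ ⋃ i, 𝒜.V i := by rw [𝒜.cover]; trivial
  simpa using this

lemma RegularAtlas.mem_source (𝒜 : RegularAtlas n M) {x : M} {j} (hx : x ∈ 𝒜.V j) :
    x ∈ (𝒜.chart j).source :=
  𝒜.closure_subset j (subset_closure hx)

lemma AtlasBound.nonneg (h : AtlasBound 𝒜 r A X B) (hA : A.Nonempty) : 0 ≤ B := by
  obtain ⟨x, hx⟩ := hA
  obtain ⟨j, hj⟩ := 𝒜.exists_mem x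
  exact (norm_nonneg _).trans (h j x ⟨hj, hx⟩ 0 (Nat.zero_le _))

lemma AtlasBound.mono (h : AtlasBound 𝒜 r A X B) (hB : B ≤ B') : AtlasBound 𝒜 r A X B' :=
  fun j x hx k hk => (h j x hx k hk).trans hB

lemma contDiffAt_of_isFieldAt (hX : ∀ x ∈ A, IsFieldAt r X x) {j} {x : M}
    (hx : x ∈ 𝒜.V j ∩ A) {k : ℕ} (hk : k ≤ r) :
    ContDiffAt ℝ k (chartField (𝒜.chart j) X) (𝒜.chart j x) :=
  ((isFieldAt_iff (𝒜.chart_mem j) (𝒜.mem_source hx.1)).1 (hX x hx.2)).of_le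
    (by exact_mod_cast hk)

lemma AtlasBound.add (h : AtlasBound 𝒜 r A X B) (h' : AtlasBound 𝒜 r A Y B')
    (hX : ∀ x ∈ A, IsFieldAt r X x) (hY : ∀ x ∈ A, IsFieldAt r Y x) :
    AtlasBound 𝒜 r A (fun x => X x + Y x) (B + B') := by
  intro j x hx k hk
  have e1 := contDiffAt_of_isFieldAt hX hx hk
  have e2 := contDiffAt_of_isFieldAt hY hx hk
  rw [chartField_add]
  have := iteratedFDeriv_add_apply e1 e2
  rw [show (fun y => chartField (𝒜.chart j) X y + chartField (𝒜.chart j) Y y) =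
    chartField (𝒜.chart j) X + chartField (𝒜.chart j) Y from rfl, this]
  exact (norm_add_le _ _).trans (add_le_add (h j x hx k hk) (h' j x hx k hk))

lemma AtlasBound.const_smul (h : AtlasBound 𝒜 r A X B) (hX : ∀ x ∈ A, IsFieldAt r X x) (c : ℝ) :
    AtlasBound 𝒜 r A (fun x => c • X x) (|c| * B) := by
  intro j x hx k hk
  have e1 := contDiffAt_of_isFieldAt hX hx hk
  rw [chartField_smul (f := fun _ => c)]
  have := iteratedFDeriv_const_smul_apply (a := c) e1
  rw [show (fun y => c • chartField (𝒜.chart j) X y) = c • chartField (𝒜.chart j) X from rfl, this,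
    norm_smul, Real.norm_eq_abs]
  exact mul_le_mul_of_nonneg_left (h j x hx k hk) (abs_nonneg _)

lemma atlasBound_zero : AtlasBound 𝒜 r A (fun x : M => (0 : TangentSpace (𝓡 n) x)) 0 := by
  intro j x hx k hk
  rw [chartField_zero]
  simp

lemma atlasBound_sum {ι : Type*} (t : Finset ι) {W : ι → ∀ x : M, TangentSpace (𝓡 n) x} {b : ι → ℝ}
    (h : ∀ i ∈ t, AtlasBound 𝒜 r A (W i) (b i)) (hW : ∀ i ∈ t, ∀ x ∈ A, IsFieldAt r (W i) x) :
    AtlasBound 𝒜 r A (fun x => ∑ i ∈ t, W i x) (∑ i ∈ t, b i) := by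
  classical
  induction t using Finset.induction_on with
  | empty => simpa using atlasBound_zero
  | insert a t ha ih =>
    simp only [Finset.sum_insert ha]
    exact (h a (Finset.mem_insert_self _ _)).add
      (ih (fun i hi => h i (Finset.mem_insert_of_mem hi))
        (fun i hi => hW i (Finset.mem_insert_of_mem hi)))
      (hW a (Finset.mem_insert_self _ _))
      (fun x hx => isFieldAt_sum t fun i hi => hW i (Finset.mem_insert_of_mem hi) x hx)

variable [CompactSpace M]

/-- In a chart, a vector field is controlled on compact sets by its `C^r` size in a regular
atlas. -/
lemma exists_bound_in_chart (𝒜 : RegularAtlas n M) (r : ℕ)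
    (he : e ∈ IsManifold.maximalAtlas (𝓡 n) ∞ M) {T : Set M} (hT : IsCompact T)
    (hTe : T ⊆ e.source) :
    ∃ C : ℝ, 0 ≤ C ∧ ∀ (A : Set M) (X : ∀ x : M, TangentSpace (𝓡 n) x), (∀ x ∈ A, IsFieldAt r X x) →
      ∀ B, AtlasBound 𝒜 r A X B → ∀ x ∈ T ∩ A, ∀ k ≤ r,
        ‖iteratedFDeriv ℝ k (chartField e X) (e x)‖ ≤ C * B := by
  -- Regularity of the atlas enters here: `T ∩ closure (V j)` is compact and lies in both chart
  -- domains, so the change of chart has bounded derivatives there.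
  have h : ∀ j, ∃ C : ℝ, 0 ≤ C ∧ ∀ (X : ∀ x : M, TangentSpace (𝓡 n) x) (x : M),
      x ∈ T ∩ closure (𝒜.V j) → IsFieldAt r X x →
      ∀ B : ℝ, (∀ k ≤ r, ‖iteratedFDeriv ℝ k (chartField (𝒜.chart j) X) (𝒜.chart j x)‖ ≤ B) →
      ∀ k ≤ r, ‖iteratedFDeriv ℝ k (chartField e X) (e x)‖ ≤ C * B := fun j =>
    exists_bound_chart_change (𝒜.chart_mem j) he (hT.inter_right isClosed_closure)
      (inter_subset_right.trans (𝒜.closure_subset j)) (inter_subset_left.trans hTe) r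
  choose C hC0 hC using h
  refine ⟨∑ j, C j, Finset.sum_nonneg fun j _ => hC0 j, fun A X hX B hB x hx k hk => ?_⟩
  obtain ⟨j, hj⟩ := 𝒜.exists_mem x
  have hB0 : 0 ≤ B := hB.nonneg ⟨x, hx.2⟩
  refine (hC j X x ⟨hx.1, subset_closure hj⟩ (hX x hx.2) B (hB j x ⟨hj, hx.2⟩) k hk).trans ?_
  exact mul_le_mul_of_nonneg_right
    (Finset.single_le_sum (f := C) (fun i _ => hC0 i) (Finset.mem_univ j)) hB0

variable [T2Space M]

/-- The `C^r` size of the extension of a vector field given in a chart. -/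
lemma exists_extField_bound (vol : VolumeForm n M) (𝒜 : RegularAtlas n M) (r : ℕ)
    (he : e ∈ IsManifold.maximalAtlas (𝓡 n) ∞ M) {T : Set (Euc n)} (hT : IsCompact T)
    (hTe : T ⊆ e.target) :
    ∃ C : ℝ, 0 ≤ C ∧ ∀ F : Euc n → Euc n, ContDiff ℝ r F → (∀ y ∉ T, F y = 0) → ∀ B, 0 ≤ B →
      (∀ y ∈ T, ∀ k ≤ r, ‖iteratedFDeriv ℝ k F y‖ ≤ B) →
      AtlasBound 𝒜 r univ (extField vol e F) (C * B) := by
  have hTc := isCompact_symm_image hT hTe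
  have hTs : e.symm '' T ⊆ e.source := symm_image_subset_source hTe
  have h : ∀ j, ∃ C : ℝ, 0 ≤ C ∧ ∀ (X : ∀ x : M, TangentSpace (𝓡 n) x) (x : M),
      x ∈ e.symm '' T ∩ closure (𝒜.V j) → IsFieldAt r X x →
      ∀ B : ℝ, (∀ k ≤ r, ‖iteratedFDeriv ℝ k (chartField e X) (e x)‖ ≤ B) →
      ∀ k ≤ r, ‖iteratedFDeriv ℝ k (chartField (𝒜.chart j) X) (𝒜.chart j x)‖ ≤ C * B := fun j =>
    exists_bound_chart_change he (𝒜.chart_mem j) (hTc.inter_right isClosed_closure)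
      (inter_subset_left.trans hTs) (inter_subset_right.trans (𝒜.closure_subset j)) r
  choose C hC0 hC using h
  have hρs : ∀ y ∈ e.target, ContDiffAt ℝ r (fun y => (chartDensity e vol.form y)⁻¹) y := fun y hy =>
    ((contDiffAt_chartDensity vol he hy).inv (chartDensity_ne_zero vol he hy)).of_le
      (by exact_mod_cast le_top)
  obtain ⟨a, ha1, ha⟩ := exists_iteratedFDeriv_bound e.open_target hT hTe r
    (fun y hy => (hρs y hy).contDiffWithinAt)
  have hS0 : 0 ≤ ∑ j, C j := Finset.sum_nonneg fun j _ => hC0 j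
  refine ⟨(∑ j, C j) * (2 ^ r * a), by positivity, fun F hF hF0 B hB0 hB j x hx k hk => ?_⟩
  by_cases hxT : x ∈ e.symm '' T
  · have hxe := hTs hxT
    have hexT : e x ∈ T := by
      obtain ⟨y, hy, rfl⟩ := hxT
      rwa [e.right_inv (hTe hy)]
    have h1 : ∀ k ≤ r, ‖iteratedFDeriv ℝ k (chartField e (extField vol e F)) (e x)‖ ≤
        2 ^ r * a * B := by
      intro k hk
      have heq : chartField e (extField vol e F) =ᶠ[𝓝 (e x)]
          fun y => (chartDensity e vol.form y)⁻¹ • F y := by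
        filter_upwards [e.open_target.mem_nhds (e.map_source hxe)] with y hy
          using chartField_extField vol he hy
      rw [(heq.iteratedFDeriv ℝ k).eq_of_nhds]
      exact norm_iteratedFDeriv_smul_le_at (hρs _ (e.map_source hxe)) hF.contDiffAt
        (fun i hi => ha _ hexT i hi) (fun i hi => hB _ hexT i hi) hk
    refine (hC j _ x ⟨hxT, subset_closure hx.1⟩ (isFieldAt_extField vol he
      (by exact_mod_cast hF) hF0 hT hTe x) _ h1 k hk).trans ?_
    rw [mul_assoc (∑ j, C j)]
    exact mul_le_mul_of_nonneg_right
      (Finset.single_le_sum (f := C) (fun i _ => hC0 i) (Finset.mem_univ j)) (by positivity)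
  · have heq := chartField_congr (𝒜.mem_source hx.1)
      (extField_eventually_eq_zero vol hF0 hT hTe hxT)
    rw [(heq.iteratedFDeriv ℝ k).eq_of_nhds, chartField_zero]
    simp only [iteratedFDeriv_fun_zero, Pi.zero_apply, norm_zero]
    positivity

/-- The `C^r` size of the product of a vector field with a smooth function supported in the
open set `A`. -/
lemma exists_smul_bound (𝒜 : RegularAtlas n M) (r : ℕ) {f : M → ℝ}
    (hf : ContMDiff (𝓡 n) 𝓘(ℝ, ℝ) ∞ f) {A : Set M} (hfA : tsupport f ⊆ A) :
    ∃ C : ℝ, 0 ≤ C ∧ ∀ X : ∀ x : M, TangentSpace (𝓡 n) x, (∀ x ∈ A, IsFieldAt r X x) →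
      ∀ B, 0 ≤ B → AtlasBound 𝒜 r A X B → AtlasBound 𝒜 r univ (fun x => f x • X x) (C * B) := by
  have h : ∀ j, ∃ C : ℝ, 1 ≤ C ∧ ∀ y ∈ 𝒜.chart j '' closure (𝒜.V j), ∀ i ≤ r,
      ‖iteratedFDeriv ℝ i (fun y => f ((𝒜.chart j).symm y)) y‖ ≤ C := fun j =>
    exists_iteratedFDeriv_bound (𝒜.chart j).open_target
      (isClosed_closure.isCompact.image_of_continuousOn
        ((𝒜.chart j).continuousOn.mono (𝒜.closure_subset j)))
      (by
        rintro _ ⟨x, hx, rfl⟩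
        exact (𝒜.chart j).map_source (𝒜.closure_subset j hx)) r
      (fun y hy => ((contDiffAt_comp_symm hf (𝒜.chart_mem j) hy).of_le
        (by exact_mod_cast le_top)).contDiffWithinAt)
  choose C hC1 hC using h
  have hC0 : ∀ j, 0 ≤ C j := fun j => zero_le_one.trans (hC1 j)
  have hS0 : 0 ≤ ∑ j, C j := Finset.sum_nonneg fun j _ => hC0 j
  refine ⟨2 ^ r * ∑ j, C j, by positivity, fun X hX B hB0 hB j x hx k hk => ?_⟩
  by_cases hxf : x ∈ tsupport f
  · have hxe := 𝒜.mem_source hx.1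
    rw [chartField_smul]
    refine (norm_iteratedFDeriv_smul_le_at ((contDiffAt_comp_symm hf (𝒜.chart_mem j)
      ((𝒜.chart j).map_source hxe)).of_le (by exact_mod_cast le_top))
      (contDiffAt_of_isFieldAt hX ⟨hx.1, hfA hxf⟩ le_rfl)
      (fun i hi => hC j _ (mem_image_of_mem _ (subset_closure hx.1)) i hi)
      (fun i hi => hB j x ⟨hx.1, hfA hxf⟩ i hi) hk).trans ?_
    have := Finset.single_le_sum (f := C) (fun i _ => hC0 i) (Finset.mem_univ j)
    gcongr
  · have h0 : ∀ᶠ z in 𝓝 x, f z • X z = 0 := by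
      filter_upwards [(isClosed_tsupport f).isOpen_compl.mem_nhds hxf] with z hz
      rw [image_eq_zero_of_notMem_tsupport hz, zero_smul]
    have heq := chartField_congr (𝒜.mem_source hx.1) h0
    rw [(heq.iteratedFDeriv ℝ k).eq_of_nhds, chartField_zero]
    simp only [iteratedFDeriv_fun_zero, Pi.zero_apply, norm_zero]
    positivity

end Norms

/-! ### Integrals of derivatives of compactly supported Euclidean fields. -/

section EuclideanIntegral

variable {n : ℕ}

/-- Integration by parts against the constant function `1`. -/
lemma integral_fderiv_apply_eq_zero {F : Euc n → Euc n} (hF : ContDiff ℝ 1 F)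
    (hc : HasCompactSupport F) (v : Euc n) : ∫ y, fderiv ℝ F y v = 0 := by
  have hcont : Continuous fun y => fderiv ℝ F y v :=
    (hF.continuous_fderiv one_ne_zero).clm_apply continuous_const
  have h := integral_smul_fderiv_eq_neg_fderiv_smul_of_integrable (μ := volume)
    (f := fun _ : Euc n => (1 : ℝ)) (g := F) (v := v) (by simp)
    (by simpa using hcont.integrable_of_hasCompactSupport (hc.fderiv_apply (𝕜 := ℝ) v))
    (by simpa using hF.continuous.integrable_of_hasCompactSupport hc)
    (fun x _ => differentiableAt_const _) (fun x _ => (hF.differentiable one_ne_zero) x)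
  simpa using h

/-- The integral of the divergence of a compactly supported vector field vanishes. -/
lemma integral_ediv_eq_zero {F : Euc n → Euc n} (hF : ContDiff ℝ 1 F)
    (hc : HasCompactSupport F) : ∫ y, ediv F y = 0 := by
  have hcont : ∀ v, Continuous fun y => fderiv ℝ F y v := fun v =>
    (hF.continuous_fderiv one_ne_zero).clm_apply continuous_const
  have hInt : ∀ v, Integrable fun y => fderiv ℝ F y v := fun v =>
    (hcont v).integrable_of_hasCompactSupport (hc.fderiv_apply (𝕜 := ℝ) v)
  simp only [ediv, traceL_apply]
  have hInt' : ∀ i, Integrable fun y => fderiv ℝ F y (EuclideanSpace.single i 1) i := fun i =>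
    (EuclideanSpace.proj i : Euc n →L[ℝ] ℝ).integrable_comp (hInt (EuclideanSpace.single i 1))
  rw [integral_finsetSum _ fun i _ => hInt' i]
  refine Finset.sum_eq_zero fun i _ => ?_
  have := (EuclideanSpace.proj i : Euc n →L[ℝ] ℝ).integral_comp_comm
    (hInt (EuclideanSpace.single i 1))
  rw [integral_fderiv_apply_eq_zero hF hc] at this
  simpa using this

end EuclideanIntegral

/-! ### Integration on `M` and vanishing of the integral of a divergence. -/

section Stokes

variable {n : ℕ} {M : Type*} [TopologicalSpace M] [ChartedSpace (EuclideanSpace ℝ (Fin n)) M]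
  [IsManifold (𝓡 n) ∞ M] {e e' : OpenPartialHomeomorph M (EuclideanSpace ℝ (Fin n))}
  {X : ∀ x : M, TangentSpace (𝓡 n) x} (vol : VolumeForm n M)

/-- The integral in the chart `e` of a function with respect to the volume. -/
def chartIntegral (e : OpenPartialHomeomorph M (EuclideanSpace ℝ (Fin n))) (u : M → ℝ) : ℝ :=
  ∫ y in e.target, |chartDensity e vol.form y| * u (e.symm y)

/-- Taking `|ρ|` as density makes the integrand transform with `|det|`, exactly as in the change of
variables formula, so charts need not be oriented. -/
lemma chartIntegral_eq_chartIntegral (he : e ∈ IsManifold.maximalAtlas (𝓡 n) ∞ M)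
    (he' : e' ∈ IsManifold.maximalAtlas (𝓡 n) ∞ M) {u : M → ℝ}
    (hu : ∀ x ∉ e.source ∩ e'.source, u x = 0) :
    chartIntegral vol e u = chartIntegral vol e' u := by
  set S := e.target ∩ e.symm ⁻¹' e'.source with hS
  set S' := e'.target ∩ e'.symm ⁻¹' e.source with hS'
  have hSo : IsOpen S := e.isOpen_inter_preimage_symm e'.open_source
  have h1 : chartIntegral vol e u = ∫ y in S, |chartDensity e vol.form y| * u (e.symm y) := by
    refine setIntegral_eq_of_subset_of_forall_sdiff_eq_zero e.open_target.measurableSet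
      inter_subset_left fun y hy => ?_
    rw [hu _ fun h => hy.2 ⟨hy.1, h.2⟩, mul_zero]
  have h2 : chartIntegral vol e' u = ∫ y in S', |chartDensity e' vol.form y| * u (e'.symm y) := by
    refine setIntegral_eq_of_subset_of_forall_sdiff_eq_zero e'.open_target.measurableSet
      inter_subset_left fun y hy => ?_
    rw [hu _ fun h => hy.2 ⟨hy.1, h.1⟩, mul_zero]
  set ψ : Euc n → Euc n := fun y => e' (e.symm y) with hψ
  have himg : ψ '' S = S' := by
    ext z
    constructor
    · rintro ⟨y, hy, rfl⟩
      refine ⟨e'.map_source hy.2, ?_⟩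
      simp only [mem_preimage, hψ, e'.left_inv hy.2]
      exact e.map_target hy.1
    · intro hz
      refine ⟨e (e'.symm z), ⟨e.map_source hz.2, ?_⟩, ?_⟩
      · simp only [mem_preimage, e.left_inv hz.2]
        exact e'.map_target hz.1
      · simp only [hψ, e.left_inv hz.2, e'.right_inv hz.1]
  have hinj : InjOn ψ S := by
    intro y hy z hz hyz
    have := e'.injOn hy.2 hz.2 hyz
    rw [← e.right_inv hy.1, this, e.right_inv hz.1]
  rw [h1, h2, ← himg, integral_image_eq_integral_abs_det_fderiv_smul volume hSo.measurableSet
    (fun y hy => ((contDiffAt_transition he he' hy.1 hy.2).differentiableAt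
      (by simp)).hasFDerivAt.hasFDerivWithinAt) hinj]
  refine setIntegral_congr_fun hSo.measurableSet fun y hy => ?_
  simp only [smul_eq_mul, e'.left_inv hy.2]
  rw [chartDensity_transition he he' vol.form hy.1 hy.2, abs_mul]
  ring

variable [CompactSpace M]

lemma continuousOn_abs_density_mul (he : e ∈ IsManifold.maximalAtlas (𝓡 n) ∞ M) {u : M → ℝ}
    (hu : Continuous u) :
    ContinuousOn (fun y => |chartDensity e vol.form y| * u (e.symm y)) e.target :=
  ((vol.smooth e he).continuousOn.abs).mul (hu.comp_continuousOn e.continuousOn_symm)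

lemma integrableOn_chartIntegral (he : e ∈ IsManifold.maximalAtlas (𝓡 n) ∞ M) {u : M → ℝ}
    (hu : Continuous u) (hue : tsupport u ⊆ e.source) :
    IntegrableOn (fun y => |chartDensity e vol.form y| * u (e.symm y)) e.target := by
  have hT : IsCompact (e '' tsupport u) :=
    (isClosed_tsupport u).isCompact.image_of_continuousOn (e.continuousOn.mono hue)
  have hTe : e '' tsupport u ⊆ e.target := by
    rintro _ ⟨x, hx, rfl⟩
    exact e.map_source (hue hx)
  refine IntegrableOn.of_forall_sdiff_eq_zero
    (((continuousOn_abs_density_mul vol he hu).mono hTe).integrableOn_compact hT)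
    e.open_target.measurableSet fun y hy => ?_
  have : u (e.symm y) = 0 := image_eq_zero_of_notMem_tsupport fun h =>
    hy.2 ⟨e.symm y, h, e.right_inv hy.1⟩
  rw [this, mul_zero]

lemma continuous_divergence (hX : ∀ x, IsFieldAt 1 X x) : Continuous (divergence vol X) := by
  refine continuous_iff_continuousAt.2 fun x => ?_
  set e := chartAt (EuclideanSpace ℝ (Fin n)) x
  have he : e ∈ IsManifold.maximalAtlas (𝓡 n) ∞ M := chart_mem x
  have hx : x ∈ e.source := mem_chart_source _ x
  have h1 : ContDiffOn ℝ 1 (fun y => chartDensity e vol.form y • chartField e X y) e.target := by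
    intro y hy
    have h2 := (isFieldAt_iff he (e.map_target hy)).1 (hX (e.symm y))
    rw [e.right_inv hy] at h2
    exact (((contDiffAt_chartDensity vol he hy).of_le (by exact_mod_cast le_top)).smul
      h2).contDiffWithinAt
  have h3 : ContinuousAt (fderiv ℝ (fun y => chartDensity e vol.form y • chartField e X y)) (e x) :=
    (h1.continuousOn_fderiv_of_isOpen e.open_target le_rfl).continuousAt
      (e.open_target.mem_nhds (e.map_source hx))
  have h4 : ContinuousAt (fun z => (chartDensity e vol.form (e z))⁻¹ *
      ediv (fun y => chartDensity e vol.form y • chartField e X y) (e z)) x := by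
    refine ContinuousAt.mul (ContinuousAt.inv₀ ?_ (chartDensity_ne_zero vol he (e.map_source hx))) ?_
    · exact (contDiffAt_chartDensity vol he (e.map_source hx)).continuousAt.comp
        (e.continuousAt hx)
    · exact (traceL n).continuous.continuousAt.comp (h3.comp (e.continuousAt hx))
  refine h4.congr ?_
  filter_upwards [e.open_source.mem_nhds hx] with z hz
  exact (divergence_eq vol (hX z) he hz).symm

variable [T2Space M]

/-- A finite smooth partition of unity on a compact set, subordinate to a choice of open
neighbourhoods of its points. -/
lemma exists_finite_partition {T : Set M} (hT : IsCompact T) (O : M → Set M)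
    (hO : ∀ x ∈ T, IsOpen (O x)) (hxO : ∀ x ∈ T, x ∈ O x) :
    ∃ (t : Finset M) (χ : M → M → ℝ), (∀ i ∈ t, i ∈ T) ∧
      (∀ i, ContMDiff (𝓡 n) 𝓘(ℝ, ℝ) ∞ (χ i)) ∧ (∀ i ∈ t, tsupport (χ i) ⊆ O i) ∧
      (∀ x ∈ T, ∑ i ∈ t, χ i x = 1) := by
  classical
  obtain ⟨t, htT, ht⟩ := hT.elim_nhds_subcover O fun x hx => (hO x hx).mem_nhds (hxO x hx)
  obtain ⟨f, hf⟩ := SmoothPartitionOfUnity.exists_isSubordinate (𝓡 n) hT.isClosed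
    (fun i : t => O i) (fun i => hO i (htT i i.2)) (by
      intro x hx
      obtain ⟨i, hi, hxi⟩ := mem_iUnion₂.1 (ht hx)
      exact mem_iUnion.2 ⟨⟨i, hi⟩, hxi⟩)
  refine ⟨t, fun i => if h : i ∈ t then f ⟨i, h⟩ else fun _ => 0, htT, fun i => ?_, fun i hi => ?_,
    fun x hx => ?_⟩
  · by_cases h : i ∈ t
    · simp only [h, dif_pos]
      exact (f ⟨i, h⟩).contMDiff
    · simp only [h, dif_neg, not_false_eq_true]
      exact contMDiff_const
  · simp only [hi, dif_pos]
    exact hf ⟨i, hi⟩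
  · have h1 := f.sum_eq_one hx
    rw [finsum_eq_sum_of_fintype] at h1
    rw [← Finset.sum_coe_sort, ← h1]
    exact Finset.sum_congr rfl fun i _ => by simp

/-- The integral on `M` of continuous functions with respect to the volume. -/
lemma exists_integral : ∃ I : (M → ℝ) → ℝ,
    (∀ e ∈ IsManifold.maximalAtlas (𝓡 n) ∞ M, ∀ u : M → ℝ, Continuous u → tsupport u ⊆ e.source →
      I u = chartIntegral vol e u) ∧
    (∀ (c : ℝ) (u : M → ℝ), I (fun x => c * u x) = c * I u) ∧
    (∀ (t : Finset M) (u : M → M → ℝ), (∀ i ∈ t, Continuous (u i)) →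
      I (fun x => ∑ i ∈ t, u i x) = ∑ i ∈ t, I (u i)) := by
  obtain ⟨t, χ, -, hχs, hχ, hχ1⟩ := exists_finite_partition (n := n) (M := M) isCompact_univ
    (fun x => (chartAt (EuclideanSpace ℝ (Fin n)) x).source)
    (fun x _ => (chartAt _ x).open_source) (fun x _ => mem_chart_source _ x)
  have htsu : ∀ (i : M) (u : M → ℝ), tsupport (fun x => χ i x * u x) ⊆ tsupport (χ i) :=
    fun i u => tsupport_mul_subset_left
  -- The integral is assembled from a finite partition of unity. For `u` supported in the domain of
  -- `e`, each part may be integrated in `e` instead, and the parts add up to `u` again.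
  refine ⟨fun u => ∑ i ∈ t, chartIntegral vol (chartAt (EuclideanSpace ℝ (Fin n)) i)
    (fun x => χ i x * u x), fun e he u hu hue => ?_, fun c u => ?_, fun t' u hu => ?_⟩
  · have h1 : chartIntegral vol e u = ∑ i ∈ t, chartIntegral vol e (fun x => χ i x * u x) := by
      unfold chartIntegral
      rw [← integral_finsetSum _ fun i hi => integrableOn_chartIntegral vol he
        (u := fun x => χ i x * u x) ((hχs i).continuous.mul hu)
        ((tsupport_mul_subset_right (f := χ i)).trans hue)]
      refine integral_congr_ae (Filter.Eventually.of_forall fun y => ?_)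
      simp only
      rw [← Finset.mul_sum, ← Finset.sum_mul, hχ1 _ (mem_univ _), one_mul]
    rw [h1]
    refine Finset.sum_congr rfl fun i hi => ?_
    refine chartIntegral_eq_chartIntegral vol (chart_mem i) he fun x hx => ?_
    by_contra hne
    exact hx ⟨hχ i hi (subset_tsupport _ (left_ne_zero_of_mul hne)),
      hue (subset_tsupport _ (right_ne_zero_of_mul hne))⟩
  · rw [Finset.mul_sum]
    refine Finset.sum_congr rfl fun i _ => ?_
    unfold chartIntegral
    rw [← integral_const_mul]
    congr 1
    ext y
    ring
  · rw [Finset.sum_comm]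
    refine Finset.sum_congr rfl fun i hi => ?_
    unfold chartIntegral
    rw [← integral_finsetSum _ fun j hj => integrableOn_chartIntegral vol (chart_mem i)
      (u := fun x => χ i x * u j x) ((hχs i).continuous.mul (hu j hj)) ((htsu i _).trans (hχ i hi))]
    congr 1
    ext y
    simp only [Finset.mul_sum]

lemma tsupport_divergence_smul_subset {f : M → ℝ} : tsupport (divergence vol fun x => f x • X x) ⊆
    tsupport f := by
  refine closure_minimal (fun x hx => ?_) (isClosed_tsupport f)
  by_contra hxf
  refine hx ?_
  have h0 : ∀ᶠ z in 𝓝 x, f z • X z = 0 := by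
    filter_upwards [(isClosed_tsupport f).isOpen_compl.mem_nhds hxf] with z hz
    rw [image_eq_zero_of_notMem_tsupport hz, zero_smul]
  rw [divergence_congr vol h0, divergence_zero]

-- In the chart, `|ρ|` times the field is a compactly supported Euclidean `C^1` field, whose
-- divergence has zero integral. Replacing `ρ` by `|ρ|` only introduces a locally constant sign.
open Classical in
lemma chartIntegral_divergence_eq_zero (he : e ∈ IsManifold.maximalAtlas (𝓡 n) ∞ M)
    (hX : ∀ x, IsFieldAt 1 X x) {f : M → ℝ} (hf : ContMDiff (𝓡 n) 𝓘(ℝ, ℝ) ∞ f)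
    (hfe : tsupport f ⊆ e.source) :
    chartIntegral vol e (divergence vol fun x => f x • X x) = 0 := by
  set W : ∀ x : M, TangentSpace (𝓡 n) x := fun x => f x • X x with hW
  have hWf : ∀ x, IsFieldAt 1 W x := fun x => (hX x).smul hf
  set ρ := chartDensity e vol.form with hρ
  set F : Euc n → Euc n := fun y => if y ∈ e.target then |ρ y| • chartField e W y else 0 with hF
  have hT : IsCompact (e '' tsupport f) :=
    (isClosed_tsupport f).isCompact.image_of_continuousOn (e.continuousOn.mono hfe)
  have hF0 : ∀ y ∉ e '' tsupport f, F y = 0 := by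
    intro y hy
    simp only [hF]
    split_ifs with h
    · have h0 : f (e.symm y) = 0 := image_eq_zero_of_notMem_tsupport fun h' =>
        hy ⟨e.symm y, h', e.right_inv h⟩
      rw [hW, chartField_smul]
      simp [h0]
    · rfl
  have hsign : ∀ y ∈ e.target, ∃ c : ℝ, c * ρ y = |ρ y| ∧ F =ᶠ[𝓝 y] fun y => c • ρ y • chartField e W y := by
    intro y hy
    have hc : ContinuousAt ρ y := (contDiffAt_chartDensity vol he hy).continuousAt
    rcases lt_or_gt_of_ne (chartDensity_ne_zero vol he hy) with h | h
    · refine ⟨-1, by rw [abs_of_neg h]; ring, ?_⟩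
      filter_upwards [e.open_target.mem_nhds hy, hc.eventually_lt continuousAt_const h] with z hz hlt
      simp only [hF, hz, if_true, abs_of_neg hlt]
      module
    · refine ⟨1, by rw [abs_of_pos h]; ring, ?_⟩
      filter_upwards [e.open_target.mem_nhds hy, continuousAt_const.eventually_lt hc h] with z hz hlt
      simp only [hF, hz, if_true, abs_of_pos hlt]
      module
  have hWd : ∀ y ∈ e.target, ContDiffAt ℝ 1 (fun y => ρ y • chartField e W y) y := by
    intro y hy
    have h2 := (isFieldAt_iff he (e.map_target hy)).1 (hWf (e.symm y))
    rw [e.right_inv hy] at h2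
    exact ((contDiffAt_chartDensity vol he hy).of_le (by exact_mod_cast le_top)).smul h2
  have hFs : ContDiff ℝ 1 F := by
    refine contDiff_iff_contDiffAt.2 fun y => ?_
    by_cases hy : y ∈ e.target
    · obtain ⟨c, -, hc⟩ := hsign y hy
      exact ((hWd y hy).const_smul c).congr_of_eventuallyEq hc
    · have hyT : y ∉ e '' tsupport f := by
        rintro ⟨x, hx, rfl⟩
        exact hy (e.map_source (hfe hx))
      refine contDiffAt_const (c := (0 : Euc n)) |>.congr_of_eventuallyEq ?_
      filter_upwards [hT.isClosed.isOpen_compl.mem_nhds hyT] with z hz using hF0 z hz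
  have hFc : HasCompactSupport F := HasCompactSupport.intro hT hF0
  rw [← integral_ediv_eq_zero hFs hFc, chartIntegral]
  have h1 : ∀ y ∈ e.target, |ρ y| * divergence vol W (e.symm y) = ediv F y := by
    intro y hy
    obtain ⟨c, hc, hev⟩ := hsign y hy
    have hne : ρ y ≠ 0 := chartDensity_ne_zero vol he hy
    rw [divergence_eq vol (hWf _) he (e.map_target hy), e.right_inv hy, ediv, ediv, hev.fderiv_eq,
      fderiv_fun_const_smul ((hWd y hy).differentiableAt one_ne_zero), map_smul, ← hc, smul_eq_mul,
      ← hρ]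
    field_simp
  rw [setIntegral_congr_fun e.open_target.measurableSet h1]
  refine setIntegral_eq_integral_of_forall_compl_eq_zero fun y hy => ?_
  have hyT : y ∉ e '' tsupport f := by
    rintro ⟨x, hx, rfl⟩
    exact hy (e.map_source (hfe hx))
  have : F =ᶠ[𝓝 y] fun _ => 0 := by
    filter_upwards [hT.isClosed.isOpen_compl.mem_nhds hyT] with z hz using hF0 z hz
  rw [ediv, this.fderiv_eq]
  simp

/-- If the divergence of a `C^1` vector field on a closed manifold is `c h`, where the integral of
`h` does not vanish, then `c = 0`. -/
lemma eq_zero_of_divergence_eq (hX : ∀ x, IsFieldAt 1 X x) {h : M → ℝ} (hh : Continuous h)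
    (he : e ∈ IsManifold.maximalAtlas (𝓡 n) ∞ M) (hhe : tsupport h ⊆ e.source)
    (hInt : chartIntegral vol e h ≠ 0) {c : ℝ} (hdiv : ∀ x, divergence vol X x = c * h x) :
    c = 0 := by
  obtain ⟨I, hI1, hI2, hI3⟩ := exists_integral vol
  obtain ⟨t, χ, -, hχs, hχ, hχ1⟩ := exists_finite_partition (n := n) (M := M) isCompact_univ
    (fun x => (chartAt (EuclideanSpace ℝ (Fin n)) x).source)
    (fun x _ => (chartAt _ x).open_source) (fun x _ => mem_chart_source _ x)
  have h1 : ∀ i ∈ t, I (divergence vol fun x => χ i x • X x) = 0 := fun i hi => by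
    rw [hI1 _ (chart_mem i) _ (continuous_divergence vol fun x => (hX x).smul (hχs i))
      ((tsupport_divergence_smul_subset vol).trans (hχ i hi))]
    exact chartIntegral_divergence_eq_zero vol (chart_mem i) hX (hχs i) (hχ i hi)
  -- `c h` is the sum of the divergences of the fields `χ i • X`, each of which has integral zero;
  -- hence `c` times the integral of `h` vanishes.
  have h2 : (fun x => c * h x) = fun x => ∑ i ∈ t, divergence vol (fun x => χ i x • X x) x := by
    ext1 x
    rw [← hdiv, ← divergence_sum vol t fun i _ => (hX x).smul (hχs i)]
    refine divergence_congr vol (Filter.Eventually.of_forall fun z => ?_)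
    rw [← Finset.sum_smul, hχ1 z (mem_univ z), one_smul]
  have h3 : c * I h = 0 := by
    rw [← hI2, h2, hI3 t _ fun i _ => continuous_divergence vol fun x => (hX x).smul (hχs i)]
    exact Finset.sum_eq_zero h1
  rw [hI1 e he h hh hhe] at h3
  exact (mul_eq_zero.1 h3).resolve_right hInt

end Stokes

/-! ### Bump functions modulo divergences of compactly supported fields. -/

section Primitives

variable {n : ℕ} {M : Type*} [TopologicalSpace M] [ChartedSpace (EuclideanSpace ℝ (Fin n)) M]
  [IsManifold (𝓡 n) ∞ M] {e e' : OpenPartialHomeomorph M (EuclideanSpace ℝ (Fin n))}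
  {X : ∀ x : M, TangentSpace (𝓡 n) x} (vol : VolumeForm n M)

/-- Every point of an open set is the centre of a closed chart ball contained in this set. -/
lemma exists_chart_ball {G : Set M} (hG : IsOpen G) {p : M} (hp : p ∈ G)
    (hpe : p ∈ e.source) :
    ∃ R : ℝ, 0 < R ∧ closedBall (e p) R ⊆ e.target ∧ e.symm '' closedBall (e p) R ⊆ G := by
  have h1 : e.target ∩ e.symm ⁻¹' G ∈ 𝓝 (e p) :=
    (e.isOpen_inter_preimage_symm hG).mem_nhds
      ⟨e.map_source hpe, by simpa only [mem_preimage, e.left_inv hpe] using hp⟩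
  obtain ⟨R, hR, hRs⟩ := nhds_basis_closedBall.mem_iff.1 h1
  refine ⟨R, hR, fun y hy => (hRs hy).1, ?_⟩
  rintro _ ⟨y, hy, rfl⟩
  exact (hRs hy).2

lemma exists_bump (c : Euc n) {R : ℝ} (hR : 0 < R) :
    ∃ h : Euc n → ℝ, ContDiff ℝ ∞ h ∧ (∀ y ∉ closedBall c R, h y = 0) ∧ ∫ y, h y = 1 := by
  let b : ContDiffBump c := ⟨R / 2, R, by positivity, by linarith⟩
  refine ⟨b.normed volume, b.contDiff_normed, fun y hy => ?_, b.integral_normed⟩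
  refine image_eq_zero_of_notMem_tsupport fun h => hy ?_
  rwa [b.tsupport_normed_eq] at h

lemma extFun_apply_of_mem (h : Euc n → ℝ) {x : M} (hx : x ∈ e.source) :
    extFun vol e h x = (chartDensity e vol.form (e x))⁻¹ * h (e x) :=
  if_pos hx

lemma extFun_add_mul (g h : Euc n → ℝ) (a : ℝ) (x : M) :
    extFun vol e (fun y => g y - a * h y) x = extFun vol e g x - a * extFun vol e h x := by
  by_cases hx : x ∈ e.source
  · simp only [extFun_apply_of_mem vol _ hx]
    ring
  · simp [extFun, hx]

section

variable [T2Space M] {T : Set (Euc n)} {h : Euc n → ℝ}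

lemma tsupport_extFun_subset (hT : IsCompact T) (hTe : T ⊆ e.target) (h0 : ∀ y ∉ T, h y = 0) :
    tsupport (extFun vol e h) ⊆ e.symm '' T :=
  closure_minimal (fun x hx => by
    by_contra hxT
    exact hx (extFun_eq_zero vol h0 hxT)) (isCompact_symm_image hT hTe).isClosed

lemma contMDiff_extFun (he : e ∈ IsManifold.maximalAtlas (𝓡 n) ∞ M) (hh : ContDiff ℝ ∞ h)
    (hT : IsCompact T) (hTe : T ⊆ e.target) (h0 : ∀ y ∉ T, h y = 0) :
    ContMDiff (𝓡 n) 𝓘(ℝ, ℝ) ∞ (extFun vol e h) := by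
  intro x
  by_cases hx : x ∈ e.source
  · have h1 : ContDiffAt ℝ ∞ (fun y => (chartDensity e vol.form y)⁻¹ * h y) (e x) :=
      ((contDiffAt_chartDensity vol he (e.map_source hx)).inv
        (chartDensity_ne_zero vol he (e.map_source hx))).mul hh.contDiffAt
    have h2 := (contMDiffAt_iff_contDiffAt.2 h1).comp x (contMDiffAt_of_mem_maximalAtlas he hx)
    refine h2.congr_of_eventuallyEq ?_
    filter_upwards [e.open_source.mem_nhds hx] with z hz
    exact extFun_apply_of_mem vol h hz
  · have h1 : (extFun vol e h) =ᶠ[𝓝 x] fun _ => 0 := by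
      filter_upwards [(isCompact_symm_image hT hTe).isClosed.isOpen_compl.mem_nhds
        fun hm => hx (symm_image_subset_source hTe hm)] with z hz
      exact extFun_eq_zero vol h0 hz
    exact contMDiffAt_const.congr_of_eventuallyEq h1

open Classical in
/-- The expression `ρ u` of a function `u` on `M` in the chart `e`, extended by zero. -/
def pullFun (e : OpenPartialHomeomorph M (EuclideanSpace ℝ (Fin n))) (u : M → ℝ) (y : Euc n) : ℝ :=
  if y ∈ e.target then chartDensity e vol.form y * u (e.symm y) else 0

lemma pullFun_eq_zero {u : M → ℝ} (hu : ∀ x ∉ e.symm '' T, u x = 0) (hTe : T ⊆ e.target) {y : Euc n}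
    (hy : y ∉ T) : pullFun vol e u y = 0 := by
  unfold pullFun
  split_ifs with h
  · have h0 : u (e.symm y) = 0 := hu _ fun ⟨z, hz, hzy⟩ =>
      hy (e.symm.injOn (hTe hz) h hzy ▸ hz)
    rw [h0, mul_zero]
  · rfl

lemma pullFun_eventuallyEq {u : M → ℝ} {y : Euc n} (hy : y ∈ e.target) :
    pullFun vol e u =ᶠ[𝓝 y] fun y => chartDensity e vol.form y * u (e.symm y) := by
  filter_upwards [e.open_target.mem_nhds hy] with z hz
  exact if_pos hz

lemma contDiff_pullFun {s : ℕ∞} (he : e ∈ IsManifold.maximalAtlas (𝓡 n) ∞ M) {u : M → ℝ}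
    (hT : IsClosed T) (hTe : T ⊆ e.target) (hu0 : ∀ x ∉ e.symm '' T, u x = 0)
    (hu : ∀ y ∈ T, ContDiffAt ℝ s (fun y => u (e.symm y)) y) : ContDiff ℝ s (pullFun vol e u) := by
  refine contDiff_iff_contDiffAt.2 fun y => ?_
  by_cases hy : y ∈ T
  · exact (((contDiffAt_chartDensity vol he (hTe hy)).of_le (by exact_mod_cast le_top)).mul
      (hu y hy)).congr_of_eventuallyEq (pullFun_eventuallyEq vol (hTe hy))
  · refine (contDiffAt_const (c := (0 : ℝ))).congr_of_eventuallyEq ?_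
    filter_upwards [hT.isOpen_compl.mem_nhds hy] with z hz
    exact pullFun_eq_zero vol hu0 hTe hz

lemma extFun_pullFun (he : e ∈ IsManifold.maximalAtlas (𝓡 n) ∞ M) {u : M → ℝ} (hTe : T ⊆ e.target)
    (hu0 : ∀ x ∉ e.symm '' T, u x = 0) (x : M) : extFun vol e (pullFun vol e u) x = u x := by
  by_cases hx : x ∈ e.source
  · have hy := e.map_source hx
    rw [extFun_apply_of_mem vol _ hx, pullFun, if_pos hy, e.left_inv hx,
      inv_mul_cancel_left₀ (chartDensity_ne_zero vol he hy)]
  · rw [extFun, if_neg hx, hu0 x fun hm => hx (symm_image_subset_source hTe hm)]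

/-- The solution of the divergence equation in a chart ball. -/
lemma divergence_extField_ballSolution {s : ℕ∞} (hs : 1 ≤ s) (hn : 1 ≤ n)
    (he : e ∈ IsManifold.maximalAtlas (𝓡 n) ∞ M) {c : Euc n} {R : ℝ}
    (hR : closedBall c R ⊆ e.target) {g : Euc n → ℝ} (hh : ContDiff ℝ ∞ h)
    (hh0 : ∀ y ∉ closedBall c R, h y = 0) (hh1 : ∫ y, h y = 1) (hg : ContDiff ℝ s g)
    (hg0 : ∀ y ∉ closedBall c R, g y = 0) (x : M) :
    divergence vol (extField vol e (ballSolution c R h g)) x =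
      extFun vol e g x - (∫ y, g y) * extFun vol e h x := by
  have hg1 : ContDiff ℝ (1 : ℕ∞) g := hg.of_le (by exact_mod_cast hs)
  rw [divergence_extField vol he (by exact_mod_cast contDiff_ballSolution hg1 hh)
    (fun y hy => ballSolution_eq_zero hg0 hh0 hy) (isCompact_closedBall c R) hR,
    ← extFun_add_mul]
  congr 1
  ext1 y
  exact ediv_ballSolution hn (by exact_mod_cast hg1) hh hg0 hh0 hh1 y

/-- `ρ` has constant sign on the connected ball. Since `extFun` carries `ρ⁻¹` and the integral
carries `|ρ|`, the result is `∫ h = 1` up to this sign. -/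
lemma chartIntegral_extFun_ne_zero (he : e ∈ IsManifold.maximalAtlas (𝓡 n) ∞ M) {c : Euc n} {R : ℝ}
    (hR : closedBall c R ⊆ e.target) (hh0 : ∀ y ∉ closedBall c R, h y = 0)
    (hh1 : ∫ y, h y = 1) : chartIntegral vol e (extFun vol e h) ≠ 0 := by
  set ρ := chartDensity e vol.form with hρ
  have hρ0 : ∀ y ∈ closedBall c R, ρ y ≠ 0 := fun y hy => chartDensity_ne_zero vol he (hR hy)
  have hρc : ContinuousOn ρ (closedBall c R) := (vol.smooth e he).continuousOn.mono hR
  have hsgn : EqOn (fun y => |ρ y| * (ρ y)⁻¹) 1 (closedBall c R) ∨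
      EqOn (fun y => |ρ y| * (ρ y)⁻¹) (-1) (closedBall c R) := by
    refine (convex_closedBall c R).isPreconnected.eq_one_or_eq_neg_one_of_sq_eq
      (hρc.abs.mul (hρc.inv₀ hρ0)) fun y hy => ?_
    have := hρ0 y hy
    simp only [Pi.pow_apply, Pi.one_apply, mul_pow, sq_abs, inv_pow]
    field_simp
  obtain ⟨k, hk0, hk⟩ : ∃ k : ℝ, k ≠ 0 ∧ ∀ y ∈ closedBall c R, |ρ y| * (ρ y)⁻¹ = k := by
    rcases hsgn with hs | hs
    · exact ⟨1, one_ne_zero, fun y hy => hs hy⟩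
    · exact ⟨-1, by norm_num, fun y hy => hs hy⟩
  have h1 : ∀ y ∈ e.target, |ρ y| * extFun vol e h (e.symm y) = k * h y := by
    intro y hy
    rw [extFun_apply_of_mem vol _ (e.map_target hy), e.right_inv hy, ← mul_assoc]
    by_cases hyR : y ∈ closedBall c R
    · rw [hk y hyR]
    · rw [hh0 y hyR, mul_zero, mul_zero]
  rw [chartIntegral, setIntegral_congr_fun e.open_target.measurableSet h1, integral_const_mul,
    setIntegral_eq_integral_of_forall_compl_eq_zero fun y hy => hh0 y fun hm => hy (hR hm), hh1,
    mul_one]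
  exact hk0

/-- `g` is the divergence of a smooth vector field with compact support in `G`. -/
def IsDivergenceIn (G : Set M) (g : M → ℝ) : Prop :=
  ∃ v : ∀ x : M, TangentSpace (𝓡 n) x, (∀ x, IsFieldAt ⊤ v x) ∧
    (∃ S : Set M, IsCompact S ∧ S ⊆ G ∧ ∀ x ∉ S, v x = 0) ∧ ∀ x, divergence vol v x = g x

/-- The ball solution applied to the chart expression `ρ g`; the coefficient `a` is the integral of
`ρ g` in the chart. -/
lemma isDivergenceIn_sub_of_ball (hn : 1 ≤ n) {G : Set M}
    (he : e ∈ IsManifold.maximalAtlas (𝓡 n) ∞ M) {c : Euc n} {R : ℝ} (hR : closedBall c R ⊆ e.target)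
    (hRG : e.symm '' closedBall c R ⊆ G) (hh : ContDiff ℝ ∞ h)
    (hh0 : ∀ y ∉ closedBall c R, h y = 0) (hh1 : ∫ y, h y = 1) {g : M → ℝ}
    (hg : ContMDiff (𝓡 n) 𝓘(ℝ, ℝ) ∞ g) (hg0 : ∀ x ∉ e.symm '' closedBall c R, g x = 0) :
    ∃ a : ℝ, IsDivergenceIn vol G fun x => g x - a * extFun vol e h x := by
  have hp : ContDiff ℝ (⊤ : ℕ∞) (pullFun vol e g) :=
    contDiff_pullFun vol he isClosed_closedBall hR hg0 fun y hy =>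
      contDiffAt_comp_symm hg he (hR hy)
  have hp0 : ∀ y ∉ closedBall c R, pullFun vol e g y = 0 := fun y hy =>
    pullFun_eq_zero vol hg0 hR hy
  have hz : ∀ y ∉ closedBall c R, ballSolution c R h (pullFun vol e g) y = 0 := fun y hy =>
    ballSolution_eq_zero hp0 hh0 hy
  refine ⟨∫ y, pullFun vol e g y, extField vol e (ballSolution c R h (pullFun vol e g)),
    fun x => isFieldAt_extField vol he (contDiff_ballSolution hp hh) hz (isCompact_closedBall c R)
      hR x, ⟨e.symm '' closedBall c R, isCompact_symm_image (isCompact_closedBall c R) hR, hRG,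
      fun x hx => extField_eq_zero vol hz hx⟩, fun x => ?_⟩
  rw [divergence_extField_ballSolution vol le_top hn he hR hh hh0 hh1 hp hp0,
    extFun_pullFun vol he hR hg0]

lemma IsDivergenceIn.add_const_mul {G : Set M} {g g' : M → ℝ} (h : IsDivergenceIn vol G g)
    (h' : IsDivergenceIn vol G g') (a : ℝ) : IsDivergenceIn vol G fun x => g x + a * g' x := by
  obtain ⟨v, hv, ⟨S, hS, hSG, hvS⟩, hdv⟩ := h
  obtain ⟨v', hv', ⟨S', hS', hSG', hvS'⟩, hdv'⟩ := h'
  have hsm : ∀ x, IsFieldAt ⊤ (fun x => a • v' x) x := fun x =>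
    (hv' x).smul (f := fun _ => a) contMDiff_const
  refine ⟨fun x => v x + a • v' x, fun x => (hv x).add (hsm x),
    ⟨S ∪ S', hS.union hS', union_subset hSG hSG', fun x hx => ?_⟩, fun x => ?_⟩
  · beta_reduce
    rw [hvS x fun hm => hx (Or.inl hm), hvS' x fun hm => hx (Or.inr hm), smul_zero, add_zero]
  · rw [divergence_add vol ((hv x).of_le le_top) ((hsm x).of_le le_top),
      divergence_const_smul vol a ((hv' x).of_le le_top), hdv, hdv']

/-- In a connected open set, every smooth function with small support is a multiple of a fixed bump
function up to the divergence of a compactly supported vector field. -/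
lemma exists_local_primitive (hn : 1 ≤ n) {G : Set M} (hG : IsOpen G) (hGc : IsPreconnected G)
    (he : e ∈ IsManifold.maximalAtlas (𝓡 n) ∞ M) {c : Euc n} {R : ℝ} (hR0 : 0 < R)
    (hR : closedBall c R ⊆ e.target) (hRG : e.symm '' closedBall c R ⊆ G) (hh : ContDiff ℝ ∞ h)
    (hh0 : ∀ y ∉ closedBall c R, h y = 0) (hh1 : ∫ y, h y = 1) {p : M} (hp : p ∈ G) :
    ∃ O : Set M, IsOpen O ∧ p ∈ O ∧ ∀ g : M → ℝ, ContMDiff (𝓡 n) 𝓘(ℝ, ℝ) ∞ g → tsupport g ⊆ O →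
      ∃ a : ℝ, IsDivergenceIn vol G fun x => g x - a * extFun vol e h x := by
  -- `P p` says that functions supported near `p` are multiples of the reference bump modulo
  -- divergences. Both `P` and its negation define open subsets of `G`, and `P` holds at the centre
  -- of the reference ball, so connectedness concludes.
  set P : M → Prop := fun p => ∃ O : Set M, IsOpen O ∧ p ∈ O ∧
    ∀ g : M → ℝ, ContMDiff (𝓡 n) 𝓘(ℝ, ℝ) ∞ g → tsupport g ⊆ O →
      ∃ a : ℝ, IsDivergenceIn vol G fun x => g x - a * extFun vol e h x with hP
  have hPopen : IsOpen {p | p ∈ G ∧ P p} := by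
    refine isOpen_iff_mem_nhds.2 fun q hq => ?_
    obtain ⟨hqG, O, hO, hqO, hOg⟩ := hq
    filter_upwards [hG.mem_nhds hqG, hO.mem_nhds hqO] with z hz hzO using ⟨hz, O, hO, hzO, hOg⟩
  have hball : ∀ (e' : OpenPartialHomeomorph M (EuclideanSpace ℝ (Fin n))) (c : Euc n) (R : ℝ),
      IsOpen (e'.source ∩ e' ⁻¹' ball c R) := fun e' c R => e'.isOpen_inter_preimage isOpen_ball
  have hsub : ∀ (e' : OpenPartialHomeomorph M (EuclideanSpace ℝ (Fin n))) (c : Euc n) (R : ℝ),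
      e'.source ∩ e' ⁻¹' ball c R ⊆ e'.symm '' closedBall c R := fun e' c R x hx =>
    ⟨e' x, ball_subset_closedBall hx.2, e'.left_inv hx.1⟩
  -- Within a single chart ball about `p`, every function is a multiple of a bump near `q` modulo
  -- divergences. If `P q` holds, that bump, taken small enough, is itself a multiple of the
  -- reference bump.
  have hstep : ∀ p ∈ G, ∃ O : Set M, IsOpen O ∧ p ∈ O ∧ O ⊆ G ∧ ∀ q ∈ O, P q → P p := by
    intro p hp
    set e' := chartAt (EuclideanSpace ℝ (Fin n)) p
    have he' : e' ∈ IsManifold.maximalAtlas (𝓡 n) ∞ M := chart_mem p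
    obtain ⟨R', hR'0, hR', hRG'⟩ := exists_chart_ball (e := e') hG hp
      (mem_chart_source _ p)
    refine ⟨_, hball e' (e' p) R', ⟨mem_chart_source _ p, mem_ball_self hR'0⟩,
      (hsub e' (e' p) R').trans hRG', fun q hq hPq => ?_⟩
    obtain ⟨O, hO, hqO, hOg⟩ := hPq
    obtain ⟨R₁, hR₁0, hR₁, hRG₁⟩ := exists_chart_ball ((hball e' (e' p) R').inter hO) ⟨hq, hqO⟩
      hq.1
    obtain ⟨b, hbs, hb0, hb1⟩ := exists_bump (e' q) hR₁0
    have hb0' : ∀ y ∉ closedBall (e' p) R', b y = 0 := fun y hy => hb0 y fun hm => hy <| by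
      have := (hRG₁ ⟨y, hm, rfl⟩).1.2
      rw [mem_preimage, e'.right_inv (hR₁ hm)] at this
      exact ball_subset_closedBall this
    refine ⟨_, hball e' (e' p) R', ⟨mem_chart_source _ p, mem_ball_self hR'0⟩, fun g hg hgO => ?_⟩
    obtain ⟨a, ha⟩ := isDivergenceIn_sub_of_ball vol hn he' hR' hRG' hbs hb0' hb1 hg
      (fun x hx => image_eq_zero_of_notMem_tsupport fun hm => hx (hsub e' _ _ (hgO hm)))
    obtain ⟨a', ha'⟩ := hOg (extFun vol e' b)
      (contMDiff_extFun vol he' hbs (isCompact_closedBall _ _) hR₁ hb0)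
      ((tsupport_extFun_subset vol (isCompact_closedBall _ _) hR₁ hb0).trans
        (hRG₁.trans inter_subset_right))
    refine ⟨a * a', ?_⟩
    have := ha.add_const_mul vol ha' a
    convert this using 2
    ring
  have hbase : P (e.symm c) := by
    have hc : c ∈ e.target := hR (mem_closedBall_self hR0.le)
    refine ⟨_, hball e c R, ⟨e.map_target hc, ?_⟩, fun g hg hgO => ?_⟩
    · rw [mem_preimage, e.right_inv hc]
      exact mem_ball_self hR0
    · exact isDivergenceIn_sub_of_ball vol hn he hR hRG hh hh0 hh1 hg
        (fun x hx => image_eq_zero_of_notMem_tsupport fun hm => hx (hsub e _ _ (hgO hm)))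
  have hNopen : IsOpen {p | p ∈ G ∧ ¬ P p} := by
    refine isOpen_iff_mem_nhds.2 fun q hq => ?_
    obtain ⟨O, hO, hqO, hOG, hOP⟩ := hstep q hq.1
    filter_upwards [hO.mem_nhds hqO] with z hz using ⟨hOG hz, fun hPz => hq.2 (hOP z hz hPz)⟩
  by_contra hcon
  have hcG : e.symm c ∈ G := hRG ⟨c, mem_closedBall_self hR0.le, rfl⟩
  obtain ⟨z, -, hz1, hz2⟩ := hGc _ _ hPopen hNopen
    (fun x hx => by
      by_cases hPx : P x
      · exact Or.inl ⟨hx, hPx⟩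
      · exact Or.inr ⟨hx, hPx⟩)
    ⟨e.symm c, hcG, hcG, hbase⟩ ⟨p, hp, hp, hcon⟩
  exact hz2.2 hz1.2

end

end Primitives

/-! ### The divergence equation `div v = div (f W)` with compact support and `C^r` bounds. -/

section Solver

variable {n : ℕ} {M : Type*} [TopologicalSpace M] [ChartedSpace (EuclideanSpace ℝ (Fin n)) M]
  [IsManifold (𝓡 n) ∞ M] [T2Space M] [CompactSpace M]
  {e : OpenPartialHomeomorph M (EuclideanSpace ℝ (Fin n))}
  {X W : ∀ x : M, TangentSpace (𝓡 n) x} (vol : VolumeForm n M)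

lemma exists_atlasBound (𝒜 : RegularAtlas n M) (r : ℕ) (hX : ∀ x, IsFieldAt r X x) :
    ∃ B : ℝ, 0 ≤ B ∧ AtlasBound 𝒜 r univ X B := by
  have h : ∀ j, ∃ C : ℝ, 1 ≤ C ∧ ∀ y ∈ 𝒜.chart j '' closure (𝒜.V j), ∀ i ≤ r,
      ‖iteratedFDeriv ℝ i (chartField (𝒜.chart j) X) y‖ ≤ C := fun j =>
    exists_iteratedFDeriv_bound (𝒜.chart j).open_target
      (isClosed_closure.isCompact.image_of_continuousOn
        ((𝒜.chart j).continuousOn.mono (𝒜.closure_subset j)))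
      (by
        rintro _ ⟨x, hx, rfl⟩
        exact (𝒜.chart j).map_source (𝒜.closure_subset j hx)) r
      (fun y hy => by
        have := (isFieldAt_iff (𝒜.chart_mem j) ((𝒜.chart j).map_target hy)).1
          (hX ((𝒜.chart j).symm y))
        rw [(𝒜.chart j).right_inv hy] at this
        exact (this.of_le (by exact_mod_cast le_rfl)).contDiffWithinAt)
  choose C hC1 hC using h
  have hC0 : ∀ j, 0 ≤ C j := fun j => zero_le_one.trans (hC1 j)
  refine ⟨∑ j, C j, Finset.sum_nonneg fun j _ => hC0 j, fun j x hx k hk => ?_⟩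
  exact (hC j _ (mem_image_of_mem _ (subset_closure hx.1)) k hk).trans
    (Finset.single_le_sum (f := C) (fun i _ => hC0 i) (Finset.mem_univ j))

lemma isFieldAt_smul_of_tsupport_subset {s : ℕ∞} {f : M → ℝ} {U : Set M}
    (hf : ContMDiff (𝓡 n) 𝓘(ℝ, ℝ) ∞ f) (hfU : tsupport f ⊆ U) (hW : ∀ x ∈ U, IsFieldAt s W x)
    (x : M) : IsFieldAt s (fun x => f x • W x) x := by
  by_cases hx : x ∈ tsupport f
  · exact (hW x (hfU hx)).smul hf
  · refine isFieldAt_zero.congr ?_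
    filter_upwards [(isClosed_tsupport f).isOpen_compl.mem_nhds hx] with z hz
    rw [image_eq_zero_of_notMem_tsupport hz, zero_smul]

/-- In `U` the divergence is `f div W + df(W)`, and both terms vanish where `f` is locally constant;
outside `U` the field `f W` is zero nearby. -/
lemma divergence_smul_eq_zero {f : M → ℝ} {U : Set M} (hfU : tsupport f ⊆ U)
    (hW : ∀ x ∈ U, IsFieldAt 1 W x) (hdiv : ∀ x ∈ U, divergence vol W x = 0) {x : M}
    (hfx : ∀ᶠ z in 𝓝 x, f z = f x) : divergence vol (fun x => f x • W x) x = 0 := by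
  by_cases hx : x ∈ U
  · rw [divergence_congr vol (Y := fun z => f x • W z), divergence_const_smul vol _ (hW x hx),
      hdiv x hx, mul_zero]
    filter_upwards [hfx] with z hz
    rw [hz]
  · rw [divergence_congr vol (Y := fun z => 0), divergence_zero]
    filter_upwards [(isClosed_tsupport f).isOpen_compl.mem_nhds fun h => hx (hfU h)] with z hz
    rw [image_eq_zero_of_notMem_tsupport hz, zero_smul]

section Piece

variable {U : Set M} {c : Euc n} {R : ℝ} {f χ : M → ℝ}

/-- In a chart, the function `χ div (f W)` has the order of differentiability of `W`. -/
lemma contDiff_pullFun_divergence {s : ℕ∞} (hs : 1 ≤ s)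
    (he : e ∈ IsManifold.maximalAtlas (𝓡 n) ∞ M) (hU : IsOpen U) (hR : closedBall c R ⊆ e.target)
    (hRU : e.symm '' closedBall c R ⊆ U) (hf : ContMDiff (𝓡 n) 𝓘(ℝ, ℝ) ∞ f)
    (hχ : ContMDiff (𝓡 n) 𝓘(ℝ, ℝ) ∞ χ) (hχ0 : ∀ x ∉ e.symm '' closedBall c R, χ x = 0)
    (hW : ∀ x ∈ U, IsFieldAt s W x) (hdiv : ∀ x ∈ U, divergence vol W x = 0) :
    ContDiff ℝ s (pullFun vol e fun x => χ x * divergence vol (fun x => f x • W x) x) ∧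
    ∀ y ∈ closedBall c R, ContDiffAt ℝ s (chartField e W) y ∧
      pullFun vol e (fun x => χ x * divergence vol (fun x => f x • W x) x) =ᶠ[𝓝 y]
        fun y => ((chartDensity e vol.form y * χ (e.symm y)) •
          fderiv ℝ (fun y => f (e.symm y)) y) (chartField e W y) := by
  have hs' : (s : WithTop ℕ∞) ≤ ∞ := by exact_mod_cast le_top
  have hWe : ∀ y ∈ closedBall c R, ContDiffAt ℝ s (chartField e W) y := fun y hy => by
    have := (isFieldAt_iff he (e.map_target (hR hy))).1 (hW _ (hRU ⟨y, hy, rfl⟩))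
    rwa [e.right_inv (hR hy)] at this
  have hdf : ∀ y ∈ e.target, ContDiffAt ℝ ∞ (fderiv ℝ fun y => f (e.symm y)) y := fun y hy =>
    (contDiffAt_comp_symm hf he hy).fderiv_right (by simp)
  have hev : ∀ y ∈ closedBall c R, ∀ᶠ z in 𝓝 y,
      divergence vol (fun x => f x • W x) (e.symm z) =
        fderiv ℝ (fun y => f (e.symm y)) z (chartField e W z) := fun y hy => by
    filter_upwards [(e.isOpen_inter_preimage_symm hU).mem_nhds ⟨hR hy, hRU ⟨y, hy, rfl⟩⟩]
      with z hz
    rw [divergence_smul vol hf ((hW _ hz.2).of_le hs) he (e.map_target hz.1), hdiv _ hz.2,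
      mul_zero, zero_add, e.right_inv hz.1]
  refine ⟨contDiff_pullFun vol he isClosed_closedBall hR (fun x hx => by rw [hχ0 x hx, zero_mul])
    fun y hy => ?_, fun y hy => ⟨hWe y hy, ?_⟩⟩
  · refine (((contDiffAt_comp_symm hχ he (hR hy)).of_le hs').mul
      (((hdf y (hR hy)).of_le hs').clm_apply (hWe y hy))).congr_of_eventuallyEq ?_
    filter_upwards [hev y hy] with z hz
    rw [hz]
  · filter_upwards [hev y hy, pullFun_eventuallyEq vol
      (u := fun x => χ x * divergence vol (fun x => f x • W x) x) (hR hy)] with z hz hz'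
    rw [hz', hz, smul_apply, smul_eq_mul, mul_assoc]

/-- On the ball the function reads `ρ χ df(W)`: fixed smooth coefficients applied to `W` itself. Its
`C^r` size is therefore bounded by the `C^r` size of `W`. -/
lemma exists_pullFun_divergence_bound (𝒜 : RegularAtlas n M) {r : ℕ} (hr : 1 ≤ r)
    (he : e ∈ IsManifold.maximalAtlas (𝓡 n) ∞ M) (hU : IsOpen U) (hR : closedBall c R ⊆ e.target)
    (hRU : e.symm '' closedBall c R ⊆ U) (hf : ContMDiff (𝓡 n) 𝓘(ℝ, ℝ) ∞ f)
    (hχ : ContMDiff (𝓡 n) 𝓘(ℝ, ℝ) ∞ χ) (hχ0 : ∀ x ∉ e.symm '' closedBall c R, χ x = 0) :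
    ∃ C : ℝ, 0 ≤ C ∧ ∀ W : ∀ x : M, TangentSpace (𝓡 n) x, (∀ x ∈ U, IsFieldAt r W x) →
      (∀ x ∈ U, divergence vol W x = 0) → ∀ B, 0 ≤ B → AtlasBound 𝒜 r U W B → ∀ y, ∀ k ≤ r,
      ‖iteratedFDeriv ℝ k
        (pullFun vol e fun x => χ x * divergence vol (fun x => f x • W x) x) y‖ ≤ C * B := by
  have hr' : (r : WithTop ℕ∞) ≤ ∞ := by exact_mod_cast le_top
  have hA : ∀ y ∈ e.target, ContDiffAt ℝ r (fun y => (chartDensity e vol.form y * χ (e.symm y)) •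
      fderiv ℝ (fun y => f (e.symm y)) y) y := fun y hy =>
    (((contDiffAt_chartDensity vol he hy).mul (contDiffAt_comp_symm hχ he hy)).smul
      ((contDiffAt_comp_symm hf he hy).fderiv_right (m := ∞) (by simp))).of_le hr'
  obtain ⟨a, ha1, ha⟩ := exists_iteratedFDeriv_bound e.open_target (isCompact_closedBall c R) hR r
    (fun y hy => (hA y hy).contDiffWithinAt)
  obtain ⟨C, hC0, hC⟩ := exists_bound_in_chart 𝒜 r he
    (isCompact_symm_image (isCompact_closedBall c R) hR) (symm_image_subset_source hR)
  refine ⟨2 ^ r * a * C, by positivity, fun W hW hdiv B hB hWB y k hk => ?_⟩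
  obtain ⟨-, h2⟩ := contDiff_pullFun_divergence vol (s := r) (by exact_mod_cast hr) he hU hR hRU hf
    hχ hχ0 hW hdiv
  by_cases hy : y ∈ closedBall c R
  · obtain ⟨h3, h4⟩ := h2 y hy
    rw [(h4.iteratedFDeriv ℝ k).eq_of_nhds]
    have hb : ∀ i ≤ r, ‖iteratedFDeriv ℝ i (chartField e W) y‖ ≤ C * B := fun i hi => by
      have hy' : y ∈ closedBall c R := hy
      have := hC U W hW B hWB (e.symm y) ⟨⟨y, hy, rfl⟩, hRU ⟨y, hy, rfl⟩⟩ i hi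
      rwa [e.right_inv (hR hy')] at this
    refine (norm_iteratedFDeriv_clm_apply_le_at (hA y (hR hy)) (by exact_mod_cast h3)
      (fun i hi => ha y hy i hi) hb hk).trans (le_of_eq (by ring))
  · have h0 : pullFun vol e (fun x => χ x * divergence vol (fun x => f x • W x) x) =ᶠ[𝓝 y]
        fun _ => 0 := by
      filter_upwards [isClosed_closedBall.isOpen_compl.mem_nhds hy] with z hz
      exact pullFun_eq_zero vol (fun x hx => by rw [hχ0 x hx, zero_mul]) hR hz
    rw [(h0.iteratedFDeriv ℝ k).eq_of_nhds]
    have : iteratedFDeriv ℝ k (fun _ : Euc n => (0 : ℝ)) y = 0 := by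
      simp
    rw [this, norm_zero]
    positivity

/-- The divergence equation for the part of `div (f W)` carried by a chart ball. -/
lemma exists_local_solution (hn : 1 ≤ n) (he : e ∈ IsManifold.maximalAtlas (𝓡 n) ∞ M)
    (hU : IsOpen U) (hR : closedBall c R ⊆ e.target) (hRU : e.symm '' closedBall c R ⊆ U)
    (hf : ContMDiff (𝓡 n) 𝓘(ℝ, ℝ) ∞ f) (hχ : ContMDiff (𝓡 n) 𝓘(ℝ, ℝ) ∞ χ)
    (hχ0 : ∀ x ∉ e.symm '' closedBall c R, χ x = 0) {b : Euc n → ℝ} (hb : ContDiff ℝ ∞ b)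
    (hb0 : ∀ y ∉ closedBall c R, b y = 0) (hb1 : ∫ y, b y = 1)
    {w : ∀ x : M, TangentSpace (𝓡 n) x} (hw : ∀ x, IsFieldAt ⊤ w x) {S : Set M}
    (hw0 : ∀ x ∉ S, w x = 0) {h₀ : M → ℝ} {a : ℝ}
    (hdw : ∀ x, divergence vol w x = extFun vol e b x - a * h₀ x) (𝒜 : RegularAtlas n M) {r : ℕ}
    (hr : 1 ≤ r) :
    ∃ C : ℝ, 0 ≤ C ∧ ∀ (s : ℕ∞), r ≤ s → ∀ W : ∀ x : M, TangentSpace (𝓡 n) x,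
      (∀ x ∈ U, IsFieldAt s W x) → (∀ x ∈ U, divergence vol W x = 0) → ∀ B, 0 ≤ B →
      AtlasBound 𝒜 r U W B → ∃ (v : ∀ x : M, TangentSpace (𝓡 n) x) (a' : ℝ),
        (∀ x, IsFieldAt s v x) ∧ (∀ x ∉ e.symm '' closedBall c R ∪ S, v x = 0) ∧
        (∀ x, divergence vol v x =
          χ x * divergence vol (fun x => f x • W x) x - a' * h₀ x) ∧
        AtlasBound 𝒜 r univ v (C * B) := by
  obtain ⟨Cg, hCg0, hCg⟩ := exists_pullFun_divergence_bound vol 𝒜 hr he hU hR hRU hf hχ hχ0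
  obtain ⟨Cb, hCb0, hCb⟩ := exists_ballSolution_bound c R r hb hb0
  obtain ⟨Ce, hCe0, hCe⟩ := exists_extField_bound vol 𝒜 r he (isCompact_closedBall c R) hR
  obtain ⟨Bw, hBw0, hBw⟩ := exists_atlasBound 𝒜 r fun x => (hw x).of_le le_top
  set m := volume.real (closedBall c R) with hm
  have hm0 : 0 ≤ m := measureReal_nonneg
  refine ⟨Ce * (Cb * Cg) + m * Cg * Bw, by positivity, fun s hrs W hW hdiv B hB hWB => ?_⟩
  have hs : 1 ≤ s := le_trans (by exact_mod_cast hr) hrs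
  set g := pullFun vol e fun x => χ x * divergence vol (fun x => f x • W x) x with hg
  have hu0 : ∀ x ∉ e.symm '' closedBall c R,
      χ x * divergence vol (fun x => f x • W x) x = 0 := fun x hx => by rw [hχ0 x hx, zero_mul]
  have hgs : ContDiff ℝ s g :=
    (contDiff_pullFun_divergence vol hs he hU hR hRU hf hχ hχ0 hW hdiv).1
  have hg0 : ∀ y ∉ closedBall c R, g y = 0 := fun y hy => pullFun_eq_zero vol hu0 hR hy
  have hgB := hCg W (fun x hx => (hW x hx).of_le hrs) hdiv B hB hWB
  have hInt : |∫ y, g y| ≤ m * Cg * B := by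
    rw [← setIntegral_eq_integral_of_forall_compl_eq_zero hg0, ← Real.norm_eq_abs]
    refine (norm_setIntegral_le_of_norm_le_const (C := Cg * B)
      (isCompact_closedBall c R).measure_lt_top fun y _ => ?_).trans (le_of_eq (by ring))
    have := hgB y 0 (Nat.zero_le _)
    rwa [norm_iteratedFDeriv_zero] at this
  have hz : ∀ y ∉ closedBall c R, ballSolution c R b g y = 0 := fun y hy =>
    ballSolution_eq_zero hg0 hb0 hy
  have hfield : ∀ x, IsFieldAt s (extField vol e (ballSolution c R b g)) x := fun x =>
    isFieldAt_extField vol he (contDiff_ballSolution hgs hb) hz (isCompact_closedBall c R) hR x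
  have hws : ∀ x, IsFieldAt s (fun x => (∫ y, g y) • w x) x := fun x =>
    ((hw x).of_le le_top).smul (f := fun _ => ∫ y, g y) contMDiff_const
  have hgr : ContDiff ℝ r g := hgs.of_le (by exact_mod_cast hrs)
  -- The ball solution leaves `-(∫ g)` times the local bump; adding `(∫ g) w` exchanges this for
  -- `-(∫ g) a` times the reference function `h₀`. As `w` is fixed, its cost is bounded by `|∫ g|`,
  -- hence by `B`.
  refine ⟨fun x => extField vol e (ballSolution c R b g) x + (∫ y, g y) • w x,
    (∫ y, g y) * a, fun x => (hfield x).add (hws x), fun x hx => ?_, fun x => ?_, ?_⟩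
  · beta_reduce
    rw [extField_eq_zero vol hz fun h => hx (Or.inl h), hw0 x fun h => hx (Or.inr h), smul_zero,
      add_zero]
  · rw [divergence_add vol ((hfield x).of_le hs) ((hws x).of_le hs),
      divergence_const_smul vol _ ((hw x).of_le le_top), hdw,
      divergence_extField_ballSolution vol hs hn he hR hb hb0 hb1 hgs hg0,
      extFun_pullFun vol he hR hu0]
    ring
  · have h1 := hCe _ (by exact_mod_cast contDiff_ballSolution (s := r) (by exact_mod_cast hgr) hb)
      hz (Cb * (Cg * B)) (by positivity) (hCb g hgr _ hgB)
    have h2 := (hBw.const_smul (fun x _ => (hw x).of_le le_top) (∫ y, g y)).mono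
      (mul_le_mul_of_nonneg_right hInt hBw0)
    refine (h1.add h2 (fun x _ => (hfield x).of_le hrs) (fun x _ => (hws x).of_le hrs)).mono
      (le_of_eq (by ring))

end Piece

/-- The divergence equation `div v = div (f W)` with a compactly supported solution `v`. -/
lemma exists_divergence_solver (hn : 1 ≤ n) {U G T : Set M} (hU : IsOpen U) (hG : IsOpen G)
    (hGU : G ⊆ U) (hGc : IsPreconnected G) (hGne : G.Nonempty) {f : M → ℝ}
    (hf : ContMDiff (𝓡 n) 𝓘(ℝ, ℝ) ∞ f) (hfU : tsupport f ⊆ U) (hT : IsCompact T) (hTG : T ⊆ G)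
    (hfT : ∀ x ∉ T, ∀ᶠ z in 𝓝 x, f z = f x) :
    ∃ T' : Set M, IsCompact T' ∧ T' ⊆ G ∧ ∀ (𝒜 : RegularAtlas n M) (r : ℕ), 1 ≤ r →
      ∃ C : ℝ, 0 ≤ C ∧ ∀ s : ℕ∞, r ≤ s → ∀ W : ∀ x : M, TangentSpace (𝓡 n) x,
        (∀ x ∈ U, IsFieldAt s W x) → (∀ x ∈ U, divergence vol W x = 0) → ∀ B, 0 ≤ B →
        AtlasBound 𝒜 r U W B → ∃ v : ∀ x : M, TangentSpace (𝓡 n) x,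
          (∀ x, IsFieldAt s v x) ∧ (∀ x ∉ T', v x = 0) ∧
          (∀ x, divergence vol v x = divergence vol (fun x => f x • W x) x) ∧
          AtlasBound 𝒜 r univ v (C * B) := by
  classical
  obtain ⟨p₀, hp₀⟩ := hGne
  set e₀ := chartAt (EuclideanSpace ℝ (Fin n)) p₀
  have he₀ : e₀ ∈ IsManifold.maximalAtlas (𝓡 n) ∞ M := chart_mem p₀
  obtain ⟨R₀, hR₀0, hR₀, hRG₀⟩ := exists_chart_ball (e := e₀) hG hp₀ (mem_chart_source _ p₀)
  obtain ⟨b₀, hb₀, hb₀0, hb₀1⟩ := exists_bump (e₀ p₀) hR₀0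
  -- The balls, bumps and transporting fields `w` are chosen before the atlas, `r` and `W`. The set
  -- `T'` built from them is thus independent of all three.
  have hloc : ∀ p ∈ G, ∃ (R : ℝ) (b : Euc n → ℝ) (w : ∀ x : M, TangentSpace (𝓡 n) x) (S : Set M)
      (a : ℝ), 0 < R ∧ closedBall (chartAt (Euc n) p p) R ⊆ (chartAt (Euc n) p).target ∧
      (chartAt (Euc n) p).symm '' closedBall (chartAt (Euc n) p p) R ⊆ G ∧ ContDiff ℝ ∞ b ∧
      (∀ y ∉ closedBall (chartAt (Euc n) p p) R, b y = 0) ∧ ∫ y, b y = 1 ∧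
      (∀ x, IsFieldAt ⊤ w x) ∧ IsCompact S ∧ S ⊆ G ∧ (∀ x ∉ S, w x = 0) ∧
      ∀ x, divergence vol w x = extFun vol (chartAt (Euc n) p) b x - a * extFun vol e₀ b₀ x := by
    intro p hp
    obtain ⟨O, hO, hpO, hOg⟩ := exists_local_primitive vol hn hG hGc he₀ hR₀0 hR₀ hRG₀ hb₀ hb₀0
      hb₀1 hp
    obtain ⟨R, hR0, hR, hRG⟩ := exists_chart_ball (e := chartAt (Euc n) p) (hG.inter hO) ⟨hp, hpO⟩
      (mem_chart_source _ p)
    obtain ⟨b, hb, hb0, hb1⟩ := exists_bump (chartAt (Euc n) p p) hR0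
    obtain ⟨a, w, hw, ⟨S, hS, hSG, hwS⟩, hdw⟩ := hOg (extFun vol (chartAt (Euc n) p) b)
      (contMDiff_extFun vol (chart_mem p) hb (isCompact_closedBall _ _) hR hb0)
      ((tsupport_extFun_subset vol (isCompact_closedBall _ _) hR hb0).trans
        (hRG.trans inter_subset_right))
    exact ⟨R, b, w, S, a, hR0, hR, hRG.trans inter_subset_left, hb, hb0, hb1, hw, hS, hSG, hwS, hdw⟩
  choose! R b w S a hR0 hR hRG hb hb0 hb1 hw hS hSG hwS hdw using hloc
  obtain ⟨t, χ, htT, hχ, hχO, hχ1⟩ := exists_finite_partition (n := n) hT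
    (fun p => (chartAt (Euc n) p).source ∩ chartAt (Euc n) p ⁻¹' ball (chartAt (Euc n) p p) (R p))
    (fun p _ => (chartAt (Euc n) p).isOpen_inter_preimage isOpen_ball)
    (fun p hp => ⟨mem_chart_source _ p, mem_ball_self (hR0 p (hTG hp))⟩)
  have htG : ∀ i ∈ t, i ∈ G := fun i hi => hTG (htT i hi)
  have hχ0 : ∀ i ∈ t, ∀ x ∉ (chartAt (Euc n) i).symm '' closedBall (chartAt (Euc n) i i) (R i),
      χ i x = 0 := fun i hi x hx => image_eq_zero_of_notMem_tsupport fun hm => hx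
    ⟨chartAt (Euc n) i x, ball_subset_closedBall (hχO i hi hm).2,
      (chartAt (Euc n) i).left_inv (hχO i hi hm).1⟩
  refine ⟨⋃ i ∈ t, ((chartAt (Euc n) i).symm '' closedBall (chartAt (Euc n) i i) (R i) ∪ S i),
    t.isCompact_biUnion fun i hi => (isCompact_symm_image (isCompact_closedBall _ _)
      (hR i (htG i hi))).union (hS i (htG i hi)),
    iUnion₂_subset fun i hi => union_subset (hRG i (htG i hi)) (hSG i (htG i hi)),
    fun 𝒜 r hr => ?_⟩
  have hsol := fun i (hi : i ∈ t) => exists_local_solution vol hn (chart_mem i) hU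
    (hR i (htG i hi)) ((hRG i (htG i hi)).trans hGU) hf (hχ i) (hχ0 i hi) (hb i (htG i hi))
    (hb0 i (htG i hi)) (hb1 i (htG i hi)) (hw i (htG i hi)) (hwS i (htG i hi))
    (hdw i (htG i hi)) 𝒜 hr
  choose! C hC0 hC using hsol
  refine ⟨∑ i ∈ t, C i, Finset.sum_nonneg hC0, fun s hrs W hW hdiv B hB hWB => ?_⟩
  have hs : 1 ≤ s := le_trans (by exact_mod_cast hr) hrs
  have hpiece := fun i (hi : i ∈ t) => hC i hi s hrs W hW hdiv B hB hWB
  choose! v a' hv hv0 hdv hvB using hpiece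
  have hvs : ∀ x, IsFieldAt s (fun x => ∑ i ∈ t, v i x) x := fun x =>
    isFieldAt_sum t fun i hi => hv i hi x
  have hfW : ∀ x, IsFieldAt s (fun x => f x • W x) x :=
    isFieldAt_smul_of_tsupport_subset hf hfU hW
  have hd : ∀ x, divergence vol (fun x => ∑ i ∈ t, v i x) x =
      divergence vol (fun x => f x • W x) x - (∑ i ∈ t, a' i) * extFun vol e₀ b₀ x := fun x => by
    rw [divergence_sum vol t fun i hi => (hv i hi x).of_le hs,
      Finset.sum_congr rfl fun i hi => hdv i hi x, Finset.sum_sub_distrib, ← Finset.sum_mul,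
      ← Finset.sum_mul]
    congr 1
    by_cases hx : x ∈ T
    · rw [hχ1 x hx, one_mul]
    · rw [divergence_smul_eq_zero vol hfU (fun x hx => (hW x hx).of_le hs) hdiv (hfT x hx),
        mul_zero]
  -- `f W - ∑ v i` is a field on the whole closed manifold with divergence `(∑ a' i)` times the
  -- reference bump, whose integral is not zero.
  have ha' : ∑ i ∈ t, a' i = 0 := by
    refine eq_zero_of_divergence_eq vol
      (X := fun x => f x • W x - ∑ i ∈ t, v i x) (h := extFun vol e₀ b₀)
      (fun x => ((hfW x).sub (hvs x)).of_le hs)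
      (contMDiff_extFun vol he₀ hb₀ (isCompact_closedBall _ _) hR₀ hb₀0).continuous he₀
      ((tsupport_extFun_subset vol (isCompact_closedBall _ _) hR₀ hb₀0).trans
        (symm_image_subset_source hR₀))
      (chartIntegral_extFun_ne_zero vol he₀ hR₀ hb₀0 hb₀1) fun x => ?_
    rw [divergence_sub vol ((hfW x).of_le hs) ((hvs x).of_le hs), hd]
    ring
  refine ⟨fun x => ∑ i ∈ t, v i x, hvs, fun x hx => Finset.sum_eq_zero fun i hi =>
    hv0 i hi x fun hm => hx (mem_biUnion hi hm), fun x => ?_, ?_⟩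
  · rw [hd, ha', zero_mul, sub_zero]
  · rw [Finset.sum_mul]
    exact atlasBound_sum t hvB fun i hi x _ => (hv i hi x).of_le hrs

end Solver

/-! ### Smoothing of divergence-free fields in chart balls. -/

section Smoothing

variable {n : ℕ}

/-- A field which is divergence-free near a ball can be approximated, with a change in this ball
only, by fields which are smooth in the ball, and have the same divergence. -/
lemma exists_local_regularization {s : ℕ∞} (hs : 1 ≤ s) {r : ℕ} (hrs : r ≤ s) {c : Euc n} {R : ℝ}
    (hR : 0 < R) {F : Euc n → Euc n} (hF : ContDiff ℝ s F)
    (hdiv : ∀ y ∈ ball c (2 * R), ediv F y = 0) {δ : ℝ} (hδ : 0 < δ) :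
    ∃ F' : Euc n → Euc n, ContDiff ℝ s F' ∧ (∀ y ∉ ball c R, F' y = F y) ∧
      (∀ y, ediv F' y = ediv F y) ∧ (∀ y ∈ ball c R, ContDiffAt ℝ ∞ F' y) ∧
      (∀ Ω, IsOpen Ω → ContDiffOn ℝ ∞ F Ω → ContDiffOn ℝ ∞ F' Ω) ∧
      ∀ y ∈ closedBall c R, ∀ k ≤ r, ‖iteratedFDeriv ℝ k (fun y => F' y - F y) y‖ ≤ δ := by
  obtain ⟨η, hη, hη0, hη1⟩ := exists_bump (0 : Euc n) one_pos
  let ε : ContDiffBump c := ⟨R / 2, R, by positivity, by linarith⟩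
  have hε : ContDiff ℝ ∞ ε := ε.contDiff
  have hεpos : ∀ y ∈ ball c R, 0 < ε y := fun y hy => ε.pos_of_mem_ball hy
  have hεzero : ∀ y ∉ ball c R, ε y = 0 := fun y hy => by
    refine Function.notMem_support.1 fun h => hy ?_
    rwa [ε.support_eq] at h
  have hF1 : ContDiff ℝ 1 F := hF.of_le (by exact_mod_cast hs)
  -- Small `τ` gives the `C^r` estimate, `τ > 0` gives smoothness in the ball, and `τ < R` keeps the
  -- points `y + τ ε(y) z`, for `y` in the closed `R`-ball, inside the `2R`-ball where the
  -- divergence vanishes.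
  obtain ⟨τ, hτδ, hτ0, hτR⟩ := (((eventually_regularize_sub_le (r := r) hη.continuous hη0 hη1 hε
    (hF.of_le (by exact_mod_cast hrs)) (isCompact_closedBall c R) hδ).filter_mono
    nhdsWithin_le_nhds).and (Ioo_mem_nhdsGT hR)).exists
  have hself : ∀ y ∉ ball c R, regularize η ε F (y, τ) = F y := fun y hy =>
    regularize_eq_self_of_eq_zero hη0 hη1 (fun _ => ε.nonneg) (hεzero y hy)
  have hpos : ∀ y ∈ ball c R, ContDiffAt ℝ ∞ (fun y => regularize η ε F (y, τ)) y := fun y hy =>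
    contDiffAt_regularize_of_pos hη hη0 hε hF.continuous hτ0 (hεpos y hy)
  refine ⟨fun y => regularize η ε F (y, τ),
    (contDiff_regularize hη.continuous hε hF).comp (contDiff_id.prodMk contDiff_const),
    hself, fun y => ?_, hpos, fun Ω hΩ hFΩ y hy => ?_, hτδ⟩
  · by_cases hy : y ∈ closedBall c R
    · rw [ediv_regularize hη.continuous hε hF1, hdiv y (closedBall_subset_ball (by linarith) hy)]
      refine setIntegral_eq_zero_of_forall_eq_zero fun z hz => ?_
      rw [hdiv, mul_zero, mul_zero]
      rw [mem_closedBall, dist_eq_norm] at hy hz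
      rw [mem_ball, dist_eq_norm]
      have h1 : ‖(τ * ε y) • z‖ ≤ τ := by
        rw [norm_smul, Real.norm_of_nonneg (mul_nonneg hτ0.le ε.nonneg), mul_assoc]
        refine mul_le_of_le_one_right hτ0.le (mul_le_one₀ ε.le_one (norm_nonneg _) ?_)
        simpa using hz
      calc ‖y + (τ * ε y) • z - c‖ = ‖(y - c) + (τ * ε y) • z‖ := by congr 1; abel
        _ ≤ ‖y - c‖ + ‖(τ * ε y) • z‖ := norm_add_le _ _
        _ < 2 * R := by linarith
    · have h : (fun y => regularize η ε F (y, τ)) =ᶠ[𝓝 y] F := by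
        filter_upwards [isClosed_closedBall.isOpen_compl.mem_nhds hy] with z hz
        exact hself z fun hm => hz (ball_subset_closedBall hm)
      rw [ediv, ediv, h.fderiv_eq]
  · by_cases hyR : y ∈ ball c R
    · exact (hpos y hyR).contDiffWithinAt
    · exact (contDiffAt_regularize_of_eq_zero hη.continuous hε (hεzero y hyR) hΩ hy
        hFΩ).contDiffWithinAt

variable {M : Type*} [TopologicalSpace M] [ChartedSpace (EuclideanSpace ℝ (Fin n)) M]
  [IsManifold (𝓡 n) ∞ M] {e : OpenPartialHomeomorph M (EuclideanSpace ℝ (Fin n))}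
  {Z : ∀ x : M, TangentSpace (𝓡 n) x} (vol : VolumeForm n M)

/-- The flux of a vector field on `M` in a chart, cut off outside of a ball. -/
lemma exists_cutoff_flux {s : ℕ∞} (hs : 1 ≤ s) (he : e ∈ IsManifold.maximalAtlas (𝓡 n) ∞ M)
    {c : Euc n} {R : ℝ} (hR0 : 0 < R) (hR : closedBall c (3 * R) ⊆ e.target)
    (hZ : ∀ x, IsFieldAt s Z x) (hdiv : ∀ x, divergence vol Z x = 0) :
    ∃ F : Euc n → Euc n, ContDiff ℝ s F ∧ (∀ y ∈ ball c (2 * R), ediv F y = 0) ∧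
      ∀ y ∈ ball c (2 * R), F y = chartDensity e vol.form y • chartField e Z y := by
  -- Equal to `1` on the `2R`-ball, which is all that the regularization in the `R`-ball reads, and
  -- supported in the `3R`-ball inside the chart, so that the flux becomes a global Euclidean field.
  let χ : ContDiffBump c := ⟨2 * R, 3 * R, by positivity, by linarith⟩
  have h1 : ∀ y ∈ ball c (2 * R), χ y • chartDensity e vol.form y • chartField e Z y =
      chartDensity e vol.form y • chartField e Z y := fun y hy => by
    rw [χ.one_of_mem_closedBall (ball_subset_closedBall hy), one_smul]
  have ht : ball c (2 * R) ⊆ e.target := (ball_subset_ball (by linarith)).trans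
    (ball_subset_closedBall.trans hR)
  have hZe : ∀ y ∈ e.target, ContDiffAt ℝ s (chartField e Z) y := fun y hy => by
    have := (isFieldAt_iff he (e.map_target hy)).1 (hZ (e.symm y))
    rwa [e.right_inv hy] at this
  refine ⟨fun y => χ y • chartDensity e vol.form y • chartField e Z y,
    contDiff_iff_contDiffAt.2 fun y => ?_, fun y hy => ?_, h1⟩
  · have hs' : (s : WithTop ℕ∞) ≤ ∞ := by exact_mod_cast le_top
    by_cases hy : y ∈ e.target
    · exact χ.contDiff.contDiffAt.smul
        (((contDiffAt_chartDensity vol he hy).of_le hs').smul (hZe y hy))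
    · refine (contDiffAt_const (c := (0 : Euc n))).congr_of_eventuallyEq ?_
      have hy' : y ∉ tsupport χ := fun hm => hy (hR (by rwa [χ.tsupport_eq] at hm))
      filter_upwards [(isClosed_tsupport χ).isOpen_compl.mem_nhds hy'] with z hz
      rw [image_eq_zero_of_notMem_tsupport hz, zero_smul]
  · have hev : (fun y => χ y • chartDensity e vol.form y • chartField e Z y) =ᶠ[𝓝 y]
        fun y => chartDensity e vol.form y • chartField e Z y := by
      filter_upwards [isOpen_ball.mem_nhds hy] with z hz using h1 z hz
    have h2 := divergence_eq vol ((hZ (e.symm y)).of_le hs) he (e.map_target (ht hy))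
    rw [hdiv, e.right_inv (ht hy)] at h2
    rw [ediv, hev.fderiv_eq]
    exact (mul_eq_zero.1 h2.symm).resolve_left
      (inv_ne_zero (chartDensity_ne_zero vol he (ht hy)))

variable [T2Space M] [CompactSpace M]

/-- The regularized flux differs from the original one only in the `R`-ball, so the difference
extends by zero to a divergence-free field on `M`, which is added to `Z`. In the `2R`-ball the sum
has the regularized flux and inherits its smoothness. The tolerance `δ / (C + 1)` pays for the
passage from the chart to the atlas. -/
lemma exists_smoothing_in_ball {s : ℕ∞} (hs : 1 ≤ s) {r : ℕ} (hrs : r ≤ s)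
    (he : e ∈ IsManifold.maximalAtlas (𝓡 n) ∞ M) {c : Euc n} {R : ℝ} (hR0 : 0 < R)
    (hR : closedBall c (3 * R) ⊆ e.target) (𝒜 : RegularAtlas n M) (hZ : ∀ x, IsFieldAt s Z x)
    (hdiv : ∀ x, divergence vol Z x = 0) {δ : ℝ} (hδ : 0 < δ) :
    ∃ Z' : ∀ x : M, TangentSpace (𝓡 n) x, (∀ x, IsFieldAt s Z' x) ∧
      (∀ x, divergence vol Z' x = 0) ∧ (∀ x ∉ e.source ∩ e ⁻¹' ball c R, Z' x = Z x) ∧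
      (∀ x ∈ e.source ∩ e ⁻¹' ball c R, IsFieldAt ⊤ Z' x) ∧
      (∀ Ω, IsOpen Ω → (∀ x ∈ Ω, IsFieldAt ⊤ Z x) → ∀ x ∈ Ω, IsFieldAt ⊤ Z' x) ∧
      AtlasBound 𝒜 r univ (fun x => Z' x - Z x) δ := by
  have hRt : closedBall c R ⊆ e.target := (closedBall_subset_closedBall (by linarith)).trans hR
  have h2Rt : ball c (2 * R) ⊆ e.target := (ball_subset_ball (by linarith)).trans
    (ball_subset_closedBall.trans hR)
  obtain ⟨F, hF, hFdiv, hFeq⟩ := exists_cutoff_flux vol hs he hR0 hR hZ hdiv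
  obtain ⟨C, hC0, hC⟩ := exists_extField_bound vol 𝒜 r he (isCompact_closedBall c R) hRt
  obtain ⟨F', hF', hself, hdiv', hsm, hΩ, hδ'⟩ := exists_local_regularization hs hrs hR0 hF hFdiv
    (δ := δ / (C + 1)) (by positivity)
  have hD : ContDiff ℝ s (fun y => F' y - F y) := hF'.sub hF
  have hDz : ∀ y ∉ ball c R, F' y - F y = 0 := fun y hy => by rw [hself y hy, sub_self]
  have hDz' : ∀ y ∉ closedBall c R, F' y - F y = 0 := fun y hy =>
    hDz y fun hm => hy (ball_subset_closedBall hm)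
  set D := extField vol e (fun y => F' y - F y) with hDdef
  have hDfield : ∀ x, IsFieldAt s D x :=
    isFieldAt_extField vol he hD hDz' (isCompact_closedBall c R) hRt
  have hDdiv : ∀ x, divergence vol D x = 0 := fun x => by
    rw [hDdef, divergence_extField vol he (hD.of_le (by exact_mod_cast hs)) hDz'
      (isCompact_closedBall c R) hRt]
    refine extFun_eq_zero vol (T := ∅) (fun y _ => ?_) (by simp)
    rw [ediv_sub ((hF'.differentiable (by simpa using (zero_lt_one.trans_le hs).ne')) y)
      ((hF.differentiable (by simpa using (zero_lt_one.trans_le hs).ne')) y), hdiv', sub_self]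
  have hchart : ∀ y ∈ ball c (2 * R), chartField e (fun x => Z x + D x) =ᶠ[𝓝 y]
      fun y => (chartDensity e vol.form y)⁻¹ • F' y := fun y hy => by
    filter_upwards [isOpen_ball.mem_nhds hy] with z hz
    rw [chartField_add, hDdef]
    beta_reduce
    rw [chartField_extField vol he (h2Rt hz), hFeq z hz, smul_sub,
      inv_smul_smul₀ (chartDensity_ne_zero vol he (h2Rt hz)), add_sub_cancel]
  have hsmooth : ∀ x ∈ e.source ∩ e ⁻¹' ball c (2 * R), ContDiffAt ℝ ∞ F' (e x) →
      IsFieldAt ⊤ (fun x => Z x + D x) x := fun x hx h => by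
    rw [isFieldAt_iff he hx.1]
    exact (((contDiffAt_chartDensity vol he (e.map_source hx.1)).inv
      (chartDensity_ne_zero vol he (e.map_source hx.1))).smul h).congr_of_eventuallyEq
      (hchart _ hx.2)
  refine ⟨fun x => Z x + D x, fun x => (hZ x).add (hDfield x), fun x => ?_, fun x hx => ?_,
    fun x hx => ?_, fun Ω hΩo hZΩ x hx => ?_, ?_⟩
  · rw [divergence_add vol ((hZ x).of_le hs) ((hDfield x).of_le hs), hdiv, hDdiv, add_zero]
  · have : D x = 0 := extField_eq_zero vol hDz fun ⟨y, hy, hyx⟩ => hx <| by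
      have hyt := hRt (ball_subset_closedBall hy)
      rw [← hyx]
      exact ⟨e.map_target hyt, by rwa [mem_preimage, e.right_inv hyt]⟩
    beta_reduce
    rw [this, add_zero]
  · exact hsmooth x ⟨hx.1, ball_subset_ball (by linarith) hx.2⟩ (hsm _ hx.2)
  · by_cases hxR : x ∈ e.symm '' closedBall c R
    · obtain ⟨y, hy, rfl⟩ := hxR
      have hyt := hRt hy
      have hy2 : y ∈ ball c (2 * R) := closedBall_subset_ball (by linarith) hy
      refine hsmooth _ ⟨e.map_target hyt, by rwa [mem_preimage, e.right_inv hyt]⟩ ?_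
      rw [e.right_inv hyt]
      have hO : IsOpen (ball c (2 * R) ∩ (e.target ∩ e.symm ⁻¹' Ω)) :=
        isOpen_ball.inter (e.isOpen_inter_preimage_symm hΩo)
      refine (hΩ _ hO fun z hz => ContDiffAt.contDiffWithinAt ?_).contDiffAt
        (hO.mem_nhds ⟨hy2, hyt, hx⟩)
      have h1 := (isFieldAt_iff he (e.map_target hz.2.1)).1 (hZΩ _ hz.2.2)
      rw [e.right_inv hz.2.1] at h1
      refine ((contDiffAt_chartDensity vol he hz.2.1).smul h1).congr_of_eventuallyEq ?_
      filter_upwards [isOpen_ball.mem_nhds hz.1] with w hw using hFeq w hw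
    · refine (hZΩ x hx).congr ?_
      filter_upwards [extField_eventually_eq_zero vol hDz' (isCompact_closedBall c R) hRt hxR]
        with z hz
      rw [hDdef, hz, add_zero]
  · have h1 := hC _ (hD.of_le (by exact_mod_cast hrs)) hDz' (δ / (C + 1)) (by positivity) hδ'
    have h2 : (fun x => Z x + D x - Z x) = D := by
      ext1 x
      rw [add_sub_cancel_left]
    rw [h2]
    refine h1.mono ?_
    rw [← mul_div_assoc, div_le_iff₀ (by positivity)]
    nlinarith

/-- Smoothing of a divergence-free vector field in a finite union of chart balls. -/
lemma exists_smoothing {s : ℕ∞} (hs : 1 ≤ s) {r : ℕ} (hrs : r ≤ s) {ι : Type*} (t : Finset ι)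
    {e : ι → OpenPartialHomeomorph M (EuclideanSpace ℝ (Fin n))}
    (he : ∀ i ∈ t, e i ∈ IsManifold.maximalAtlas (𝓡 n) ∞ M) {c : ι → Euc n} {R : ι → ℝ}
    (hR0 : ∀ i ∈ t, 0 < R i) (hR : ∀ i ∈ t, closedBall (c i) (3 * R i) ⊆ (e i).target)
    (𝒜 : RegularAtlas n M) (hZ : ∀ x, IsFieldAt s Z x) (hdiv : ∀ x, divergence vol Z x = 0)
    {δ : ℝ} (hδ : 0 < δ) :
    ∃ Z' : ∀ x : M, TangentSpace (𝓡 n) x, (∀ x, IsFieldAt s Z' x) ∧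
      (∀ x, divergence vol Z' x = 0) ∧
      (∀ x ∉ ⋃ i ∈ t, (e i).source ∩ e i ⁻¹' ball (c i) (R i), Z' x = Z x) ∧
      (∀ x ∈ ⋃ i ∈ t, (e i).source ∩ e i ⁻¹' ball (c i) (R i), IsFieldAt ⊤ Z' x) ∧
      AtlasBound 𝒜 r univ (fun x => Z' x - Z x) δ := by
  classical
  induction t using Finset.induction_on generalizing δ with
  | empty =>
    refine ⟨Z, hZ, hdiv, fun _ _ => rfl, by simp, ?_⟩
    simp only [sub_self]
    exact atlasBound_zero.mono hδ.le
  | insert a t ha ih =>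
    obtain ⟨Z₁, hZ₁, hdiv₁, heq₁, hsm₁, hB₁⟩ := ih
      (fun i hi => he i (Finset.mem_insert_of_mem hi))
      (fun i hi => hR0 i (Finset.mem_insert_of_mem hi))
      (fun i hi => hR i (Finset.mem_insert_of_mem hi)) (half_pos hδ)
    have hat := Finset.mem_insert_self a t
    obtain ⟨Z₂, hZ₂, hdiv₂, heq₂, hsm₂, hΩ₂, hB₂⟩ := exists_smoothing_in_ball vol hs hrs (he a hat)
      (hR0 a hat) (hR a hat) 𝒜 hZ₁ hdiv₁ (half_pos hδ)
    refine ⟨Z₂, hZ₂, hdiv₂, fun x hx => ?_, fun x hx => ?_, ?_⟩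
    · rw [Finset.set_biUnion_insert, mem_union, not_or] at hx
      rw [heq₂ x hx.1, heq₁ x hx.2]
    · rw [Finset.set_biUnion_insert] at hx
      rcases hx with hx | hx
      · exact hsm₂ x hx
      -- Points smoothed in earlier balls stay smooth, since the regularization in the new ball
      -- preserves smoothness on open sets.
      · exact hΩ₂ _ (isOpen_biUnion fun i _ => (e i).isOpen_inter_preimage isOpen_ball) hsm₁ x hx
    · have h := hB₂.add hB₁ (fun x _ => ((hZ₂ x).sub (hZ₁ x)).of_le hrs)
        (fun x _ => ((hZ₁ x).sub (hZ x)).of_le hrs)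
      simpa only [sub_add_sub_cancel, add_halves] using h

end Smoothing

/-! ### Cut-off, correction and smoothing put together. -/

section Pasting

variable {n : ℕ} {M : Type*} [TopologicalSpace M] [ChartedSpace (EuclideanSpace ℝ (Fin n)) M]
  [IsManifold (𝓡 n) ∞ M] [T2Space M] [CompactSpace M]
  {X Y : ∀ x : M, TangentSpace (𝓡 n) x} (vol : VolumeForm n M)

lemma AtlasBound.eq_zero {𝒜 : RegularAtlas n M} {r : ℕ} {A : Set M} (h : AtlasBound 𝒜 r A X 0)
    {x : M} (hx : x ∈ A) : X x = 0 := by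
  obtain ⟨j, hj⟩ := 𝒜.exists_mem x
  have h1 := h j x ⟨hj, hx⟩ 0 (Nat.zero_le _)
  rw [norm_iteratedFDeriv_zero, norm_le_zero_iff] at h1
  have hxs := 𝒜.mem_source hj
  have h2 := mfderiv_symm_chartField (𝒜.chart_mem j) X ((𝒜.chart j).map_source hxs)
  rw [h1, (𝒜.chart j).left_inv hxs] at h2
  exact h2.symm.trans (map_zero _)

/-- `X` is automatically bounded by compactness of `M`, so boundedness of `Y` makes the norm of `Y -
X` on `U` finite and usable as a real number. -/
lemma exists_atlasBound_sub (𝒜 : RegularAtlas n M) (r : ℕ) {U : Set M}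
    (hX : ∀ x, IsFieldAt r X x) (hY : ∀ x ∈ U, IsFieldAt r Y x) (hYb : IsCrBoundedOn 𝒜 r U Y) :
    ∃ B, AtlasBound 𝒜 r U (fun x => Y x - X x) B := by
  obtain ⟨B, -, hB⟩ := exists_atlasBound 𝒜 r hX
  have hB' : AtlasBound 𝒜 r U X B := fun j x hx => hB j x ⟨hx.1, trivial⟩
  have h := (atlasBound_of_whitneyNorm_ne_top hYb.ne).add
    (hB'.const_smul (fun x _ => hX x) (-1)) hY
    (fun x _ => (hX x).smul (f := fun _ => (-1 : ℝ)) contMDiff_const)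
  simp only [neg_smul, one_smul, ← sub_eq_add_neg] at h
  exact ⟨_, h⟩

/-- A cut-off function for a compact set `K` in an open set `U`, with its transition region. -/
lemma exists_cutoff {K U : Set M} (hK : IsCompact K) (hU : IsOpen U) (hKU : K ⊆ U) :
    ∃ (f : M → ℝ) (T N : Set M), ContMDiff (𝓡 n) 𝓘(ℝ, ℝ) ∞ f ∧ tsupport f ⊆ U ∧ IsCompact T ∧
      T ⊆ U \ K ∧ IsOpen N ∧ K ⊆ N ∧ N ⊆ U ∧ (∀ x ∈ N, f x = 1) ∧
      ∀ x ∉ T, x ∈ N ∨ x ∉ tsupport f := by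
  obtain ⟨f, hf0, hf1, -⟩ := exists_contMDiffMap_zero_one_nhds_of_isClosed (n := ⊤) (𝓡 n)
    hU.isClosed_compl hK.isClosed (disjoint_compl_left_iff_subset.2 hKU)
  obtain ⟨N₀, hN₀, hUN₀, hfN₀⟩ := eventually_nhdsSet_iff_exists.1 hf0
  obtain ⟨N, hN, hKN, hfN⟩ := eventually_nhdsSet_iff_exists.1 hf1
  have hfU : tsupport f ⊆ U := by
    have h1 : tsupport f ⊆ N₀ᶜ := closure_minimal (fun x hx hxN => hx (hfN₀ x hxN))
      hN₀.isClosed_compl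
    exact h1.trans (compl_subset_comm.1 hUN₀)
  refine ⟨f, tsupport f \ N, N, f.contMDiff, hfU,
    ((isClosed_tsupport _).sdiff hN).isCompact,
    fun x hx => ⟨hfU hx.1, fun hxK => hx.2 (hKN hxK)⟩, hN, hKN, fun x hx => ?_, hfN,
    fun x hx => ?_⟩
  · refine hfU (subset_tsupport _ ?_)
    rw [Function.mem_support, hfN x hx]
    exact one_ne_zero
  · by_contra! h
    exact hx ⟨h.2, h.1⟩

/-- A compact set in an open set `G` is covered by finitely many balls of charts whose closures are
in `G`. -/
lemma exists_ball_cover {G T : Set M} (hG : IsOpen G) (hT : IsCompact T) (hTG : T ⊆ G) :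
    ∃ (t : Finset M) (R : M → ℝ), (∀ i ∈ t, 0 < R i) ∧
      (∀ i ∈ t, closedBall (chartAt (Euc n) i i) (3 * R i) ⊆ (chartAt (Euc n) i).target) ∧
      (∀ i ∈ t, (chartAt (Euc n) i).symm '' closedBall (chartAt (Euc n) i i) (R i) ⊆ G) ∧
      T ⊆ ⋃ i ∈ t, (chartAt (Euc n) i).source ∩
        chartAt (Euc n) i ⁻¹' ball (chartAt (Euc n) i i) (R i) := by
  have h : ∀ p ∈ T, ∃ R : ℝ, 0 < R ∧
      closedBall (chartAt (Euc n) p p) (3 * R) ⊆ (chartAt (Euc n) p).target ∧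
      (chartAt (Euc n) p).symm '' closedBall (chartAt (Euc n) p p) (R) ⊆ G := fun p hp => by
    obtain ⟨R, hR0, hR, hRG⟩ := exists_chart_ball (e := chartAt (Euc n) p) hG (hTG hp)
      (mem_chart_source _ p)
    refine ⟨R / 3, by positivity, by rwa [mul_div_cancel₀ _ (by norm_num)],
      (image_mono (closedBall_subset_closedBall (by linarith))).trans hRG⟩
  choose! R hR0 hR hRG using h
  obtain ⟨t, htT, ht⟩ := hT.elim_nhds_subcover
    (fun p => (chartAt (Euc n) p).source ∩ chartAt (Euc n) p ⁻¹' ball (chartAt (Euc n) p p) (R p))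
    fun p hp => ((chartAt (Euc n) p).isOpen_inter_preimage isOpen_ball).mem_nhds
      ⟨mem_chart_source _ p, mem_ball_self (hR0 p hp)⟩
  exact ⟨t, R, fun i hi => hR0 i (htT i hi), fun i hi => hR i (htT i hi),
    fun i hi => hRG i (htT i hi), ht⟩

/-- The pasting of two fields which do not coincide. -/
lemma exists_pasting (hn : 1 ≤ n) {K U : Set M} (hK : IsCompact K) (hU : IsOpen U) (hKU : K ⊆ U)
    (hUK : IsPreconnected (U \ K)) (hne : (U \ K).Nonempty) :
    ∃ V : Set M, IsOpen V ∧ K ⊆ V ∧ V ⊆ U ∧ ∀ (𝒜 : RegularAtlas n M) (r : ℕ), 1 ≤ r →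
      ∃ C : ℝ, 1 < C ∧ ∀ s : ℕ∞, r ≤ s → ∀ X Y : ∀ x : M, TangentSpace (𝓡 n) x,
        IsDivFreeFieldOn vol s univ X → IsDivFreeFieldOn vol s U Y →
        ∀ B, 0 < B → AtlasBound 𝒜 r U (fun x => Y x - X x) B →
        ∃ Z : ∀ x : M, TangentSpace (𝓡 n) x, IsDivFreeFieldOn vol s univ Z ∧
          (∀ x ∈ V, Z x = Y x) ∧ (∀ᶠ x in 𝓝ˢ Uᶜ, Z x = X x) ∧
          AtlasBound 𝒜 r univ (fun x => Z x - X x) (C * B) ∧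
          ∀ x, Z x ≠ X x → (x ∈ U → Z x ≠ Y x) → IsFieldAt ⊤ Z x := by
  have hG : IsOpen (U \ K) := hU.sdiff hK.isClosed
  obtain ⟨f, T, N, hf, hfU, hT, hTG, hN, hKN, hNU, hfN, hTN⟩ := exists_cutoff (n := n) hK hU hKU
  have hfT : ∀ x ∉ T, ∀ᶠ z in 𝓝 x, f z = f x := fun x hx => by
    rcases hTN x hx with h | h
    · filter_upwards [hN.mem_nhds h] with z hz
      rw [hfN z hz, hfN x h]
    · filter_upwards [(isClosed_tsupport f).isOpen_compl.mem_nhds h] with z hz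
      rw [image_eq_zero_of_notMem_tsupport hz, image_eq_zero_of_notMem_tsupport h]
  obtain ⟨T', hT', hTG', hsolve⟩ := exists_divergence_solver vol hn hU hG sdiff_subset hUK hne hf hfU
    hT hTG hfT
  obtain ⟨t, R, hR0, hR, hRG, hcov⟩ := exists_ball_cover (n := n) hG (hT.union hT')
    (union_subset hTG hTG')
  set Q : Set M := ⋃ i ∈ t, (chartAt (Euc n) i).symm '' closedBall (chartAt (Euc n) i i) (R i)
    with hQ
  set O : Set M := ⋃ i ∈ t, (chartAt (Euc n) i).source ∩
    chartAt (Euc n) i ⁻¹' ball (chartAt (Euc n) i i) (R i) with hO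
  have hQc : IsCompact Q := t.isCompact_biUnion fun i hi => isCompact_symm_image
    (isCompact_closedBall _ _) ((closedBall_subset_closedBall
      (by linarith [hR0 i hi])).trans (hR i hi))
  have hQG : Q ⊆ U \ K := iUnion₂_subset hRG
  have hOQ : O ⊆ Q := iUnion₂_mono fun i _ x hx =>
    ⟨chartAt (Euc n) i x, ball_subset_closedBall hx.2, (chartAt (Euc n) i).left_inv hx.1⟩
  -- `V` is the part of the region `f = 1` reached neither by the correction `v`, supported in `T'`,
  -- nor by the smoothing, confined to `Q`. All these sets are fixed before the atlas and `r`.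
  refine ⟨N ∩ (T'ᶜ ∩ Qᶜ), hN.inter (hT'.isClosed.isOpen_compl.inter hQc.isClosed.isOpen_compl),
    fun x hx => ⟨hKN hx, fun h => (hTG' h).2 hx, fun h => (hQG h).2 hx⟩,
    inter_subset_left.trans hNU, fun 𝒜 r hr => ?_⟩
  obtain ⟨C₁, hC₁0, hC₁⟩ := exists_smul_bound 𝒜 r hf hfU
  obtain ⟨C₂, hC₂0, hC₂⟩ := hsolve 𝒜 r hr
  -- `C₁` accounts for `f W`, `C₂` for `v`, and `1` for the smoothing, whose tolerance is `B`
  -- itself; the remaining `1` makes the constant exceed `1` strictly.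
  refine ⟨C₁ + C₂ + 2, by linarith, fun s hrs X Y hX hY B hB hWB => ?_⟩
  have hs : 1 ≤ s := le_trans (by exact_mod_cast hr) hrs
  have hXf : ∀ x, IsFieldAt s X x := fun x => hX.isFieldAt vol isOpen_univ (mem_univ x)
  have hYf : ∀ x ∈ U, IsFieldAt s Y x := fun x hx => hY.isFieldAt vol hU hx
  set W : ∀ x : M, TangentSpace (𝓡 n) x := fun x => Y x - X x with hW
  have hWf : ∀ x ∈ U, IsFieldAt s W x := fun x hx => (hYf x hx).sub (hXf x)
  have hWd : ∀ x ∈ U, divergence vol W x = 0 := fun x hx => by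
    rw [hW, divergence_sub vol ((hYf x hx).of_le hs) ((hXf x).of_le hs),
      hY.divergence_eq_zero vol hx, hX.divergence_eq_zero vol (mem_univ x), sub_zero]
  obtain ⟨v, hv, hv0, hvd, hvB⟩ := hC₂ s hrs W hWf hWd B hB.le hWB
  have hfW : ∀ x, IsFieldAt s (fun x => f x • W x) x :=
    isFieldAt_smul_of_tsupport_subset hf hfU hWf
  have hfWv : ∀ x, IsFieldAt s (fun x => f x • W x - v x) x := fun x => (hfW x).sub (hv x)
  set Z₀ : ∀ x : M, TangentSpace (𝓡 n) x := fun x => X x + (f x • W x - v x) with hZ₀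
  have hZ₀f : ∀ x, IsFieldAt s Z₀ x := fun x => (hXf x).add (hfWv x)
  have hZ₀d : ∀ x, divergence vol Z₀ x = 0 := fun x => by
    rw [hZ₀, divergence_add vol ((hXf x).of_le hs) ((hfWv x).of_le hs),
      divergence_sub vol ((hfW x).of_le hs) ((hv x).of_le hs), hvd,
      hX.divergence_eq_zero vol (mem_univ x), sub_self, add_zero]
  have hZ₀X : ∀ x ∉ tsupport f, x ∉ T' → Z₀ x = X x := fun x hx hx' => by
    simp only [hZ₀]
    rw [image_eq_zero_of_notMem_tsupport hx, hv0 x hx', zero_smul, sub_zero, add_zero]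
  have hZ₀Y : ∀ x ∈ N, x ∉ T' → Z₀ x = Y x := fun x hx hx' => by
    simp only [hZ₀]
    rw [hfN x hx, hv0 x hx', one_smul, sub_zero, hW, add_sub_cancel]
  obtain ⟨Z, hZf, hZd, hZZ₀, hZsm, hZB⟩ := exists_smoothing vol hs hrs t
    (e := fun i => chartAt (Euc n) i) (fun i _ => chart_mem i) hR0 hR 𝒜 hZ₀f hZ₀d hB
  refine ⟨Z, isDivFreeFieldOn_of vol hs (fun x _ => hZf x) (fun x _ => hZd x), fun x hx => ?_, ?_,
    ?_, fun x hxX hxY => ?_⟩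
  · rw [hZZ₀ x fun h => hx.2.2 (hOQ h), hZ₀Y x hx.1 hx.2.1]
  · refine eventually_nhdsSet_iff_exists.2 ⟨(tsupport f)ᶜ ∩ (T'ᶜ ∩ Qᶜ),
      (isClosed_tsupport f).isOpen_compl.inter
        (hT'.isClosed.isOpen_compl.inter hQc.isClosed.isOpen_compl),
      fun x hx => ⟨fun h => hx (hfU h), fun h => hx (hTG' h).1, fun h => hx (hQG h).1⟩,
      fun x hx => ?_⟩
    rw [hZZ₀ x fun h => hx.2.2 (hOQ h), hZ₀X x hx.1 hx.2.1]
  · have hv' : ∀ x, IsFieldAt s (fun x => (-1 : ℝ) • v x) x := fun x =>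
      (hv x).smul (f := fun _ => (-1 : ℝ)) contMDiff_const
    have h1 := hC₁ W (fun x hx => (hWf x hx).of_le hrs) B hB.le hWB
    have h2 := h1.add (hvB.const_smul (fun x _ => (hv x).of_le hrs) (-1))
      (fun x _ => (hfW x).of_le hrs) (fun x _ => (hv' x).of_le hrs)
    have h3 := hZB.add h2 (fun x _ => ((hZf x).sub (hZ₀f x)).of_le hrs)
      (fun x _ => ((hfW x).add (hv' x)).of_le hrs)
    have h4 : (fun x => Z x - Z₀ x + (f x • W x + (-1 : ℝ) • v x)) = fun x => Z x - X x := by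
      ext1 x
      simp only [hZ₀, neg_smul, one_smul]
      abel
    rw [h4] at h3
    refine h3.mono ?_
    rw [abs_neg, abs_one]
    nlinarith
  -- Outside the smoothed set `O` the field is still `Z₀`, and `O` covers `T ∪ T'`. Off `T ∪ T'` the
  -- correction vanishes and either `f = 1`, so that `Z₀ = Y`, or `f = 0`, so that `Z₀ = X`.
  · refine hZsm x (by_contra fun hxO => ?_)
    have hxT : x ∉ T ∪ T' := fun h => hxO (hcov h)
    rw [hZZ₀ x hxO] at hxX hxY
    rcases hTN x fun h => hxT (Or.inl h) with h | h
    · exact hxY (hNU h) (hZ₀Y x h fun h' => hxT (Or.inr h'))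
    · exact hxX (hZ₀X x h fun h' => hxT (Or.inr h'))

end Pasting

end ConservativePasting

end

/-! ### The pasting theorem. -/

open ConservativePasting in
theorem theorem1 {n : ℕ} (hn : 2 ≤ n) {M : Type*} [TopologicalSpace M] [T2Space M]
    [CompactSpace M] [ConnectedSpace M] [ChartedSpace (EuclideanSpace ℝ (Fin n)) M]
    [IsManifold (𝓡 n) ∞ M] (vol : VolumeForm n M)
    (K U : Set M) (hK : IsCompact K) (hU : IsOpen U) (hKU : K ⊆ U) (hU_ne : U ≠ Set.univ)
    (hUK : IsPreconnected (U \ K)) :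
    ∃ V : Set M, IsOpen V ∧ K ⊆ V ∧ V ⊆ U ∧
      ∀ (𝒜 : RegularAtlas n M) (r : ℕ), 1 ≤ r →
        ∃ C : ℝ≥0, 1 < C ∧
          ∀ s : ℕ∞, (r : ℕ∞) ≤ s →
            ∀ X Y : ∀ x : M, TangentSpace (𝓡 n) x,
              IsDivFreeFieldOn vol s Set.univ X →
              IsDivFreeFieldOn vol s U Y → IsCrBoundedOn 𝒜 r U Y →
                ∃ Z : ∀ x : M, TangentSpace (𝓡 n) x,
                  IsDivFreeFieldOn vol s Set.univ Z ∧
                  (∀ x ∈ V, Z x = Y x) ∧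
                  (∀ᶠ x in 𝓝ˢ Uᶜ, Z x = X x) ∧
                  whitneyNorm 𝒜 r Set.univ (fun x => Z x - X x) ≤
                    (C : ENNReal) * whitneyNorm 𝒜 r U (fun x => Y x - X x) ∧
                  (∀ x, Z x ≠ X x → (x ∈ U → Z x ≠ Y x) →
                    ContMDiffAt (𝓡 n) (𝓡 n).tangent ∞
                      (fun x => (⟨x, Z x⟩ : TangentBundle (𝓡 n) M)) x) := by
  have hzero : ∀ (𝒜 : RegularAtlas n M) (r : ℕ) (X : ∀ x : M, TangentSpace (𝓡 n) x) (c : ENNReal),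
      whitneyNorm 𝒜 r Set.univ (fun x => X x - X x) ≤ c := fun 𝒜 r X c => by
    simp only [sub_self]
    refine (whitneyNorm_le_of_atlasBound atlasBound_zero).trans ?_
    simp
  rcases (U \ K).eq_empty_or_nonempty with hempty | hne
  -- Here `U = K` is open and closed in the connected manifold `M` and is not `M`, so it is empty
  -- and `Z = X` will do.
  · have hUeq : U = K := (Set.sdiff_eq_empty.1 hempty).antisymm hKU
    have hU0 : U = ∅ := (isClopen_iff.1 ⟨hUeq ▸ hK.isClosed, hU⟩).resolve_right hU_ne
    refine ⟨∅, isOpen_empty, by rw [← hUeq, hU0], Set.empty_subset _, fun 𝒜 r hr =>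
      ⟨2, one_lt_two, fun s hrs X Y hX _ _ => ⟨X, hX, by simp, Filter.Eventually.of_forall
        fun _ => rfl, hzero 𝒜 r X _, fun x hx => (hx rfl).elim⟩⟩⟩
  obtain ⟨V, hV, hKV, hVU, h⟩ := exists_pasting vol (one_le_two.trans hn) hK hU hKU hUK hne
  refine ⟨V, hV, hKV, hVU, fun 𝒜 r hr => ?_⟩
  obtain ⟨C, hC1, hC⟩ := h 𝒜 r hr
  refine ⟨⟨C, zero_le_one.trans hC1.le⟩, hC1, fun s hrs X Y hX hY hYb => ?_⟩
  obtain ⟨B', hB'⟩ := exists_atlasBound_sub 𝒜 r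
    (fun x => (hX.isFieldAt vol isOpen_univ (Set.mem_univ x)).of_le hrs)
    (fun x hx => (hY.isFieldAt vol hU hx).of_le hrs) hYb
  have hfin : whitneyNorm 𝒜 r U (fun x => Y x - X x) ≠ ⊤ :=
    ((whitneyNorm_le_of_atlasBound hB').trans_lt ENNReal.ofReal_lt_top).ne
  have hWB := atlasBound_of_whitneyNorm_ne_top hfin
  -- The norm of `Y - X` also serves as the tolerance of the smoothing and must then be positive. If
  -- it is zero, `X = Y` on `U` and `Z = X` works.
  rcases (ENNReal.toReal_nonneg (a := whitneyNorm 𝒜 r U fun x => Y x - X x)).eq_or_lt' with h0 | h0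
  · rw [h0] at hWB
    exact ⟨X, hX, fun x hx => (sub_eq_zero.1 (hWB.eq_zero (hVU hx))).symm,
      Filter.Eventually.of_forall fun _ => rfl, hzero 𝒜 r X _, fun x hx => (hx rfl).elim⟩
  · obtain ⟨Z, hZ, hZV, hZU, hZB, hZs⟩ := hC s hrs X Y hX hY _ h0 hWB
    refine ⟨Z, hZ, hZV, hZU, (whitneyNorm_le_of_atlasBound hZB).trans (le_of_eq ?_), hZs⟩
    rw [ENNReal.ofReal_mul (zero_le_one.trans hC1.le), ENNReal.ofReal_toReal hfin,
      ENNReal.ofReal_eq_coe_nnreal (zero_le_one.trans hC1.le)]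
    rfl
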